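/- Fix $n\ge 1$. An additive category is a preadditive category with a zero object and binary biproducts. **Definitions.** Let $\mathcal D$ be an additive category and $\mathbb G\colon\mathcal D^{\mathrm{op}}\times\mathcal D\to\mathsf{Ab}$ a biadditive functor. For $\delta\in\mathbb G(C,A)$, $a\colon A\to B$, $c\colon D\to C$ put $a_*\delta=\mathbb G(C,a)(\delta)$ and $c^*\delta=\mathbb G(c,A)(\delta)$. For $A,C\in\mathcal D$ let $\mathbf C^{n+2}_{(\mathcal D;A,C)}$ be the category of complexes $X_\bullet=(X_0\xrightarrow{d_0}X_1\to\cdots\xrightarrow{d_n}X_{n+1})$ in $\mathcal D$ with $X_0=A$, $X_{n+1}=C$, with morphisms the chain maps $f_\bullet$ with $f_0=\mathrm{id}_A$, $f_{n+1}=\mathrm{id}_C$; let $[X_\bullet]$ be the class of $X_\bullet$ under homotopy equivalence in this category (two morphisms being homotopic if their difference is null-homotopic as a chain map). The pair $\langle X_\bullet,\delta\rangle$ with $\delta\in\mathbb G(C,A)$ is an *$n$-exangle* if $(d_0)_*\delta=0$, $(d_n)^*\delta=0$, and for every $W\in\mathcal D$ the sequences $\mathcal D(W,X_0)\to\cdots\to\mathcal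 D(W,X_{n+1})\to\mathbb G(W,X_0)$ and $\mathcal D(X_{n+1},W)\to\cdots\to\mathcal D(X_0,W)\to\mathbb G(X_{n+1},W)$, with last maps $g\mapsto g^*\delta$ and $g\mapsto g_*\delta$, are exact. An *exact realisation* $\mathfrak r$ of $\mathbb G$ assigns to each $\delta\in\mathbb G(C,A)$ a class $\mathfrak r(\delta)=[X_\bullet]$ with $X_\bullet\in\mathbf C^{n+2}_{(\mathcal D;A,C)}$ such that: * (R0) if $\mathfrak r(\delta)=[X_\bullet]$, $\mathfrak r(\rho)=[Y_\bullet]$ with $\delta\in\mathbb G(C,A)$, $\rho\in\mathbb G(D,B)$, and $a\colon A\to B$, $c\colon C\to D$ satisfy $a_*\delta=c^*\rho$, then there is a chain map $f_\bullet\colon X_\bullet\to Y_\bullet$ with $f_0=a$, $f_{n+1}=c$ (a *lift* of $(a,c)$); * (R1) if $\mathfrak r(\delta)=[X_\bullet]$ then $\langle X_\bullet,\delta\rangle$ is an $n$-exangle (such $n$-exangles are called *$\mathfrak r$-distinguished*); * (R2) the zero elements of $\mathbb G(0,A)$ and $\mathbb G(C,0)$ are realised by $A\xrightarrow{\mathrm{id}}A\to0\to\cdots\to0$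 and $0\to\cdots\to0\to C\xrightarrow{\mathrm{id}}C$, respectively, for every zero object $0$. The first differentials $d_0$ of $\mathfrak r$-distinguished $n$-exangles are the *$\mathfrak r$-inflations*, the last differentials $d_n$ the *$\mathfrak r$-deflations*. The triplet $(\mathcal D,\mathbb G,\mathfrak r)$ is an *$n$-exangulated category* if, moreover: * (EA1), (EA1$^{\mathrm{op}}$) $\mathfrak r$-inflations are closed under composition, and so are $\mathfrak r$-deflations; * (EA2) for $c\colon C\to D$, $\rho\in\mathbb G(D,A)$ and $\mathfrak r$-distinguished $\langle X_\bullet,c^*\rho\rangle$, $\langle Y_\bullet,\rho\rangle$, there is a lift $f_\bullet$ of $(\mathrm{id}_A,c)$ such that $\langle M^f_\bullet,(d^X_0)_*\rho\rangle$ is $\mathfrak r$-distinguished, where $M^f_\bullet$ is the mapping cone $X_1\to X_2\oplus Y_1\to\cdots\to X_{n+1}\oplus Y_n\to Y_{n+1}$ with differentials $\left[\begin{smallmatrix}-d^X&0\\ f&d^Y\end{smallmatrix}\right]$ (restricted to $\left[\begin{smallmatrix}-d^X_1\\ f_1\end{smallmatrix}\right]$ at the left end and $\left[\begin{smallmatrix}f_{n+1}&d^Y_n\end{smallmatrix}\right]$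 at the right end); * (EA2$^{\mathrm{op}}$) for $a\colon A\to B$, $\delta\in\mathbb G(C,A)$ and $\mathfrak r$-distinguished $\langle X_\bullet,\delta\rangle$, $\langle Y_\bullet,a_*\delta\rangle$, there is a lift $f_\bullet$ of $(a,\mathrm{id}_C)$ such that $\langle N^f_\bullet,(d^Y_n)^*\delta\rangle$ is $\mathfrak r$-distinguished, where $N^f_\bullet$ is the mapping cocone $X_0\to X_1\oplus Y_0\to\cdots\to X_n\oplus Y_{n-1}\to Y_n$ with differentials $\left[\begin{smallmatrix}d^X&0\\ f&-d^Y\end{smallmatrix}\right]$ (restricted to $\left[\begin{smallmatrix}d^X_0\\ f_0\end{smallmatrix}\right]$ and $\left[\begin{smallmatrix}f_n&-d^Y_{n-1}\end{smallmatrix}\right]$ at the ends). An *$n$-exangulated functor* $(\mathscr F,\Gamma)\colon(\mathcal D,\mathbb G,\mathfrak r)\to(\mathcal D',\mathbb G',\mathfrak r')$ is an additive functor $\mathscr F\colon\mathcal D\to\mathcal D'$ with a natural transformation $\Gamma\colon\mathbb G(-,-)\Rightarrow\mathbb G'(\mathscr F-,\mathscr F-)$ such that $\mathfrak r(\delta)=[X_\bullet]$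 implies $\mathfrak r'(\Gamma(\delta))=[\mathscr F(X_\bullet)]$. An *additive subcategory* $\mathcal A\subset\mathcal C$ is a full subcategory that is closed under isomorphisms, contains a zero object and is closed under biproducts of two objects (closure under direct summands is not required). For an $n$-exangulated category $(\mathcal C,\mathbb E,\mathfrak s)$ it is *$n$-extension closed* if for all $A,C\in\mathcal A$ every $\delta\in\mathbb E(C,A)$ admits an $\mathfrak s$-distinguished $n$-exangle $\langle X_\bullet,\delta\rangle$ with $X_i\in\mathcal A$ for $0\le i\le n+1$. **Theorem.** Let $(\mathcal C,\mathbb E,\mathfrak s)$ be an $n$-exangulated category and $\mathcal A\subset\mathcal C$ an $n$-extension closed additive subcategory with inclusion $\mathscr I_{\mathcal A}$. Let $\mathbb F(-,-)=\mathbb E(\mathscr I_{\mathcal A}-,\mathscr I_{\mathcal A}-)$, let $\Theta_{\mathcal A}\colon\mathbb F(-,-)\Rightarrow\mathbb E(\mathscr I_{\mathcal A}-,\mathscr I_{\mathcal A}-)$ be $\delta\mapsto\delta$, and for $\delta\in\mathbb F(C,A)$ let $\mathfrak t(\delta)=[X_\bullet]$ be the class, formed in $\mathcal A$, of an $\mathfrak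 s$-distinguished $\langle X_\bullet,\delta\rangle$ with all terms in $\mathcal A$. Then: 1. $\mathfrak t$ does not depend on the choices: for $A,C\in\mathcal A$, $\delta\in\mathbb F(C,A)$ and $X_\bullet\in\mathbf C^{n+2}_{(\mathcal A;A,C)}$ one has $\mathfrak t(\delta)=[X_\bullet]$ in $\mathcal A$ if and only if $\mathfrak s(\delta)=[\mathscr I_{\mathcal A}(X_\bullet)]$ in $\mathcal C$; 2. $(\mathcal A,\mathbb F,\mathfrak t)$ is an $n$-exangulated category; 3. $(\mathscr I_{\mathcal A},\Theta_{\mathcal A})\colon(\mathcal A,\mathbb F,\mathfrak t)\to(\mathcal C,\mathbb E,\mathfrak s)$ is an $n$-exangulated functor, $\mathscr I_{\mathcal A}$ is full and faithful, and $\Theta_{\mathcal A}$ is a natural isomorphism. -/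

import Mathlib

open CategoryTheory CategoryTheory.Limits Opposite

universe w v v' u u'

namespace NExangulated

noncomputable section

/-! Additive categories are preadditive categories with a zero object and binary biproducts, and complexes
concentrated in degrees `0, …, n+1` are `ℕ`-indexed cochain complexes all of whose terms in
degrees `> n+1` are zero objects. -/

section Complexes

variable {D : Type u} [Category.{v} D] [Preadditive D]

/-- The objects of the category `C^{n+2}_{(D;A,C)}`: complexes `X` in `D` concentrated in degrees
`0, …, n+1` with `X₀ = A` and `X_{n+1} = C`. -/
structure ComplexBetween (n : ℕ) (A C : D) where
  /-- the underlying complex -/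
  cpx : CochainComplex D ℕ
  isZero : ∀ i, n + 1 < i → IsZero (cpx.X i)
  left : cpx.X 0 = A
  right : cpx.X (n + 1) = C

variable {n : ℕ}

namespace ComplexBetween

variable {A C : D} (X : ComplexBetween n A C)

/-- The identification `X₀ = A`. -/
def isoLeft : X.cpx.X 0 ≅ A := eqToIso X.left

/-- The identification `X_{n+1} = C`. -/
def isoRight : X.cpx.X (n + 1) ≅ C := eqToIso X.right

/-- The first differential `d₀ : A ⟶ X₁`. -/
def dLeft : A ⟶ X.cpx.X 1 := X.isoLeft.inv ≫ X.cpx.d 0 1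

/-- The last differential `d_n : X_n ⟶ C`. -/
def dRight : X.cpx.X n ⟶ C := X.cpx.d n (n + 1) ≫ X.isoRight.hom

end ComplexBetween

/-- The morphism of complexes `f : X ⟶ Y` satisfies `f₀ = a` and `f_{n+1} = c`. -/
structure IsLift {A B C C' : D} (X : ComplexBetween n A C) (Y : ComplexBetween n B C')
    (f : X.cpx ⟶ Y.cpx) (a : A ⟶ B) (c : C ⟶ C') : Prop where
  left : f.f 0 ≫ Y.isoLeft.hom = X.isoLeft.hom ≫ a
  right : f.f (n + 1) ≫ Y.isoRight.hom = X.isoRight.hom ≫ c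

lemma IsLift.comp {A B C C' A' C'' : D} {X : ComplexBetween n A C} {Y : ComplexBetween n B C'}
    {Z : ComplexBetween n A' C''} {f : X.cpx ⟶ Y.cpx} {g : Y.cpx ⟶ Z.cpx}
    {a : A ⟶ B} {c : C ⟶ C'} {b : B ⟶ A'} {e : C' ⟶ C''}
    (hf : IsLift X Y f a c) (hg : IsLift Y Z g b e) :
    IsLift X Z (f ≫ g) (a ≫ b) (c ≫ e) where
  left := by
    rw [HomologicalComplex.comp_f, Category.assoc, hg.left, ← Category.assoc, hf.left,
      Category.assoc]
  right := by
    rw [HomologicalComplex.comp_f, Category.assoc, hg.right, ← Category.assoc, hf.right,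
      Category.assoc]

lemma IsLift.id {A C : D} (X : ComplexBetween n A C) : IsLift X X (𝟙 X.cpx) (𝟙 A) (𝟙 C) where
  left := by simp
  right := by simp

/-- Homotopy equivalence in `C^{n+2}_{(D;A,C)}`, whose morphisms are the morphisms of complexes
`f` with `f₀ = id_A` and `f_{n+1} = id_C`. -/
def HtpyEquivBetween {A C : D} (X Y : ComplexBetween n A C) : Prop :=
  ∃ (f : X.cpx ⟶ Y.cpx) (g : Y.cpx ⟶ X.cpx),
    IsLift X Y f (𝟙 A) (𝟙 C) ∧ IsLift Y X g (𝟙 A) (𝟙 C) ∧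
      Nonempty (Homotopy (f ≫ g) (𝟙 X.cpx)) ∧ Nonempty (Homotopy (g ≫ f) (𝟙 Y.cpx))

lemma htpyEquivBetween_equivalence (n : ℕ) (A C : D) :
    Equivalence (HtpyEquivBetween (n := n) (A := A) (C := C)) where
  refl X := ⟨𝟙 _, 𝟙 _, IsLift.id X, IsLift.id X, ⟨Homotopy.ofEq (Category.comp_id _)⟩,
    ⟨Homotopy.ofEq (Category.comp_id _)⟩⟩
  symm := fun ⟨f, g, hf, hg, h, h'⟩ => ⟨g, f, hg, hf, h', h⟩
  trans := by
    rintro X Y Z ⟨f, g, hf, hg, ⟨h⟩, ⟨h'⟩⟩ ⟨f₂, g₂, hf₂, hg₂, ⟨h₂⟩, ⟨h₂'⟩⟩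
    refine ⟨f ≫ f₂, g₂ ≫ g, by simpa using hf.comp hf₂, by simpa using hg₂.comp hg, ⟨?_⟩, ⟨?_⟩⟩
    · have k := (h₂.compLeft f).compRight g
      exact ((Homotopy.ofEq (by simp)).trans k).trans ((Homotopy.ofEq (by simp)).trans h)
    · have k := (h'.compLeft g₂).compRight f₂
      exact ((Homotopy.ofEq (by simp)).trans k).trans ((Homotopy.ofEq (by simp)).trans h₂')

/-- The setoid of homotopy equivalence on `C^{n+2}_{(D;A,C)}`. -/
def htpySetoid (n : ℕ) (A C : D) : Setoid (ComplexBetween n A C) :=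
  ⟨HtpyEquivBetween, htpyEquivBetween_equivalence n A C⟩

/-- Homotopy equivalence classes of objects of `C^{n+2}_{(D;A,C)}`. -/
def HtpyClass (n : ℕ) (A C : D) := Quotient (htpySetoid n A C)

/-- The homotopy equivalence class `[X]` of `X`. -/
def ComplexBetween.cls {A C : D} (X : ComplexBetween n A C) : HtpyClass n A C :=
  Quotient.mk (htpySetoid n A C) X

end Complexes

section Triv

variable {D : Type u} [Category.{v} D] [Preadditive D]

/-- The complex `0 ⟶ ⋯ ⟶ 0 ⟶ X ⟶ X ⟶ 0 ⟶ ⋯` with `id_X` from degree `i` to degree `i+1`, where all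
other terms are the given zero object `Z`. -/
def trivComplex (i : ℕ) (X Z : D) : CochainComplex D ℕ :=
  CochainComplex.of (fun j => if j = i ∨ j = i + 1 then X else Z)
    (fun j => if h : j = i then eqToHom (by rw [if_pos (Or.inl h), if_pos (by omega)]) else 0)
    (fun j => by
      by_cases h : j = i
      · rw [dif_neg (show ¬ (j + 1 = i) by omega), comp_zero]
      · rw [dif_neg h, zero_comp])

lemma trivComplex_isZero {i : ℕ} {X Z : D} (hZ : IsZero Z) {j : ℕ} (hj : i + 1 < j) :
    IsZero ((trivComplex i X Z).X j) := by
  change IsZero (if j = i ∨ j = i + 1 then X else Z)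
  rwa [if_neg (by omega)]

/-- `triv₀(A)`, with end terms `A` and the zero object `Z`. -/
def trivLeft (n : ℕ) [NeZero n] (A Z : D) (hZ : IsZero Z) : ComplexBetween n A Z where
  cpx := trivComplex 0 A Z
  isZero i hi := trivComplex_isZero hZ (by omega)
  left := by
    change (if 0 = 0 ∨ 0 = 0 + 1 then A else Z) = A
    exact if_pos (Or.inl rfl)
  right := by
    have := NeZero.ne n
    change (if _ then _ else _) = _
    exact if_neg (by omega)

/-- `triv_n(C)`, with end terms the zero object `Z` and `C`. -/
def trivRight (n : ℕ) [NeZero n] (Z C : D) (hZ : IsZero Z) : ComplexBetween n Z C where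
  cpx := trivComplex n C Z
  isZero i hi := trivComplex_isZero hZ hi
  left := by
    have := NeZero.ne n
    change (if _ then _ else _) = _
    exact if_neg (by omega)
  right := by change (if _ then _ else _) = _; exact if_pos (Or.inr rfl)

end Triv

section Cones

variable {D : Type u} [Category.{v} D] [Preadditive D] [HasBinaryBiproducts D]

variable (n : ℕ) {X Y : CochainComplex D ℕ} (f : X ⟶ Y)

/-! ### The mapping cone

`M₀ = X₁`, `Mᵢ = X_{i+1} ⊞ Yᵢ` for `1 ≤ i ≤ n` and `M_{n+1} = Y_{n+1}`. In order to write the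
differential uniformly, `coneInl`, `coneInr`, `coneFst`, `coneSnd` are the canonical
inclusions and projections between `Mᵢ` and `X_{i+1}`, `Yᵢ`, and zero where the
corresponding summand is absent. -/

variable (X Y) in
/-- The terms of the mapping cone (in degrees `> n+1` these are the terms of `Y`). -/
def coneX : ℕ → D
  | 0 => X.X 1
  | i + 1 => if i + 1 ≤ n then X.X (i + 2) ⊞ Y.X (i + 1) else Y.X (i + 1)

variable (X Y) in
lemma coneX_of_le {i : ℕ} (h : i + 1 ≤ n) :
    coneX n X Y (i + 1) = (X.X (i + 2) ⊞ Y.X (i + 1) : D) := if_pos h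

variable (X Y) in
lemma coneX_of_not_le {i : ℕ} (h : ¬ i + 1 ≤ n) : coneX n X Y (i + 1) = Y.X (i + 1) := if_neg h

variable (X Y) in
/-- The inclusion `X_{i+1} ⟶ Mᵢ` for `i ≤ n`. -/
def coneInl : ∀ i : ℕ, X.X (i + 1) ⟶ coneX n X Y i
  | 0 => 𝟙 _
  | i + 1 => if h : i + 1 ≤ n then biprod.inl ≫ eqToHom (coneX_of_le n X Y h).symm else 0

variable (X Y) in
/-- The inclusion `Yᵢ ⟶ Mᵢ` for `i ≥ 1`. -/
def coneInr : ∀ i : ℕ, Y.X i ⟶ coneX n X Y i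
  | 0 => 0
  | i + 1 => if h : i + 1 ≤ n then biprod.inr ≫ eqToHom (coneX_of_le n X Y h).symm
      else eqToHom (coneX_of_not_le n X Y h).symm

variable (X Y) in
/-- The projection `Mᵢ ⟶ X_{i+1}` for `i ≤ n`. -/
def coneFst : ∀ i : ℕ, coneX n X Y i ⟶ X.X (i + 1)
  | 0 => 𝟙 _
  | i + 1 => if h : i + 1 ≤ n then eqToHom (coneX_of_le n X Y h) ≫ biprod.fst else 0

variable (X Y) in
/-- The projection `Mᵢ ⟶ Yᵢ` for `i ≥ 1`. -/
def coneSnd : ∀ i : ℕ, coneX n X Y i ⟶ Y.X i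
  | 0 => 0
  | i + 1 => if h : i + 1 ≤ n then eqToHom (coneX_of_le n X Y h) ≫ biprod.snd
      else eqToHom (coneX_of_not_le n X Y h)

/-- The differential of the mapping cone, with matrix `[-d_X 0; f d_Y]`. -/
def coneD (i : ℕ) : coneX n X Y i ⟶ coneX n X Y (i + 1) :=
  coneFst n X Y i ≫
      (-(X.d (i + 1) (i + 2)) ≫ coneInl n X Y (i + 1) + f.f (i + 1) ≫ coneInr n X Y (i + 1)) +
    coneSnd n X Y i ≫ Y.d i (i + 1) ≫ coneInr n X Y (i + 1)

variable (X Y) in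
lemma coneInl_fst {i : ℕ} (h : i ≤ n) : coneInl n X Y i ≫ coneFst n X Y i = 𝟙 _ := by
  cases i with
  | zero => exact Category.id_comp _
  | succ i => simp [coneInl, coneFst, h]

variable (X Y) in
lemma coneInl_eq_zero {i : ℕ} (h : ¬ i ≤ n) : coneInl n X Y i = 0 := by
  cases i with
  | zero => omega
  | succ i => simp [coneInl, h]

variable (X Y) in
lemma coneInl_snd (i : ℕ) : coneInl n X Y i ≫ coneSnd n X Y i = 0 := by
  cases i with
  | zero => simp [coneSnd]
  | succ i => by_cases h : i + 1 ≤ n <;> simp [coneInl, coneSnd, h]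

variable (X Y) in
lemma coneInr_fst (i : ℕ) : coneInr n X Y i ≫ coneFst n X Y i = 0 := by
  cases i with
  | zero => simp [coneInr]
  | succ i => by_cases h : i + 1 ≤ n <;> simp [coneInr, coneFst, h]

variable (X Y) in
lemma coneInr_snd (i : ℕ) : coneInr n X Y (i + 1) ≫ coneSnd n X Y (i + 1) = 𝟙 _ := by
  by_cases h : i + 1 ≤ n <;> simp [coneInr, coneSnd, h]

lemma coneD_comp (hY : ∀ i, n + 1 < i → IsZero (Y.X i)) (i : ℕ) :
    coneD n f i ≫ coneD n f (i + 1) = 0 := by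
  have h1 := coneInl_snd n X Y (i + 1)
  have h2 := coneInr_fst n X Y (i + 1)
  have h3 := coneInr_snd n X Y i
  by_cases h : i + 1 ≤ n
  · have h4 := coneInl_fst n X Y h
    simp [coneD, reassoc_of% h1, reassoc_of% h2, reassoc_of% h3, reassoc_of% h4]
  · have h4 := coneInl_eq_zero n X Y h
    have h5 : Y.d (i + 1) (i + 2) = 0 := (hY _ (by omega)).eq_of_tgt _ _
    simp [coneD, reassoc_of% h2, h4, h5]

/-- The mapping cone
`X₁ ⟶ X₂ ⊞ Y₁ ⟶ ⋯ ⟶ X_{n+1} ⊞ Y_n ⟶ Y_{n+1}` of a morphism `f` of complexes concentrated in degrees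
`0, …, n+1`. -/
def mappingCone {n : ℕ} {A B C C' : D} (X : ComplexBetween n A C) (Y : ComplexBetween n B C')
    (f : X.cpx ⟶ Y.cpx) : ComplexBetween n (X.cpx.X 1) C' where
  cpx := CochainComplex.of (coneX n X.cpx Y.cpx) (coneD n f) (coneD_comp n f Y.isZero)
  isZero := by
    rintro (_ | i) hi
    · omega
    · change IsZero (coneX n X.cpx Y.cpx (i + 1))
      rw [coneX_of_not_le n X.cpx Y.cpx (by omega)]
      exact Y.isZero _ hi
  left := rfl
  right := (coneX_of_not_le n X.cpx Y.cpx (by omega)).trans Y.right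

/-! ### The mapping cocone

`N₀ = X₀`, `N_{i+1} = X_{i+1} ⊞ Yᵢ` for `0 ≤ i < n` and `N_{n+1} = Y_n`. As above, the canonical
inclusions and projections are zero where the corresponding summand is absent. -/

variable (X Y) in
/-- The terms of the mapping cocone (in degrees `> n+1` these are the terms of `X`). -/
def coconeX : ℕ → D
  | 0 => X.X 0
  | i + 1 => if i + 1 ≤ n then X.X (i + 1) ⊞ Y.X i else if i = n then Y.X i else X.X (i + 1)

variable (X Y) in
lemma coconeX_of_le {i : ℕ} (h : i + 1 ≤ n) :
    coconeX n X Y (i + 1) = (X.X (i + 1) ⊞ Y.X i : D) := if_pos h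

variable (X Y) in
lemma coconeX_of_eq {i : ℕ} (h : i = n) : coconeX n X Y (i + 1) = Y.X i :=
  (if_neg (by omega)).trans (if_pos h)

variable (X Y) in
/-- The inclusion `Xᵢ ⟶ Nᵢ` for `i ≤ n`. -/
def coconeInl : ∀ i : ℕ, X.X i ⟶ coconeX n X Y i
  | 0 => 𝟙 _
  | i + 1 => if h : i + 1 ≤ n then biprod.inl ≫ eqToHom (coconeX_of_le n X Y h).symm else 0

variable (X Y) in
/-- The inclusion `Yᵢ ⟶ N_{i+1}` for `i ≤ n`. -/
def coconeInr (i : ℕ) : Y.X i ⟶ coconeX n X Y (i + 1) :=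
  if h : i + 1 ≤ n then biprod.inr ≫ eqToHom (coconeX_of_le n X Y h).symm
  else if h' : i = n then eqToHom (coconeX_of_eq n X Y h').symm else 0

variable (X Y) in
/-- The projection `Nᵢ ⟶ Xᵢ` for `i ≤ n`. -/
def coconeFst : ∀ i : ℕ, coconeX n X Y i ⟶ X.X i
  | 0 => 𝟙 _
  | i + 1 => if h : i + 1 ≤ n then eqToHom (coconeX_of_le n X Y h) ≫ biprod.fst else 0

variable (X Y) in
/-- The projection `N_{i+1} ⟶ Yᵢ` for `i ≤ n`. -/
def coconeSnd (i : ℕ) : coconeX n X Y (i + 1) ⟶ Y.X i :=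
  if h : i + 1 ≤ n then eqToHom (coconeX_of_le n X Y h) ≫ biprod.snd
  else if h' : i = n then eqToHom (coconeX_of_eq n X Y h') else 0

/-- The differential of the mapping cocone, with matrix `[d_X 0; f -d_Y]`. -/
def coconeD : ∀ i : ℕ, coconeX n X Y i ⟶ coconeX n X Y (i + 1)
  | 0 => coconeFst n X Y 0 ≫ (X.d 0 1 ≫ coconeInl n X Y 1 + f.f 0 ≫ coconeInr n X Y 0)
  | i + 1 => coconeFst n X Y (i + 1) ≫
      (X.d (i + 1) (i + 2) ≫ coconeInl n X Y (i + 2) + f.f (i + 1) ≫ coconeInr n X Y (i + 1)) +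
    coconeSnd n X Y i ≫ (-(Y.d i (i + 1)) ≫ coconeInr n X Y (i + 1))

variable (X Y) in
lemma coconeInl_fst {i : ℕ} (h : i ≤ n) : coconeInl n X Y i ≫ coconeFst n X Y i = 𝟙 _ := by
  cases i with
  | zero => exact Category.id_comp _
  | succ i => simp [coconeInl, coconeFst, h]

variable (X Y) in
lemma coconeFst_eq_zero {i : ℕ} (h : ¬ i ≤ n) : coconeFst n X Y i = 0 := by
  cases i with
  | zero => omega
  | succ i => simp [coconeFst, h]

variable (X Y) in
lemma coconeInl_snd (i : ℕ) : coconeInl n X Y (i + 1) ≫ coconeSnd n X Y i = 0 := by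
  by_cases h : i + 1 ≤ n <;> simp [coconeInl, coconeSnd, h]

variable (X Y) in
lemma coconeInr_fst (i : ℕ) : coconeInr n X Y i ≫ coconeFst n X Y (i + 1) = 0 := by
  by_cases h : i + 1 ≤ n <;> simp [coconeInr, coconeFst, h]

variable (X Y) in
lemma coconeInr_snd {i : ℕ} (h : i ≤ n) : coconeInr n X Y i ≫ coconeSnd n X Y i = 𝟙 _ := by
  by_cases h' : i + 1 ≤ n
  · simp [coconeInr, coconeSnd, h']
  · have : i = n := by omega
    simp [coconeInr, coconeSnd, this]

variable (X Y) in
lemma coconeInr_eq_zero {i : ℕ} (h : ¬ i ≤ n) : coconeInr n X Y i = 0 := by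
  simp [coconeInr, show ¬ i + 1 ≤ n by omega, show i ≠ n by omega]

lemma coconeD_comp (i : ℕ) : coconeD n f i ≫ coconeD n f (i + 1) = 0 := by
  have h1 := coconeInl_snd n X Y i
  have h2 := coconeInr_fst n X Y i
  by_cases h : i + 1 ≤ n
  · have h3 := coconeInl_fst n X Y h
    have h4 := coconeInr_snd n X Y (show i ≤ n by omega)
    cases i <;> simp [coconeD, reassoc_of% h1, reassoc_of% h2, reassoc_of% h3, reassoc_of% h4]
  · have h3 := coconeFst_eq_zero n X Y h
    have h4 := coconeInr_eq_zero n X Y h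
    have : coconeD n f (i + 1) = 0 := by simp [coconeD, h3, h4]
    rw [this, comp_zero]

/-- The mapping cocone
`X₀ ⟶ X₁ ⊞ Y₀ ⟶ ⋯ ⟶ X_n ⊞ Y_{n-1} ⟶ Y_n` of a morphism `f` of complexes concentrated in degrees
`0, …, n+1`. -/
def mappingCocone {n : ℕ} {A B C C' : D} (X : ComplexBetween n A C) (Y : ComplexBetween n B C')
    (f : X.cpx ⟶ Y.cpx) : ComplexBetween n A (Y.cpx.X n) where
  cpx := CochainComplex.of (coconeX n X.cpx Y.cpx) (coconeD n f) (coconeD_comp n f)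
  isZero := by
    rintro (_ | i) hi
    · omega
    · change IsZero (if i + 1 ≤ n then _ else if i = n then _ else _)
      rw [if_neg (by omega), if_neg (by omega)]
      exact X.isZero _ hi
  left := X.left
  right := coconeX_of_eq n X.cpx Y.cpx rfl

end Cones

section Extensions

variable {D : Type u} [Category.{v} D]

/-! A bifunctor `Dᵒᵖ × D ⥤ Ab` is given in curried form `G : Dᵒᵖ ⥤ D ⥤ Ab`. -/

variable (G : Dᵒᵖ ⥤ D ⥤ AddCommGrpCat.{w})

/-- The group `G(C, A)` of `G`-extensions. -/
abbrev Extn (C A : D) : Type w := ((G.obj (op C)).obj A : Type w)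

variable {G}

/-- `a_* δ = G(C, a)(δ)`. -/
def push {A B C : D} (a : A ⟶ B) (δ : Extn G C A) : Extn G C B := (G.obj (op C)).map a δ

/-- `c^* δ = G(c, A)(δ)`. -/
def pull {A C C' : D} (c : C' ⟶ C) (δ : Extn G C A) : Extn G C' A := (G.map c.op).app A δ

variable (G) in
/-- `G` is additive in each variable. -/
structure IsBiadditive [Preadditive D] : Prop where
  push_add : ∀ {A B C : D} (a a' : A ⟶ B) (δ : Extn G C A),
    push (a + a') δ = push a δ + push a' δ
  pull_add : ∀ {A C C' : D} (c c' : C' ⟶ C) (δ : Extn G C A),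
    pull (c + c') δ = pull c δ + pull c' δ

variable [Preadditive D] {n : ℕ}

/-- `⟨X, δ⟩` is an `n`-exangle: it is a `G`-attached complex, i.e. `(d₀)_* δ = 0` and
`(d_n)^* δ = 0`, and for all `W` the sequences
`D(W, X₀) ⟶ ⋯ ⟶ D(W, X_{n+1}) ⟶ G(W, X₀)` and `D(X_{n+1}, W) ⟶ ⋯ ⟶ D(X₀, W) ⟶ G(X_{n+1}, W)`
are exact. -/
structure IsNExangle {A C : D} (X : ComplexBetween n A C) (δ : Extn G C A) : Prop where
  push_eq_zero : push X.dLeft δ = 0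
  pull_eq_zero : pull X.dRight δ = 0
  exact_cov : ∀ (W : D) (i : ℕ), i < n →
    Function.Exact (fun g : W ⟶ X.cpx.X i => g ≫ X.cpx.d i (i + 1))
      (fun g : W ⟶ X.cpx.X (i + 1) => g ≫ X.cpx.d (i + 1) (i + 2))
  exact_cov_end : ∀ W : D,
    Function.Exact (fun g : W ⟶ X.cpx.X n => g ≫ X.dRight) (fun g : W ⟶ C => pull g δ)
  exact_contra : ∀ (W : D) (i : ℕ), i < n →
    Function.Exact (fun g : X.cpx.X (i + 2) ⟶ W => X.cpx.d (i + 1) (i + 2) ≫ g)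
      (fun g : X.cpx.X (i + 1) ⟶ W => X.cpx.d i (i + 1) ≫ g)
  exact_contra_end : ∀ W : D,
    Function.Exact (fun g : X.cpx.X 1 ⟶ W => X.dLeft ≫ g) (fun g : A ⟶ W => push g δ)

/-- A map `r` assigning to each `δ ∈ G(C, A)` a homotopy equivalence class `r(δ)` of objects of
`C^{n+2}_{(D;A,C)}`. An object `X` with `r(δ) = [X]` is an `r`-realisation of `δ`, and `⟨X, δ⟩` is
then called `r`-distinguished. -/
abbrev RealisationMap (n : ℕ) (G : Dᵒᵖ ⥤ D ⥤ AddCommGrpCat.{w}) := ∀ ⦃A C : D⦄, Extn G C A → HtpyClass n A C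

/-- `r` is an exact realisation of `G`. The last two conditions are imposed for every zero object
of `D`. -/
structure IsExactRealisation [NeZero n] (r : RealisationMap n G) : Prop where
  exists_lift : ∀ {A B C C' : D} (δ : Extn G C A) (ρ : Extn G C' B)
    (X : ComplexBetween n A C) (Y : ComplexBetween n B C'), r δ = X.cls → r ρ = Y.cls →
    ∀ (a : A ⟶ B) (c : C ⟶ C'), push a δ = pull c ρ → ∃ f : X.cpx ⟶ Y.cpx, IsLift X Y f a c
  isNExangle : ∀ {A C : D} (δ : Extn G C A) (X : ComplexBetween n A C), r δ = X.cls →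
    IsNExangle X δ
  triv_left : ∀ (A Z : D) (hZ : IsZero Z), r (0 : Extn G Z A) = (trivLeft n A Z hZ).cls
  triv_right : ∀ (Z C : D) (hZ : IsZero Z), r (0 : Extn G C Z) = (trivRight n Z C hZ).cls

/-- The `r`-inflations: the morphisms `d₀` of `r`-distinguished `n`-exangles. -/
inductive IsInflation (r : RealisationMap n G) : ∀ ⦃A B : D⦄, (A ⟶ B) → Prop
  | mk {A C : D} (δ : Extn G C A) (X : ComplexBetween n A C) (h : r δ = X.cls) :
      IsInflation r X.dLeft

/-- The `r`-deflations: the morphisms `d_n` of `r`-distinguished `n`-exangles. -/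
inductive IsDeflation (r : RealisationMap n G) : ∀ ⦃B C : D⦄, (B ⟶ C) → Prop
  | mk {A C : D} (δ : Extn G C A) (X : ComplexBetween n A C) (h : r δ = X.cls) :
      IsDeflation r X.dRight

/-- `(D, G, r)` is an `n`-exangulated category. -/
structure IsNExangulated [HasZeroObject D] [HasBinaryBiproducts D] [NeZero n] (G : Dᵒᵖ ⥤ D ⥤ AddCommGrpCat.{w})
    (r : RealisationMap n G) : Prop where
  biadditive : IsBiadditive G
  exactRealisation : IsExactRealisation r
  inflation_comp : ∀ {A B B' : D} (f : A ⟶ B) (g : B ⟶ B'), IsInflation r f → IsInflation r g →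
    IsInflation r (f ≫ g)
  deflation_comp : ∀ {A B B' : D} (f : A ⟶ B) (g : B ⟶ B'), IsDeflation r f → IsDeflation r g →
    IsDeflation r (f ≫ g)
  good_lift : ∀ {A C C' : D} (c : C ⟶ C') (ρ : Extn G C' A)
    (X : ComplexBetween n A C) (Y : ComplexBetween n A C'),
    r (pull c ρ) = X.cls → r ρ = Y.cls →
    ∃ f : X.cpx ⟶ Y.cpx, IsLift X Y f (𝟙 A) c ∧ r (push X.dLeft ρ) = (mappingCone X Y f).cls
  good_lift_op : ∀ {A B C : D} (a : A ⟶ B) (δ : Extn G C A)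
    (X : ComplexBetween n A C) (Y : ComplexBetween n B C),
    r δ = X.cls → r (push a δ) = Y.cls →
    ∃ f : X.cpx ⟶ Y.cpx, IsLift X Y f a (𝟙 C) ∧ r (pull Y.dRight δ) = (mappingCocone X Y f).cls

end Extensions

section Functors

variable {D : Type u} [Category.{v} D] {D' : Type u'} [Category.{v'} D']

/-- The bifunctor `G(F -, F -)`. -/
abbrev pullbackBifunctor (G : D'ᵒᵖ ⥤ D' ⥤ AddCommGrpCat.{w}) (F : D ⥤ D') :
    Dᵒᵖ ⥤ D ⥤ AddCommGrpCat.{w} :=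
  F.op ⋙ G ⋙ (Functor.whiskeringLeft D D' AddCommGrpCat.{w}).obj F

variable [Preadditive D] [Preadditive D'] {n : ℕ}

/-- The image of a complex under an additive functor. -/
def mapBetween (F : D ⥤ D') [F.Additive] {A C : D} (X : ComplexBetween n A C) :
    ComplexBetween n (F.obj A) (F.obj C) where
  cpx := (F.mapHomologicalComplex _).obj X.cpx
  isZero i hi := F.map_isZero (X.isZero i hi)
  left := congrArg F.obj X.left
  right := congrArg F.obj X.right

/-- `(F, Γ) : (D, G, r) ⟶ (D', G', r')` is an `n`-exangulated functor. -/
structure IsNExangulatedFunctor {G : Dᵒᵖ ⥤ D ⥤ AddCommGrpCat.{w}}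
    {G' : D'ᵒᵖ ⥤ D' ⥤ AddCommGrpCat.{w}} (r : RealisationMap n G) (r' : RealisationMap n G')
    (F : D ⥤ D') (Γ : G ⟶ pullbackBifunctor G' F) : Prop where
  [additive : F.Additive]
  map_realisation : ∀ {A C : D} (δ : Extn G C A) (X : ComplexBetween n A C), r δ = X.cls →
    r' (A := F.obj A) (C := F.obj C) ((Γ.app (op C)).app A δ) = (mapBetween F X).cls

end Functors

section Subcategories

variable {D : Type u} [Category.{v} D] [Preadditive D] [HasBinaryBiproducts D]

/-- The full subcategory on `P` is an additive subcategory: `P` is closed under isomorphisms,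
contains a zero object, and is closed under biproducts of two objects. -/
class IsAdditiveSubcategory (P : ObjectProperty D) : Prop
    extends P.IsClosedUnderIsomorphisms, P.ContainsZero where
  biprod : ∀ B B' : D, P B → P B' → P (B ⊞ B')

instance (P : ObjectProperty D) [IsAdditiveSubcategory P] :
    HasBinaryBiproducts P.FullSubcategory where
  has_binary_biproduct B B' := by
    let b : BinaryBicone B B' :=
      { pt := ⟨B.obj ⊞ B'.obj, IsAdditiveSubcategory.biprod _ _ B.property B'.property⟩
        fst := ObjectProperty.homMk biprod.fst
        snd := ObjectProperty.homMk biprod.snd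
        inl := ObjectProperty.homMk biprod.inl
        inr := ObjectProperty.homMk biprod.inr
        inl_fst := by ext; simp
        inl_snd := by ext; simp
        inr_fst := by ext; simp
        inr_snd := by ext; simp }
    exact HasBinaryBiproduct.mk ⟨b, isBinaryBilimitOfTotal b (ObjectProperty.hom_ext _ biprod.total)⟩

variable {n : ℕ} {E : Dᵒᵖ ⥤ D ⥤ AddCommGrpCat.{w}}

/-- The additive subcategory on `P` is `n`-extension closed: each `δ ∈ E(C, A)` with `A`, `C` in `P`
has a realisation all of whose terms in degrees `0, …, n+1` are in `P`. -/
def IsNExtensionClosed (s : RealisationMap n E) (P : ObjectProperty D) : Prop :=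
  ∀ (A C : D), P A → P C → ∀ δ : Extn E C A,
    ∃ X : ComplexBetween n A C, s δ = X.cls ∧ ∀ i, i ≤ n + 1 → P (X.cpx.X i)

/-- A complex with all terms in `P`, viewed as a complex in the full subcategory on `P`. -/
def liftBetween (P : ObjectProperty D) [IsAdditiveSubcategory P] {A C : P.FullSubcategory}
    (X : ComplexBetween n A.obj C.obj) (hX : ∀ i, i ≤ n + 1 → P (X.cpx.X i)) :
    ComplexBetween n A C where
  cpx := HomologicalComplex.liftObjectProperty P X.cpx (fun i =>
    if hi : i ≤ n + 1 then hX i hi else P.prop_of_isZero (X.isZero i (by omega)))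
  isZero i hi := IsZero.of_full_of_faithful_of_isZero P.ι _ (X.isZero i hi)
  left := ObjectProperty.FullSubcategory.ext X.left
  right := ObjectProperty.FullSubcategory.ext X.right

variable (E) in
/-- The restriction `F = E(I -, I -)` of the bifunctor `E` to the full subcategory on `P`. -/
abbrev restrictedBifunctor (P : ObjectProperty D) :
    P.FullSubcategoryᵒᵖ ⥤ P.FullSubcategory ⥤ AddCommGrpCat.{w} :=
  pullbackBifunctor E P.ι

variable (E) in
/-- The canonical transformation `Θ : F(-, -) ⟶ E(I -, I -)`, `δ ↦ δ`. -/
def inclusionTransformation (P : ObjectProperty D) :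
    restrictedBifunctor E P ⟶ pullbackBifunctor E P.ι := 𝟙 _

/-- The induced realisation `t` on the full subcategory on `P`: `t(δ)` is the class of an
`s`-realisation of `δ` with all terms in `P`. -/
def inducedRealisation (s : RealisationMap n E) (P : ObjectProperty D) [IsAdditiveSubcategory P]
    (hP : IsNExtensionClosed s P) : RealisationMap n (restrictedBifunctor E P) :=
  fun A C δ =>
    (liftBetween P (hP A.obj C.obj A.property C.property δ).choose
      (hP A.obj C.obj A.property C.property δ).choose_spec.2).cls

end Subcategories

end

end NExangulated

open NExangulated

/-!
An `n`-extension closed additive subcategory of an `n`-exangulated category inherits the structure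
of an `n`-exangulated category.

Since the inclusion of the subcategory is fully faithful, morphisms of complexes, homotopies and the
exactness of the defining sequences restrict to it, and the inclusion commutes with mapping cones
and cocones up to an isomorphism fixing the ends. Hence a complex in the subcategory realises `δ`
there if and only if it realises `δ` in the ambient category (`inducedRealisation_eq_cls_iff`), and
every axiom except the closure of inflations and of deflations under composition restricts at once.

The composition axioms are the content of the proof: a composite of two inflations `f = d₀^X` and
`g = d₀^Y` is an inflation `d₀^Z` in the ambient category, but the terms of `Z` need not be in the
subcategory, and only the class of `Z` up to homotopy is given. The good lifts extend the long exact
sequences of an `n`-exangle by one term (`IsNExangulated.exists_pull_eq`,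
`IsNExangulated.exists_push_eq`). Let `W` be a realisation in the subcategory of the push-forward
along `d₁^X` of the extension of `Y`. The mapping cocone of a good lift `Y ⟶ W` and the mapping cone
of a good lift `X ⟶ Z` have isomorphic first morphisms (`IsNExangulated.exists_iso_dLeft_comp`).

* For `n = 1` an inflation determines the codomain of its deflation up to isomorphism
  (`IsNExangulated.nonempty_iso_right`), so the last term of `Z` is isomorphic to `W₁`.
* For `n ≥ 2` the comparison provides an extension in `E(W_n ⊞ X_{n+1}, X₀)` whose realisation in
  the subcategory has a first morphism that factors through `f ≫ g`. If `b ≫ χ` is an inflation with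
  terms in the subcategory, then so is `b` (`IsNExangulated.exists_inflation_of_comp_eq`): the
  mapping cocone of a good lift over the push-forward along `b` has first morphism `(b, d₀)`, where
  `d₀ = b ≫ χ` can be cleared by a change of coordinates, and the superfluous summand in degree `1`
  is cancelled by Gaussian elimination against a copy of it in degree `2`, created by the mapping
  cocone of a lift to a split complex. The cancellation takes place in degrees `1` and `2 ≤ n`,
  and thus leaves the ends fixed.

Deflations are treated by the dual arguments.
-/

namespace NExangulated

noncomputable section

/-! ### Calculus of extensions -/

section Calculus

variable {D : Type u} [Category.{v} D] {G : Dᵒᵖ ⥤ D ⥤ AddCommGrpCat.{w}}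

lemma push_id {A C : D} (δ : Extn G C A) : push (𝟙 A) δ = δ := by
  simp [push]

lemma pull_id {A C : D} (δ : Extn G C A) : pull (𝟙 C) δ = δ := by
  simp [pull]

lemma push_comp {A B B' C : D} (a : A ⟶ B) (b : B ⟶ B') (δ : Extn G C A) :
    push (a ≫ b) δ = push b (push a δ) := by
  simp [push]

lemma pull_comp {A C C' C'' : D} (c : C' ⟶ C) (c' : C'' ⟶ C') (δ : Extn G C A) :
    pull (c' ≫ c) δ = pull c' (pull c δ) := by
  simp [pull]

lemma push_pull {A B C C' : D} (a : A ⟶ B) (c : C' ⟶ C) (δ : Extn G C A) :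
    push a (pull c δ) = pull c (push a δ) :=
  (ConcreteCategory.congr_hom ((G.map c.op).naturality a) δ).symm

@[simp]
lemma push_zero {A B C : D} (a : A ⟶ B) : push a (0 : Extn G C A) = 0 :=
  map_zero ((G.obj (op C)).map a).hom

@[simp]
lemma pull_zero {A C C' : D} (c : C' ⟶ C) : pull c (0 : Extn G C A) = 0 :=
  map_zero ((G.map c.op).app A).hom

lemma push_add {A B C : D} (a : A ⟶ B) (δ ε : Extn G C A) :
    push a (δ + ε) = push a δ + push a ε :=
  map_add ((G.obj (op C)).map a).hom δ ε

lemma pull_add {A C C' : D} (c : C' ⟶ C) (δ ε : Extn G C A) :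
    pull c (δ + ε) = pull c δ + pull c ε :=
  map_add ((G.map c.op).app A).hom δ ε

variable [Preadditive D]

lemma IsBiadditive.zero_push (hG : IsBiadditive G) {A B C : D} (δ : Extn G C A) :
    push (0 : A ⟶ B) δ = 0 := by
  have := hG.push_add (0 : A ⟶ B) 0 δ
  simpa using this

lemma IsBiadditive.zero_pull (hG : IsBiadditive G) {A C C' : D} (δ : Extn G C A) :
    pull (0 : C' ⟶ C) δ = 0 := by
  have := hG.pull_add (0 : C' ⟶ C) 0 δ
  simpa using this

lemma IsBiadditive.sub_push (hG : IsBiadditive G) {A B C : D} (a b : A ⟶ B) (δ : Extn G C A) :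
    push (a - b) δ = push a δ - push b δ := by
  have := hG.push_add (a - b) b δ
  rw [sub_add_cancel] at this
  rw [this, add_sub_cancel_right]

lemma IsBiadditive.sub_pull (hG : IsBiadditive G) {A C C' : D} (c d : C' ⟶ C) (δ : Extn G C A) :
    pull (c - d) δ = pull c δ - pull d δ := by
  have := hG.pull_add (c - d) d δ
  rw [sub_add_cancel] at this
  rw [this, add_sub_cancel_right]

end Calculus

/-! ### Realisations and exactness -/

section Realisations

variable {D : Type u} [Category.{v} D] [Preadditive D] {G : Dᵒᵖ ⥤ D ⥤ AddCommGrpCat.{w}} {n : ℕ}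

lemma exists_realisation (r : RealisationMap n G) {A C : D} (δ : Extn G C A) :
    ∃ X : ComplexBetween n A C, r δ = X.cls := by
  obtain ⟨X, hX⟩ := Quotient.exists_rep (r δ)
  exact ⟨X, hX.symm⟩

lemma ComplexBetween.cls_eq_iff {A C : D} (X Y : ComplexBetween n A C) :
    X.cls = Y.cls ↔ HtpyEquivBetween X Y :=
  ⟨fun h => Quotient.exact h, fun h => Quotient.sound h⟩

namespace ComplexBetween

variable {A B C C' : D} {X : ComplexBetween n A C} {Y : ComplexBetween n B C'}

lemma isoLeft_hom_dLeft (X : ComplexBetween n A C) :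
    X.isoLeft.hom ≫ X.dLeft = X.cpx.d 0 1 := by
  simp [dLeft]

lemma dRight_isoRight_inv (X : ComplexBetween n A C) :
    X.dRight ≫ X.isoRight.inv = X.cpx.d n (n + 1) := by
  simp [dRight]

@[simp]
lemma dLeft_d (X : ComplexBetween n A C) (i : ℕ) : X.dLeft ≫ X.cpx.d 1 i = 0 := by
  simp [dLeft]

@[simp]
lemma d_dRight (X : ComplexBetween n A C) (i : ℕ) : X.cpx.d i n ≫ X.dRight = 0 := by
  simp [dRight]

end ComplexBetween

namespace IsLift

variable {A B C C' : D} {X : ComplexBetween n A C} {Y : ComplexBetween n B C'}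
  {f : X.cpx ⟶ Y.cpx} {a : A ⟶ B} {c : C ⟶ C'}

lemma isoLeft_inv (h : IsLift X Y f a c) :
    X.isoLeft.inv ≫ f.f 0 = a ≫ Y.isoLeft.inv := by
  rw [Iso.inv_comp_eq, ← Category.assoc, Iso.eq_comp_inv, h.left]

lemma dLeft_comp (h : IsLift X Y f a c) : X.dLeft ≫ f.f 1 = a ≫ Y.dLeft := by
  rw [ComplexBetween.dLeft, ComplexBetween.dLeft, Category.assoc, ← f.comm, ← Category.assoc,
    h.isoLeft_inv, Category.assoc]

lemma comp_dRight (h : IsLift X Y f a c) : f.f n ≫ Y.dRight = X.dRight ≫ c := by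
  rw [ComplexBetween.dRight, ComplexBetween.dRight, Category.assoc, ← h.right, ← Category.assoc,
    f.comm, Category.assoc]

end IsLift

namespace IsNExangle

variable {A C : D} {X : ComplexBetween n A C} {δ : Extn G C A}

lemma exists_of_push_eq_zero (h : IsNExangle X δ) {W : D} (g : A ⟶ W) (hg : push g δ = 0) :
    ∃ k : X.cpx.X 1 ⟶ W, X.dLeft ≫ k = g :=
  (h.exact_contra_end W g).1 hg

lemma exists_of_pull_eq_zero (h : IsNExangle X δ) {W : D} (g : W ⟶ C) (hg : pull g δ = 0) :
    ∃ k : W ⟶ X.cpx.X n, k ≫ X.dRight = g :=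
  (h.exact_cov_end W g).1 hg

lemma exists_of_dLeft_comp_eq_zero [NeZero n] (h : IsNExangle X δ) {W : D}
    (g : X.cpx.X 1 ⟶ W) (hg : X.dLeft ≫ g = 0) :
    ∃ k : X.cpx.X 2 ⟶ W, X.cpx.d 1 2 ≫ k = g :=
  (h.exact_contra W 0 (NeZero.pos n) g).1 (by
    change X.cpx.d 0 1 ≫ g = 0
    rw [← X.isoLeft_hom_dLeft, Category.assoc, hg, comp_zero])

end IsNExangle

/-- Two consecutive differentials at the right end, in the indexing `n = m + 1` in which the
degree `n - 1` can be named. -/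
lemma IsNExangle.exists_of_comp_dRight_eq_zero {m : ℕ} {A C : D}
    {X : ComplexBetween (m + 1) A C} {δ : Extn G C A} (h : IsNExangle X δ) {W : D}
    (g : W ⟶ X.cpx.X (m + 1)) (hg : g ≫ X.dRight = 0) :
    ∃ k : W ⟶ X.cpx.X m, k ≫ X.cpx.d m (m + 1) = g :=
  (h.exact_cov W m (Nat.lt_succ_self m) g).1 (by
    change g ≫ X.cpx.d (m + 1) (m + 1 + 1) = 0
    rw [← X.dRight_isoRight_inv, ← Category.assoc, hg, zero_comp])

end Realisations

/-! ### Mapping cones and cocones as biproducts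

The terms of the mapping cone and of the mapping cocone are used only through the inclusions and
projections below, which are typed by the terms of the complexes themselves. -/

section ConeFormulas

variable {D : Type u} [Category.{v} D] [Preadditive D] [HasBinaryBiproducts D] {n : ℕ}
  {A B C C' : D} (X : ComplexBetween n A C) (Y : ComplexBetween n B C') (f : X.cpx ⟶ Y.cpx)

namespace mappingCone

/-- The inclusion of `X_{i+1}` into the `i`-th term of the mapping cone (zero for `i > n`). -/
def inl (i : ℕ) : X.cpx.X (i + 1) ⟶ (mappingCone X Y f).cpx.X i := coneInl n X.cpx Y.cpx i

/-- The inclusion of `Yᵢ` into the `i`-th term of the mapping cone (zero for `i = 0`). -/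
def inr (i : ℕ) : Y.cpx.X i ⟶ (mappingCone X Y f).cpx.X i := coneInr n X.cpx Y.cpx i

/-- The projection of the `i`-th term of the mapping cone to `X_{i+1}` (zero for `i > n`). -/
def fst (i : ℕ) : (mappingCone X Y f).cpx.X i ⟶ X.cpx.X (i + 1) := coneFst n X.cpx Y.cpx i

/-- The projection of the `i`-th term of the mapping cone to `Yᵢ` (zero for `i = 0`). -/
def snd (i : ℕ) : (mappingCone X Y f).cpx.X i ⟶ Y.cpx.X i := coneSnd n X.cpx Y.cpx i

lemma inl_fst {i : ℕ} (h : i ≤ n) : inl X Y f i ≫ fst X Y f i = 𝟙 _ :=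
  coneInl_fst n X.cpx Y.cpx h

lemma inl_eq_zero {i : ℕ} (h : ¬ i ≤ n) : inl X Y f i = 0 :=
  coneInl_eq_zero n X.cpx Y.cpx h

@[simp]
lemma inl_snd (i : ℕ) : inl X Y f i ≫ snd X Y f i = 0 :=
  coneInl_snd n X.cpx Y.cpx i

@[simp]
lemma inr_fst (i : ℕ) : inr X Y f i ≫ fst X Y f i = 0 :=
  coneInr_fst n X.cpx Y.cpx i

@[simp]
lemma inr_snd (i : ℕ) : inr X Y f (i + 1) ≫ snd X Y f (i + 1) = 𝟙 _ :=
  coneInr_snd n X.cpx Y.cpx i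

lemma total (i : ℕ) :
    fst X Y f i ≫ inl X Y f i + snd X Y f i ≫ inr X Y f i = 𝟙 _ := by
  change coneFst n X.cpx Y.cpx i ≫ coneInl n X.cpx Y.cpx i +
    coneSnd n X.cpx Y.cpx i ≫ coneInr n X.cpx Y.cpx i = 𝟙 (coneX n X.cpx Y.cpx i)
  generalize X.cpx = K
  generalize Y.cpx = L
  cases i with
  | zero =>
    simp only [coneSnd, zero_comp, add_zero]
    exact Category.id_comp (𝟙 (K.X 1))
  | succ i =>
    by_cases h : i + 1 ≤ n
    · simp only [coneFst, coneInl, coneSnd, coneInr, dif_pos h, Category.assoc]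
      rw [← cancel_epi (eqToHom (coneX_of_le n K L h).symm),
        ← cancel_mono (eqToHom (coneX_of_le n K L h))]
      simp [biprod.total]
    · simp [coneFst, coneInl, coneSnd, coneInr, h]

lemma d_eq (i : ℕ) : (mappingCone X Y f).cpx.d i (i + 1) =
    fst X Y f i ≫
        (-(X.cpx.d (i + 1) (i + 2)) ≫ inl X Y f (i + 1) + f.f (i + 1) ≫ inr X Y f (i + 1)) +
      snd X Y f i ≫ Y.cpx.d i (i + 1) ≫ inr X Y f (i + 1) :=
  CochainComplex.of_d (coneX n X.cpx Y.cpx) (coneD n f) i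

lemma inr_isoRight :
    inr X Y f (n + 1) ≫ (mappingCone X Y f).isoRight.hom = Y.isoRight.hom := by
  have h : inr X Y f (n + 1) =
      eqToHom (coneX_of_not_le n X.cpx Y.cpx (show ¬ n + 1 ≤ n by omega)).symm :=
    dif_neg (show ¬ n + 1 ≤ n by omega)
  rw [h]
  exact eqToHom_trans _ (mappingCone X Y f).right

lemma dLeft_eq :
    (mappingCone X Y f).dLeft = -(X.cpx.d 1 2) ≫ inl X Y f 1 + f.f 1 ≫ inr X Y f 1 := by
  have h : (mappingCone X Y f).isoLeft.inv = inl X Y f 0 := rfl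
  have h' : snd X Y f 0 = 0 := rfl
  rw [ComplexBetween.dLeft, d_eq, h, h', zero_comp, add_zero,
    reassoc_of% (inl_fst X Y f (Nat.zero_le n))]

lemma dRight_eq :
    (mappingCone X Y f).dRight =
      fst X Y f n ≫ f.f (n + 1) ≫ Y.isoRight.hom + snd X Y f n ≫ Y.dRight := by
  have h : inl X Y f (n + 1) = 0 := inl_eq_zero _ _ _ (by omega)
  rw [ComplexBetween.dRight, d_eq, h]
  simp [inr_isoRight, ComplexBetween.dRight]

end mappingCone

namespace mappingCocone

/-- The inclusion of `Xᵢ` into the `i`-th term of the mapping cocone (zero for `i > n`). -/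
def inl (i : ℕ) : X.cpx.X i ⟶ (mappingCocone X Y f).cpx.X i := coconeInl n X.cpx Y.cpx i

/-- The inclusion of `Yᵢ` into the `(i+1)`-st term of the mapping cocone (zero for `i > n`). -/
def inr (i : ℕ) : Y.cpx.X i ⟶ (mappingCocone X Y f).cpx.X (i + 1) := coconeInr n X.cpx Y.cpx i

/-- The projection of the `i`-th term of the mapping cocone to `Xᵢ` (zero for `i > n`). -/
def fst (i : ℕ) : (mappingCocone X Y f).cpx.X i ⟶ X.cpx.X i := coconeFst n X.cpx Y.cpx i

/-- The projection of the `(i+1)`-st term of the mapping cocone to `Yᵢ` (zero for `i > n`). -/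
def snd (i : ℕ) : (mappingCocone X Y f).cpx.X (i + 1) ⟶ Y.cpx.X i := coconeSnd n X.cpx Y.cpx i

lemma inl_fst {i : ℕ} (h : i ≤ n) : inl X Y f i ≫ fst X Y f i = 𝟙 _ :=
  coconeInl_fst n X.cpx Y.cpx h

@[simp]
lemma inl_snd (i : ℕ) : inl X Y f (i + 1) ≫ snd X Y f i = 0 :=
  coconeInl_snd n X.cpx Y.cpx i

@[simp]
lemma inr_fst (i : ℕ) : inr X Y f i ≫ fst X Y f (i + 1) = 0 :=
  coconeInr_fst n X.cpx Y.cpx i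

lemma inr_snd {i : ℕ} (h : i ≤ n) : inr X Y f i ≫ snd X Y f i = 𝟙 _ :=
  coconeInr_snd n X.cpx Y.cpx h

lemma inr_eq_zero {i : ℕ} (h : ¬ i ≤ n) : inr X Y f i = 0 :=
  coconeInr_eq_zero n X.cpx Y.cpx h

lemma inl_eq_zero {i : ℕ} (h : ¬ i ≤ n) : inl X Y f i = 0 := by
  change coconeInl n X.cpx Y.cpx i = 0
  cases i with
  | zero => omega
  | succ i => simp [coconeInl, h]

lemma total {i : ℕ} (hi : i ≤ n) :
    fst X Y f (i + 1) ≫ inl X Y f (i + 1) + snd X Y f i ≫ inr X Y f i = 𝟙 _ := by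
  change coconeFst n X.cpx Y.cpx (i + 1) ≫ coconeInl n X.cpx Y.cpx (i + 1) +
    coconeSnd n X.cpx Y.cpx i ≫ coconeInr n X.cpx Y.cpx i = 𝟙 (coconeX n X.cpx Y.cpx (i + 1))
  generalize X.cpx = K
  generalize Y.cpx = L
  by_cases h : i + 1 ≤ n
  · simp only [coconeFst, coconeInl, coconeSnd, coconeInr, dif_pos h, Category.assoc]
    rw [← cancel_epi (eqToHom (coconeX_of_le n K L h).symm),
      ← cancel_mono (eqToHom (coconeX_of_le n K L h))]
    simp [biprod.total]
  · have : i = n := by omega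
    subst this
    simp [coconeFst, coconeInl, coconeSnd, coconeInr]

lemma fst_inl_zero : fst X Y f 0 ≫ inl X Y f 0 = 𝟙 _ :=
  Category.id_comp (𝟙 (X.cpx.X 0))

lemma d_zero_eq : (mappingCocone X Y f).cpx.d 0 1 =
    fst X Y f 0 ≫ (X.cpx.d 0 1 ≫ inl X Y f 1 + f.f 0 ≫ inr X Y f 0) :=
  CochainComplex.of_d (coconeX n X.cpx Y.cpx) (coconeD n f) 0

lemma d_succ_eq (i : ℕ) : (mappingCocone X Y f).cpx.d (i + 1) (i + 2) =
    fst X Y f (i + 1) ≫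
        (X.cpx.d (i + 1) (i + 2) ≫ inl X Y f (i + 2) + f.f (i + 1) ≫ inr X Y f (i + 1)) +
      snd X Y f i ≫ (-(Y.cpx.d i (i + 1)) ≫ inr X Y f (i + 1)) :=
  CochainComplex.of_d (coconeX n X.cpx Y.cpx) (coconeD n f) (i + 1)

lemma dLeft_eq :
    (mappingCocone X Y f).dLeft =
      X.dLeft ≫ inl X Y f 1 + (X.isoLeft.inv ≫ f.f 0) ≫ inr X Y f 0 := by
  have h : (mappingCocone X Y f).isoLeft.inv = X.isoLeft.inv ≫ inl X Y f 0 :=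
    (Category.comp_id (X := A) (Y := X.cpx.X 0) X.isoLeft.inv).symm
  rw [ComplexBetween.dLeft, d_zero_eq, h, Category.assoc,
    reassoc_of% (inl_fst X Y f (Nat.zero_le n))]
  simp [ComplexBetween.dLeft]

lemma inr_isoRight :
    inr X Y f n ≫ (mappingCocone X Y f).isoRight.hom = 𝟙 _ := by
  have h : inr X Y f n = eqToHom (coconeX_of_eq n X.cpx Y.cpx rfl).symm := by
    exact (dif_neg (show ¬ n + 1 ≤ n by omega)).trans (dif_pos rfl)
  rw [h]
  exact eqToHom_trans _ (mappingCocone X Y f).right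

lemma dRight_eq {m : ℕ} (X : ComplexBetween (m + 1) A C)
    (Y : ComplexBetween (m + 1) B C') (f : X.cpx ⟶ Y.cpx) :
    (mappingCocone X Y f).dRight =
      fst X Y f (m + 1) ≫ f.f (m + 1) - snd X Y f m ≫ Y.cpx.d m (m + 1) := by
  have h : inl X Y f (m + 2) = 0 := inl_eq_zero _ _ _ (by omega)
  rw [ComplexBetween.dRight, d_succ_eq, h]
  simp [inr_isoRight, sub_eq_add_neg]

end mappingCocone

end ConeFormulas

/-! ### Long exact sequences -/

section LongExact

variable {D : Type u} [Category.{v} D] [Preadditive D] [HasZeroObject D] [HasBinaryBiproducts D]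
  {n : ℕ} [NeZero n] {G : Dᵒᵖ ⥤ D ⥤ AddCommGrpCat.{w}} {r : RealisationMap n G}

lemma IsNExangulated.isNExangle (h : IsNExangulated G r) {A C : D} {δ : Extn G C A}
    {X : ComplexBetween n A C} (hX : r δ = X.cls) : IsNExangle X δ :=
  h.exactRealisation.isNExangle δ X hX

/-- Exactness of `D(W, X_{n+1}) ⟶ G(W, X₀) ⟶ G(W, X₁)`. The mapping cone of a good lift of the
inclusion `X_{n+1} ⟶ X_{n+1} ⊞ W` into a realisation of `(δ, θ)` realises the zero extension,
so its last morphism is surjective on maps out of `W`. -/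
lemma IsNExangulated.exists_pull_eq (h : IsNExangulated G r) {A C W : D} {δ : Extn G C A}
    {X : ComplexBetween n A C} (hX : r δ = X.cls) (θ : Extn G W A) (hθ : push X.dLeft θ = 0) :
    ∃ c : W ⟶ C, pull c δ = θ := by
  let σ : Extn G (C ⊞ W) A := pull biprod.fst δ + pull biprod.snd θ
  have hinl : pull biprod.inl σ = δ := by
    simp only [σ, pull_add, ← pull_comp, biprod.inl_fst, biprod.inl_snd, pull_id,
      h.biadditive.zero_pull, add_zero]
  have hinr : pull biprod.inr σ = θ := by
    simp only [σ, pull_add, ← pull_comp, biprod.inr_fst, biprod.inr_snd, pull_id,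
      h.biadditive.zero_pull, zero_add]
  have hσ : push X.dLeft σ = 0 := by
    simp only [σ, push_add, push_pull, hθ, (h.isNExangle hX).push_eq_zero, pull_zero, add_zero]
  obtain ⟨S, hS⟩ := exists_realisation r σ
  obtain ⟨f, hf, hM⟩ := h.good_lift biprod.inl σ X S (by rw [hinl]; exact hX) hS
  rw [hσ] at hM
  obtain ⟨g, hg⟩ := (h.isNExangle hM).exists_of_pull_eq_zero (biprod.inr : W ⟶ C ⊞ W)
    (pull_zero _)
  rw [mappingCone.dRight_eq, hf.right, Preadditive.comp_add] at hg
  refine ⟨g ≫ mappingCone.fst X S f n ≫ X.isoRight.hom, ?_⟩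
  calc pull (g ≫ mappingCone.fst X S f n ≫ X.isoRight.hom) δ
      = pull (g ≫ mappingCone.fst X S f n ≫ X.isoRight.hom ≫ biprod.inl) σ := by
        have : g ≫ mappingCone.fst X S f n ≫ X.isoRight.hom ≫ (biprod.inl : C ⟶ C ⊞ W) =
            (g ≫ mappingCone.fst X S f n ≫ X.isoRight.hom) ≫ biprod.inl := by
          simp only [Category.assoc]
        rw [this, pull_comp biprod.inl, hinl]
    _ = pull (g ≫ mappingCone.fst X S f n ≫ X.isoRight.hom ≫ biprod.inl) σ +
          pull (g ≫ mappingCone.snd X S f n ≫ S.dRight) σ := by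
        rw [← Category.assoc g (mappingCone.snd X S f n), pull_comp S.dRight,
          (h.isNExangle hS).pull_eq_zero, pull_zero, add_zero]
    _ = θ := by rw [← h.biadditive.pull_add, hg, hinr]

/-- Exactness of `D(X₀, W) ⟶ G(X_{n+1}, W) ⟶ G(X_n, W)`. -/
lemma IsNExangulated.exists_push_eq (h : IsNExangulated G r) {A C W : D} {δ : Extn G C A}
    {X : ComplexBetween n A C} (hX : r δ = X.cls) (θ : Extn G C W) (hθ : pull X.dRight θ = 0) :
    ∃ a : A ⟶ W, push a δ = θ := by
  let σ : Extn G C (A ⊞ W) := push biprod.inl δ + push biprod.inr θ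
  have hfst : push biprod.fst σ = δ := by
    simp only [σ, push_add, ← push_comp, biprod.inl_fst, biprod.inr_fst, push_id,
      h.biadditive.zero_push, add_zero]
  have hsnd : push biprod.snd σ = θ := by
    simp only [σ, push_add, ← push_comp, biprod.inl_snd, biprod.inr_snd, push_id,
      h.biadditive.zero_push, zero_add]
  have hσ : pull X.dRight σ = 0 := by
    simp only [σ, pull_add, ← push_pull, hθ, (h.isNExangle hX).pull_eq_zero, push_zero, add_zero]
  obtain ⟨S, hS⟩ := exists_realisation r σ
  obtain ⟨f, hf, hN⟩ := h.good_lift_op biprod.fst σ S X hS (by rw [hfst]; exact hX)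
  rw [hσ] at hN
  obtain ⟨g, hg⟩ := (h.isNExangle hN).exists_of_push_eq_zero (biprod.snd : A ⊞ W ⟶ W)
    (push_zero _)
  rw [mappingCocone.dLeft_eq, hf.isoLeft_inv, Preadditive.add_comp] at hg
  refine ⟨X.isoLeft.inv ≫ mappingCocone.inr S X f 0 ≫ g, ?_⟩
  calc push (X.isoLeft.inv ≫ mappingCocone.inr S X f 0 ≫ g) δ
      = push (((biprod.fst ≫ X.isoLeft.inv) ≫ mappingCocone.inr S X f 0) ≫ g) σ := by
        simp only [Category.assoc]
        rw [push_comp biprod.fst, hfst]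
    _ = push ((S.dLeft ≫ mappingCocone.inl S X f 1) ≫ g) σ +
          push (((biprod.fst ≫ X.isoLeft.inv) ≫ mappingCocone.inr S X f 0) ≫ g) σ := by
        have h0 : push ((S.dLeft ≫ mappingCocone.inl S X f 1) ≫ g) σ = 0 := by
          rw [Category.assoc, push_comp, (h.isNExangle hS).push_eq_zero, push_zero]
        rw [h0]
        exact (zero_add _).symm
    _ = θ := by rw [← h.biadditive.push_add, hg, hsnd]

end LongExact

/-! ### Comparing two constructions over a composite -/

section Composite

variable {D : Type u} [Category.{v} D] [Preadditive D] [HasZeroObject D] [HasBinaryBiproducts D]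
  {n : ℕ} [NeZero n] {G : Dᵒᵖ ⥤ D ⥤ AddCommGrpCat.{w}} {r : RealisationMap n G}

/-- Let `f = d₀^X` and `g = d₀^Y` be composable inflations whose composite is the inflation
`d₀^Z`, and let `W` realise `(d₁^X)_* ρ`. The mapping cocone of `Y ⟶ W` and the mapping cone of
`X ⟶ Z` have the same first morphism `X₁ ⟶ X₂ ⊞ Y₁`, up to an isomorphism of the targets. -/
lemma IsNExangulated.exists_iso_dLeft_comp (h : IsNExangulated G r) {A C C' C'' : D}
    {δ : Extn G C A} {X : ComplexBetween n A C} (hX : r δ = X.cls)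
    {ρ : Extn G C' (X.cpx.X 1)} {Y : ComplexBetween n (X.cpx.X 1) C'} (hY : r ρ = Y.cls)
    {ζ : Extn G C'' A} {Z : ComplexBetween n A C''} (hZ : r ζ = Z.cls)
    (e : Z.cpx.X 1 ≅ Y.cpx.X 1) (he : Z.dLeft ≫ e.hom = X.dLeft ≫ Y.dLeft)
    {W : ComplexBetween n (X.cpx.X 2) C'} (hW : r (push (X.cpx.d 1 2) ρ) = W.cls) :
    ∃ (N : ComplexBetween n (X.cpx.X 1) (W.cpx.X n)) (M : ComplexBetween n (X.cpx.X 1) C''),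
      r (pull W.dRight ρ) = N.cls ∧ r (push X.dLeft ζ) = M.cls ∧
        ∃ φ : N.cpx.X 1 ≅ M.cpx.X 1, N.dLeft ≫ φ.hom = M.dLeft := by
  have hn : 1 ≤ n := NeZero.pos n
  obtain ⟨F, hF, hN⟩ := h.good_lift_op (X.cpx.d 1 2) ρ Y W hY hW
  have hδ : push Z.dLeft δ = 0 := by
    have : Z.dLeft = X.dLeft ≫ Y.dLeft ≫ e.inv := by
      rw [← Category.assoc, ← he, Category.assoc, e.hom_inv_id, Category.comp_id]
    rw [this, push_comp, (h.isNExangle hX).push_eq_zero, push_zero]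
  -- `X ⟶ Z` is a good lift of `(1, c)`; its component in degree `1` is `g + d₁^X ≫ k`
  obtain ⟨c, hc⟩ := h.exists_pull_eq hZ δ hδ
  obtain ⟨f, hf, hM⟩ := h.good_lift c ζ X Z (by rw [hc]; exact hX) hZ
  have hf1 : X.dLeft ≫ (f.f 1 ≫ e.hom - Y.dLeft) = 0 := by
    rw [Preadditive.comp_sub, ← Category.assoc, hf.dLeft_comp, Category.id_comp, he, sub_self]
  obtain ⟨k, hk⟩ := (h.isNExangle hX).exists_of_dLeft_comp_eq_zero _ hf1
  have hk' : f.f 1 = (X.cpx.d 1 2 ≫ k + Y.dLeft) ≫ e.inv := by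
    rw [hk, sub_add_cancel, Category.assoc, e.hom_inv_id, Category.comp_id]
  have hinlN := mappingCocone.inl_fst Y W F hn
  have hinrN := mappingCocone.inr_snd Y W F (Nat.zero_le n)
  have hinl_sndN : mappingCocone.inl Y W F 1 ≫ mappingCocone.snd Y W F 0 = 0 :=
    mappingCocone.inl_snd Y W F 0
  have hinr_fstN : mappingCocone.inr Y W F 0 ≫ mappingCocone.fst Y W F 1 = 0 :=
    mappingCocone.inr_fst Y W F 0
  have htN : mappingCocone.fst Y W F 1 ≫ mappingCocone.inl Y W F 1 +
      mappingCocone.snd Y W F 0 ≫ mappingCocone.inr Y W F 0 = 𝟙 _ :=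
    mappingCocone.total Y W F (Nat.zero_le n)
  have hinlM := mappingCone.inl_fst X Z f hn
  have hinrM : mappingCone.inr X Z f 1 ≫ mappingCone.snd X Z f 1 = 𝟙 _ :=
    mappingCone.inr_snd X Z f 0
  have hinl_sndM := mappingCone.inl_snd X Z f 1
  have hinr_fstM := mappingCone.inr_fst X Z f 1
  have htM := mappingCone.total X Z f 1
  refine ⟨mappingCocone Y W F, mappingCone X Z f, hN, hM,
    { hom := mappingCocone.fst Y W F 1 ≫ e.inv ≫ mappingCone.inr X Z f 1 +
        mappingCocone.snd Y W F 0 ≫ W.isoLeft.hom ≫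
          (k ≫ e.inv ≫ mappingCone.inr X Z f 1 - mappingCone.inl X Z f 1)
      inv := mappingCone.fst X Z f 1 ≫ (k ≫ mappingCocone.inl Y W F 1 -
          W.isoLeft.inv ≫ mappingCocone.inr Y W F 0) +
        mappingCone.snd X Z f 1 ≫ e.hom ≫ mappingCocone.inl Y W F 1
      hom_inv_id := ?_
      inv_hom_id := ?_ }, ?_⟩
  · rw [← htN]
    simp [reassoc_of% hinlM, reassoc_of% hinrM, reassoc_of% hinl_sndM, reassoc_of% hinr_fstM]
    abel
  · rw [← htM]
    simp [reassoc_of% hinlN, reassoc_of% hinrN, reassoc_of% hinl_sndN, reassoc_of% hinr_fstN]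
    abel
  · rw [mappingCocone.dLeft_eq, mappingCone.dLeft_eq, hF.isoLeft_inv, hk']
    simp [reassoc_of% hinlN, reassoc_of% hinrN, reassoc_of% hinl_sndN, reassoc_of% hinr_fstN]
    abel

/-- The dual comparison: `f = d_n^X` and `g = d_n^Y` are composable deflations whose composite is
the deflation `d_n^Z`, and `W` realises `(d_{n-1}^X)^* ρ`. -/
lemma IsNExangulated.exists_iso_comp_dRight {m : ℕ} {r : RealisationMap (m + 1) G}
    (h : IsNExangulated G r) {A B C A' : D}
    {δ : Extn G C A} {X : ComplexBetween (m + 1) A C} (hX : r δ = X.cls)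
    {ρ : Extn G (X.cpx.X (m + 1)) B} {Y : ComplexBetween (m + 1) B (X.cpx.X (m + 1))}
    (hY : r ρ = Y.cls)
    {ζ : Extn G C A'} {Z : ComplexBetween (m + 1) A' C} (hZ : r ζ = Z.cls)
    (e : Z.cpx.X (m + 1) ≅ Y.cpx.X (m + 1)) (he : e.hom ≫ Y.dRight ≫ X.dRight = Z.dRight)
    {W : ComplexBetween (m + 1) B (X.cpx.X m)} (hW : r (pull (X.cpx.d m (m + 1)) ρ) = W.cls) :
    ∃ (N : ComplexBetween (m + 1) (W.cpx.X 1) (X.cpx.X (m + 1)))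
      (M : ComplexBetween (m + 1) A' (X.cpx.X (m + 1))),
      r (push W.dLeft ρ) = N.cls ∧ r (pull X.dRight ζ) = M.cls ∧
        ∃ φ : M.cpx.X (m + 1) ≅ N.cpx.X (m + 1), φ.hom ≫ N.dRight = M.dRight := by
  obtain ⟨F, hF, hN⟩ := h.good_lift (X.cpx.d m (m + 1)) ρ W Y hW hY
  have hδ : pull Z.dRight δ = 0 := by
    rw [← he, pull_comp, pull_comp, (h.isNExangle hX).pull_eq_zero, pull_zero, pull_zero]
  obtain ⟨a, ha⟩ := h.exists_push_eq hZ δ hδ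
  obtain ⟨f, hf, hM⟩ := h.good_lift_op a ζ Z X hZ (by rw [ha]; exact hX)
  have hf1 : (e.inv ≫ f.f (m + 1) - Y.dRight) ≫ X.dRight = 0 := by
    rw [Preadditive.sub_comp, Category.assoc, hf.comp_dRight, Category.comp_id, ← he,
      e.inv_hom_id_assoc, sub_self]
  obtain ⟨k, hk⟩ := (h.isNExangle hX).exists_of_comp_dRight_eq_zero _ hf1
  have hk' : f.f (m + 1) = e.hom ≫ (k ≫ X.cpx.d m (m + 1) + Y.dRight) := by
    rw [hk, sub_add_cancel, e.hom_inv_id_assoc]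
  have hinlN := mappingCone.inl_fst W Y F (le_refl (m + 1))
  have hinrN := mappingCone.inr_snd W Y F m
  have hinl_sndN := mappingCone.inl_snd W Y F (m + 1)
  have hinr_fstN := mappingCone.inr_fst W Y F (m + 1)
  have htN := mappingCone.total W Y F (m + 1)
  have hinlM := mappingCocone.inl_fst Z X f (le_refl (m + 1))
  have hinrM := mappingCocone.inr_snd Z X f (Nat.le_succ m)
  have hinl_sndM := mappingCocone.inl_snd Z X f m
  have hinr_fstM := mappingCocone.inr_fst Z X f m
  have htM := mappingCocone.total Z X f (Nat.le_succ m)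
  refine ⟨mappingCone W Y F, mappingCocone Z X f, hN, hM,
    { hom := mappingCocone.fst Z X f (m + 1) ≫ e.hom ≫
          (k ≫ W.isoRight.inv ≫ mappingCone.inl W Y F (m + 1) + mappingCone.inr W Y F (m + 1)) -
        mappingCocone.snd Z X f m ≫ W.isoRight.inv ≫ mappingCone.inl W Y F (m + 1)
      inv := mappingCone.snd W Y F (m + 1) ≫
          (e.inv ≫ mappingCocone.inl Z X f (m + 1) + k ≫ mappingCocone.inr Z X f m) -
        mappingCone.fst W Y F (m + 1) ≫ W.isoRight.hom ≫ mappingCocone.inr Z X f m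
      hom_inv_id := ?_
      inv_hom_id := ?_ }, ?_⟩
  · rw [← htM]
    simp [reassoc_of% hinlN, reassoc_of% hinrN, reassoc_of% hinl_sndN, reassoc_of% hinr_fstN]
    abel
  · rw [← htN]
    simp [reassoc_of% hinlM, reassoc_of% hinrM, reassoc_of% hinl_sndM, reassoc_of% hinr_fstM]
    abel
  · rw [mappingCocone.dRight_eq, mappingCone.dRight_eq, hF.right, hk']
    simp [reassoc_of% hinlN, reassoc_of% hinrN, reassoc_of% hinl_sndN, reassoc_of% hinr_fstN]
    abel

end Composite

/-! ### Uniqueness of the far end for `n = 1` -/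

section FarEnd

variable {D : Type u} [Category.{v} D] [Preadditive D] {n : ℕ} {G : Dᵒᵖ ⥤ D ⥤ AddCommGrpCat.{w}}

/-- An endomorphism that fixes the deflation of an `n`-exangle and its extension is invertible: if
it is `1 + s`, then `s` vanishes on the deflation and factors through it, whence `s² = 0`. -/
lemma IsNExangle.isIso_of_dRight_comp (hG : IsBiadditive G) {A C : D} {X : ComplexBetween n A C}
    {δ : Extn G C A} (h : IsNExangle X δ) (u : C ⟶ C) (hu : X.dRight ≫ u = X.dRight)
    (hδ : pull u δ = δ) : IsIso u := by
  obtain ⟨k, hk⟩ := h.exists_of_pull_eq_zero (u - 𝟙 C) (by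
    rw [hG.sub_pull, hδ, pull_id, sub_self])
  have hs : (u - 𝟙 C) ≫ (u - 𝟙 C) = 0 := by
    nth_rw 1 [← hk]
    rw [Category.assoc, Preadditive.comp_sub, hu, Category.comp_id, sub_self, comp_zero]
  refine ⟨𝟙 C - (u - 𝟙 C), ?_, ?_⟩
  · have : u ≫ (𝟙 C - (u - 𝟙 C)) = 𝟙 C - (u - 𝟙 C) ≫ (u - 𝟙 C) := by simp; abel
    rw [this, hs, sub_zero]
  · have : (𝟙 C - (u - 𝟙 C)) ≫ u = 𝟙 C - (u - 𝟙 C) ≫ (u - 𝟙 C) := by simp; abel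
    rw [this, hs, sub_zero]

lemma IsNExangle.isIso_of_comp_dLeft (hG : IsBiadditive G) {A C : D} {X : ComplexBetween n A C}
    {δ : Extn G C A} (h : IsNExangle X δ) (u : A ⟶ A) (hu : u ≫ X.dLeft = X.dLeft)
    (hδ : push u δ = δ) : IsIso u := by
  obtain ⟨k, hk⟩ := h.exists_of_push_eq_zero (u - 𝟙 A) (by
    rw [hG.sub_push, hδ, push_id, sub_self])
  have hs : (u - 𝟙 A) ≫ (u - 𝟙 A) = 0 := by
    nth_rw 2 [← hk]
    rw [← Category.assoc, Preadditive.sub_comp, hu, Category.id_comp, sub_self, zero_comp]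
  refine ⟨𝟙 A - (u - 𝟙 A), ?_, ?_⟩
  · have : u ≫ (𝟙 A - (u - 𝟙 A)) = 𝟙 A - (u - 𝟙 A) ≫ (u - 𝟙 A) := by simp; abel
    rw [this, hs, sub_zero]
  · have : (𝟙 A - (u - 𝟙 A)) ≫ u = 𝟙 A - (u - 𝟙 A) ≫ (u - 𝟙 A) := by simp; abel
    rw [this, hs, sub_zero]

variable [HasZeroObject D] [HasBinaryBiproducts D] {r : RealisationMap 1 G}

lemma IsNExangulated.exists_dRight_comparison (h : IsNExangulated G r) {B C C' : D}
    {ν : Extn G C B} {N : ComplexBetween 1 B C} (hN : r ν = N.cls)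
    {μ : Extn G C' B} {M : ComplexBetween 1 B C'} (hM : r μ = M.cls)
    (φ : N.cpx.X 1 ⟶ M.cpx.X 1) (hφ : N.dLeft ≫ φ = M.dLeft) :
    ∃ p : C ⟶ C', φ ≫ M.dRight = N.dRight ≫ p ∧ pull p μ = ν := by
  obtain ⟨p, hp⟩ := h.exists_pull_eq hM ν (by
    rw [← hφ, push_comp, (h.isNExangle hN).push_eq_zero, push_zero])
  obtain ⟨b, hb⟩ := h.exactRealisation.exists_lift ν μ N M hN hM (𝟙 B) p (by rw [push_id, hp])
  obtain ⟨k, hk⟩ := (h.isNExangle hN).exists_of_dLeft_comp_eq_zero (φ - b.f 1) (by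
    rw [Preadditive.comp_sub, hφ, hb.dLeft_comp, Category.id_comp, sub_self])
  have hφb : φ = b.f 1 + N.dRight ≫ N.isoRight.inv ≫ k := by
    rw [← Category.assoc, N.dRight_isoRight_inv, hk, add_sub_cancel]
  refine ⟨p + (N.isoRight.inv ≫ k) ≫ M.dRight, ?_, ?_⟩
  · rw [hφb, Preadditive.add_comp, hb.comp_dRight, Preadditive.comp_add]
    simp only [Category.assoc]
  · rw [h.biadditive.pull_add, hp, pull_comp, (h.isNExangle hM).pull_eq_zero, pull_zero, add_zero]

lemma IsNExangulated.exists_dLeft_comparison (h : IsNExangulated G r) {A A' B : D}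
    {ν : Extn G B A} {N : ComplexBetween 1 A B} (hN : r ν = N.cls)
    {μ : Extn G B A'} {M : ComplexBetween 1 A' B} (hM : r μ = M.cls)
    (φ : M.cpx.X 1 ⟶ N.cpx.X 1) (hφ : φ ≫ N.dRight = M.dRight) :
    ∃ p : A' ⟶ A, M.dLeft ≫ φ = p ≫ N.dLeft ∧ push p μ = ν := by
  obtain ⟨p, hp⟩ := h.exists_push_eq hM ν (by
    rw [← hφ, pull_comp, (h.isNExangle hN).pull_eq_zero, pull_zero])
  obtain ⟨b, hb⟩ := h.exactRealisation.exists_lift μ ν M N hM hN p (𝟙 B) (by rw [pull_id, hp])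
  obtain ⟨k, hk⟩ := (h.isNExangle hN).exists_of_comp_dRight_eq_zero (m := 0) (φ - b.f 1) (by
    rw [Preadditive.sub_comp, hφ, hb.comp_dRight, Category.comp_id, sub_self])
  have hφb : φ = b.f 1 + (k ≫ N.isoLeft.hom) ≫ N.dLeft := by
    rw [Category.assoc, N.isoLeft_hom_dLeft, hk, add_sub_cancel]
  refine ⟨p + M.dLeft ≫ k ≫ N.isoLeft.hom, ?_, ?_⟩
  · rw [hφb, Preadditive.comp_add, hb.dLeft_comp, Preadditive.add_comp]
    simp only [Category.assoc]
  · rw [h.biadditive.push_add, hp, push_comp, (h.isNExangle hM).push_eq_zero, push_zero, add_zero]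

/-- For `n = 1` the codomain of the deflation is determined by the inflation. -/
lemma IsNExangulated.nonempty_iso_right (h : IsNExangulated G r) {B C C' : D}
    {ν : Extn G C B} {N : ComplexBetween 1 B C} (hN : r ν = N.cls)
    {μ : Extn G C' B} {M : ComplexBetween 1 B C'} (hM : r μ = M.cls)
    (φ : N.cpx.X 1 ≅ M.cpx.X 1) (hφ : N.dLeft ≫ φ.hom = M.dLeft) : Nonempty (C ≅ C') := by
  obtain ⟨p, hp, hp'⟩ := h.exists_dRight_comparison hN hM φ.hom hφ
  obtain ⟨q, hq, hq'⟩ := h.exists_dRight_comparison hM hN φ.inv (by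
    rw [← hφ, Category.assoc, φ.hom_inv_id, Category.comp_id])
  have h1 : IsIso (p ≫ q) := (h.isNExangle hN).isIso_of_dRight_comp h.biadditive _
    (by rw [← Category.assoc, ← hp, Category.assoc, ← hq, φ.hom_inv_id_assoc])
    (by rw [pull_comp, hq', hp'])
  have h2 : IsIso (q ≫ p) := (h.isNExangle hM).isIso_of_dRight_comp h.biadditive _
    (by rw [← Category.assoc, ← hq, Category.assoc, ← hp, φ.inv_hom_id_assoc])
    (by rw [pull_comp, hp', hq'])
  have h3 : Mono p := mono_of_mono p q
  have h4 : IsSplitEpi p := ⟨⟨⟨inv (q ≫ p) ≫ q, by simp⟩⟩⟩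
  have : IsIso p := isIso_of_mono_of_isSplitEpi p
  exact ⟨asIso p⟩

/-- For `n = 1` the domain of the inflation is determined by the deflation. -/
lemma IsNExangulated.nonempty_iso_left (h : IsNExangulated G r) {A A' B : D}
    {ν : Extn G B A} {N : ComplexBetween 1 A B} (hN : r ν = N.cls)
    {μ : Extn G B A'} {M : ComplexBetween 1 A' B} (hM : r μ = M.cls)
    (φ : M.cpx.X 1 ≅ N.cpx.X 1) (hφ : φ.hom ≫ N.dRight = M.dRight) : Nonempty (A ≅ A') := by
  obtain ⟨p, hp, hp'⟩ := h.exists_dLeft_comparison hN hM φ.hom hφ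
  obtain ⟨q, hq, hq'⟩ := h.exists_dLeft_comparison hM hN φ.inv (by
    rw [← hφ, φ.inv_hom_id_assoc])
  have h1 : IsIso (p ≫ q) := (h.isNExangle hM).isIso_of_comp_dLeft h.biadditive _
    (by rw [Category.assoc, ← hq, ← Category.assoc, ← hp, Category.assoc, φ.hom_inv_id,
      Category.comp_id])
    (by rw [push_comp, hp', hq'])
  have h2 : IsIso (q ≫ p) := (h.isNExangle hN).isIso_of_comp_dLeft h.biadditive _
    (by rw [Category.assoc, ← hp, ← Category.assoc, ← hq, Category.assoc, φ.inv_hom_id,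
      Category.comp_id])
    (by rw [push_comp, hq', hp'])
  have h3 : Mono p := mono_of_mono p q
  have h4 : IsSplitEpi p := ⟨⟨⟨inv (q ≫ p) ≫ q, by simp⟩⟩⟩
  have : IsIso p := isIso_of_mono_of_isSplitEpi p
  exact ⟨(asIso p).symm⟩

end FarEnd

/-! ### Changing two consecutive terms of a complex -/

section LocalChange

variable {D : Type u} [Category.{v} D] [Preadditive D]

/-- A homotopy with a single nonzero component, from degree `j + 2` to degree `j + 1`. -/
def homotopyOfSingle {K L : CochainComplex D ℕ} (u v : K ⟶ L) (j : ℕ)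
    (k : K.X (j + 2) ⟶ L.X (j + 1))
    (h₁ : u.f (j + 1) = K.d (j + 1) (j + 2) ≫ k + v.f (j + 1))
    (h₂ : u.f (j + 2) = k ≫ L.d (j + 1) (j + 2) + v.f (j + 2))
    (h : ∀ m, m ≠ j + 1 → m ≠ j + 2 → u.f m = v.f m) : Homotopy u v where
  hom a b := if hab : a = j + 2 ∧ b = j + 1 then
    eqToHom (by rw [hab.1]) ≫ k ≫ eqToHom (by rw [hab.2]) else 0
  zero a b hab := dif_neg (fun hab' => hab (by
    rw [hab'.1, hab'.2]
    exact rfl))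
  comm m := by
    rcases m with _ | m
    · rw [Homotopy.dNext_cochainComplex, Homotopy.prevD_zero_cochainComplex,
        h 0 (by omega) (by omega),
        dif_neg (by omega)]
      simp
    · rw [Homotopy.dNext_cochainComplex, Homotopy.prevD_succ_cochainComplex]
      by_cases hm : m = j
      · subst hm
        rw [dif_pos ⟨rfl, rfl⟩, dif_neg (by omega)]
        simpa using h₁
      · by_cases hm' : m = j + 1
        · subst hm'
          rw [dif_neg (by omega), dif_pos ⟨rfl, rfl⟩]
          simpa using h₂
        · rw [dif_neg (by omega), dif_neg (by omega), h _ (by omega) (by omega)]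
          simp

variable (K : CochainComplex D ℕ) (j : ℕ) (B₁ B₂ : D)

/-- The terms of `K`, with those in degrees `j + 1` and `j + 2` replaced by `B₁` and `B₂`. -/
def changeX (m : ℕ) : D := if m = j + 1 then B₁ else if m = j + 2 then B₂ else K.X m

lemma changeX_one : changeX K j B₁ B₂ (j + 1) = B₁ := if_pos rfl

lemma changeX_two : changeX K j B₁ B₂ (j + 2) = B₂ :=
  (if_neg (by omega)).trans (if_pos rfl)

variable {j} in
lemma changeX_of_ne {m : ℕ} (h₁ : m ≠ j + 1) (h₂ : m ≠ j + 2) : changeX K j B₁ B₂ m = K.X m :=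
  (if_neg h₁).trans (if_neg h₂)

variable {K j B₁ B₂}

/-- A family of morphisms to the changed terms, given by `f₁` and `f₂` in the two changed
degrees. -/
def changeTo (f₁ : K.X (j + 1) ⟶ B₁) (f₂ : K.X (j + 2) ⟶ B₂) (m : ℕ) :
    K.X m ⟶ changeX K j B₁ B₂ m :=
  if h₁ : m = j + 1 then eqToHom (by rw [h₁]) ≫ f₁ ≫ eqToHom (by rw [h₁, changeX_one])
  else if h₂ : m = j + 2 then eqToHom (by rw [h₂]) ≫ f₂ ≫ eqToHom (by rw [h₂, changeX_two])
  else eqToHom (changeX_of_ne K B₁ B₂ h₁ h₂).symm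

/-- A family of morphisms from the changed terms, given by `g₁` and `g₂` in the two changed
degrees. -/
def changeFrom (g₁ : B₁ ⟶ K.X (j + 1)) (g₂ : B₂ ⟶ K.X (j + 2)) (m : ℕ) :
    changeX K j B₁ B₂ m ⟶ K.X m :=
  if h₁ : m = j + 1 then eqToHom (by rw [h₁, changeX_one]) ≫ g₁ ≫ eqToHom (by rw [h₁])
  else if h₂ : m = j + 2 then eqToHom (by rw [h₂, changeX_two]) ≫ g₂ ≫ eqToHom (by rw [h₂])
  else eqToHom (changeX_of_ne K B₁ B₂ h₁ h₂)

section

variable (f₁ : K.X (j + 1) ⟶ B₁) (f₂ : K.X (j + 2) ⟶ B₂)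
  (g₁ : B₁ ⟶ K.X (j + 1)) (g₂ : B₂ ⟶ K.X (j + 2))

lemma changeTo_one : changeTo f₁ f₂ (j + 1) = f₁ ≫ eqToHom (changeX_one K j B₁ B₂).symm := by
  simp [changeTo]

lemma changeTo_two : changeTo f₁ f₂ (j + 2) = f₂ ≫ eqToHom (changeX_two K j B₁ B₂).symm := by
  simp [changeTo]

lemma changeTo_of_ne {m : ℕ} (h₁ : m ≠ j + 1) (h₂ : m ≠ j + 2) :
    changeTo f₁ f₂ m = eqToHom (changeX_of_ne K B₁ B₂ h₁ h₂).symm := by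
  simp [changeTo, h₁, h₂]

lemma changeFrom_one : changeFrom g₁ g₂ (j + 1) = eqToHom (changeX_one K j B₁ B₂) ≫ g₁ := by
  simp [changeFrom]

lemma changeFrom_two : changeFrom g₁ g₂ (j + 2) = eqToHom (changeX_two K j B₁ B₂) ≫ g₂ := by
  simp [changeFrom]

lemma changeFrom_of_ne {m : ℕ} (h₁ : m ≠ j + 1) (h₂ : m ≠ j + 2) :
    changeFrom g₁ g₂ m = eqToHom (changeX_of_ne K B₁ B₂ h₁ h₂) := by
  simp [changeFrom, h₁, h₂]

/-- The differential on the changed terms: `d₁` from degree `j + 1` to degree `j + 2`, and the one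
induced by the differential of `K` elsewhere. -/
def changeD (d₁ : B₁ ⟶ B₂) (m : ℕ) : changeX K j B₁ B₂ m ⟶ changeX K j B₁ B₂ (m + 1) :=
  if h : m = j + 1 then eqToHom (by rw [h, changeX_one]) ≫ d₁ ≫ eqToHom (by rw [h, changeX_two])
  else changeFrom g₁ g₂ m ≫ K.d m (m + 1) ≫ changeTo f₁ f₂ (m + 1)

lemma changeD_one (d₁ : B₁ ⟶ B₂) : changeD f₁ f₂ g₁ g₂ d₁ (j + 1) =
    eqToHom (changeX_one K j B₁ B₂) ≫ d₁ ≫ eqToHom (changeX_two K j B₁ B₂).symm := by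
  simp [changeD]

lemma changeD_of_ne (d₁ : B₁ ⟶ B₂) {m : ℕ} (h : m ≠ j + 1) : changeD f₁ f₂ g₁ g₂ d₁ m =
    changeFrom g₁ g₂ m ≫ K.d m (m + 1) ≫ changeTo f₁ f₂ (m + 1) := by
  simp [changeD, h]

end

variable {f₁ : K.X (j + 1) ⟶ B₁} {f₂ : K.X (j + 2) ⟶ B₂}
  {g₁ : B₁ ⟶ K.X (j + 1)} {g₂ : B₂ ⟶ K.X (j + 2)} {d₁ : B₁ ⟶ B₂} {k : K.X (j + 2) ⟶ K.X (j + 1)}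

lemma changeTo_comp_changeFrom {m : ℕ} (h₁ : m ≠ j + 1) (h₂ : m ≠ j + 2) :
    changeTo f₁ f₂ m ≫ changeFrom g₁ g₂ m = 𝟙 _ := by
  rw [changeTo_of_ne _ _ h₁ h₂, changeFrom_of_ne _ _ h₁ h₂, eqToHom_trans, eqToHom_refl]

lemma changeFrom_comp_changeTo {m : ℕ} (h₁ : m ≠ j + 1) (h₂ : m ≠ j + 2) :
    changeFrom g₁ g₂ m ≫ changeTo f₁ f₂ m = 𝟙 _ := by
  rw [changeTo_of_ne _ _ h₁ h₂, changeFrom_of_ne _ _ h₁ h₂, eqToHom_trans, eqToHom_refl]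

lemma d_comp_changeTo_changeFrom (hfg₁ : f₁ ≫ g₁ + K.d (j + 1) (j + 2) ≫ k = 𝟙 _) {m : ℕ}
    (h : m ≠ j + 1) :
    K.d m (m + 1) ≫ changeTo f₁ f₂ (m + 1) ≫ changeFrom g₁ g₂ (m + 1) = K.d m (m + 1) := by
  by_cases hm : m = j
  · subst hm
    have h' : f₁ ≫ g₁ = 𝟙 _ - K.d (m + 1) (m + 2) ≫ k := eq_sub_of_add_eq hfg₁
    simp [changeTo_one, changeFrom_one, h']
  · rw [changeTo_comp_changeFrom (by omega) (by omega), Category.comp_id]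

lemma changeTo_changeFrom_comp_d (hfg₂ : f₂ ≫ g₂ + k ≫ K.d (j + 1) (j + 2) = 𝟙 _) {m : ℕ}
    (h : m ≠ j + 1) :
    changeTo f₁ f₂ m ≫ changeFrom g₁ g₂ m ≫ K.d m (m + 1) = K.d m (m + 1) := by
  by_cases hm : m = j + 2
  · subst hm
    have h' : f₂ ≫ g₂ = 𝟙 _ - k ≫ K.d (j + 1) (j + 2) := eq_sub_of_add_eq hfg₂
    simp [changeTo_two, changeFrom_two, reassoc_of% h']
  · rw [← Category.assoc, changeTo_comp_changeFrom h hm, Category.id_comp]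

lemma changeTo_comp_changeD (hfg₂ : f₂ ≫ g₂ + k ≫ K.d (j + 1) (j + 2) = 𝟙 _)
    (hf : f₁ ≫ d₁ = K.d (j + 1) (j + 2) ≫ f₂) (m : ℕ) :
    changeTo f₁ f₂ m ≫ changeD f₁ f₂ g₁ g₂ d₁ m = K.d m (m + 1) ≫ changeTo f₁ f₂ (m + 1) := by
  by_cases hm : m = j + 1
  · subst hm
    simp [changeTo_one, changeTo_two, changeD_one, reassoc_of% hf]
  · rw [changeD_of_ne _ _ _ _ _ hm]
    simp only [← Category.assoc]
    rw [Category.assoc (changeTo f₁ f₂ m), changeTo_changeFrom_comp_d hfg₂ hm]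

lemma changeD_comp_changeFrom (hfg₁ : f₁ ≫ g₁ + K.d (j + 1) (j + 2) ≫ k = 𝟙 _)
    (hg : d₁ ≫ g₂ = g₁ ≫ K.d (j + 1) (j + 2)) (m : ℕ) :
    changeD f₁ f₂ g₁ g₂ d₁ m ≫ changeFrom g₁ g₂ (m + 1) = changeFrom g₁ g₂ m ≫ K.d m (m + 1) := by
  by_cases hm : m = j + 1
  · subst hm
    simp [changeFrom_one, changeFrom_two, changeD_one, hg]
  · rw [changeD_of_ne _ _ _ _ _ hm, Category.assoc, Category.assoc,
      d_comp_changeTo_changeFrom hfg₁ hm]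

lemma changeD_comp_changeD (hfg₁ : f₁ ≫ g₁ + K.d (j + 1) (j + 2) ≫ k = 𝟙 _)
    (hfg₂ : f₂ ≫ g₂ + k ≫ K.d (j + 1) (j + 2) = 𝟙 _)
    (hf : f₁ ≫ d₁ = K.d (j + 1) (j + 2) ≫ f₂) (hg : d₁ ≫ g₂ = g₁ ≫ K.d (j + 1) (j + 2)) (m : ℕ) :
    changeD f₁ f₂ g₁ g₂ d₁ m ≫ changeD f₁ f₂ g₁ g₂ d₁ (m + 1) = 0 := by
  by_cases hm : m + 1 = j + 1
  · rw [changeD_of_ne _ _ _ _ _ (show m ≠ j + 1 by omega), Category.assoc, Category.assoc,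
      changeTo_comp_changeD hfg₂ hf]
    simp
  · rw [changeD_of_ne _ _ _ _ _ hm, ← Category.assoc, changeD_comp_changeFrom hfg₁ hg]
    simp

/-- Local change of a complex up to homotopy equivalence: the two terms in degrees `j + 1` and
`j + 2` are replaced by `B₁ ⟶ B₂`, where `f` and `g` are mutually inverse up to the homotopies
`k` and `l` concentrated in these two degrees. -/
lemma ComplexBetween.exists_localChange {n : ℕ} {A C : D} (X : ComplexBetween n A C) (j : ℕ)
    (hj : j + 2 ≤ n) {B₁ B₂ : D} (d₁ : B₁ ⟶ B₂)
    (f₁ : X.cpx.X (j + 1) ⟶ B₁) (f₂ : X.cpx.X (j + 2) ⟶ B₂)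
    (g₁ : B₁ ⟶ X.cpx.X (j + 1)) (g₂ : B₂ ⟶ X.cpx.X (j + 2))
    (k : X.cpx.X (j + 2) ⟶ X.cpx.X (j + 1)) (l : B₂ ⟶ B₁)
    (hf : f₁ ≫ d₁ = X.cpx.d (j + 1) (j + 2) ≫ f₂)
    (hg : d₁ ≫ g₂ = g₁ ≫ X.cpx.d (j + 1) (j + 2))
    (hfg₁ : f₁ ≫ g₁ + X.cpx.d (j + 1) (j + 2) ≫ k = 𝟙 _)
    (hfg₂ : f₂ ≫ g₂ + k ≫ X.cpx.d (j + 1) (j + 2) = 𝟙 _)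
    (hgf₁ : g₁ ≫ f₁ + d₁ ≫ l = 𝟙 _) (hgf₂ : g₂ ≫ f₂ + l ≫ d₁ = 𝟙 _) :
    ∃ (Q : ComplexBetween n A C) (f : X.cpx ⟶ Q.cpx) (g : Q.cpx ⟶ X.cpx)
      (e₁ : Q.cpx.X (j + 1) = B₁) (e₂ : Q.cpx.X (j + 2) = B₂),
      HtpyEquivBetween X Q ∧ IsLift X Q f (𝟙 A) (𝟙 C) ∧ IsLift Q X g (𝟙 A) (𝟙 C) ∧
        f.f (j + 1) ≫ eqToHom e₁ = f₁ ∧ g.f (j + 2) = eqToHom e₂ ≫ g₂ ∧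
        ∀ m, m ≠ j + 1 → m ≠ j + 2 → Q.cpx.X m = X.cpx.X m := by
  let Q : ComplexBetween n A C :=
    { cpx := CochainComplex.of (changeX X.cpx j B₁ B₂) (changeD f₁ f₂ g₁ g₂ d₁)
        (changeD_comp_changeD hfg₁ hfg₂ hf hg)
      isZero := fun i hi => by
        change IsZero (changeX X.cpx j B₁ B₂ i)
        rw [changeX_of_ne _ _ _ (by omega) (by omega)]
        exact X.isZero i hi
      left := (changeX_of_ne (j := j) X.cpx B₁ B₂ (by omega) (by omega)).trans X.left
      right := (changeX_of_ne (j := j) X.cpx B₁ B₂ (by omega) (by omega)).trans X.right }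
  have hQd (m : ℕ) : Q.cpx.d m (m + 1) = changeD f₁ f₂ g₁ g₂ d₁ m :=
    CochainComplex.of_d (changeX X.cpx j B₁ B₂) (changeD f₁ f₂ g₁ g₂ d₁) m
  let f : X.cpx ⟶ Q.cpx :=
    { f := changeTo f₁ f₂
      comm' := by
        rintro m _ rfl
        exact (congrArg (changeTo f₁ f₂ m ≫ ·) (hQd m)).trans (changeTo_comp_changeD hfg₂ hf m) }
  let g : Q.cpx ⟶ X.cpx :=
    { f := changeFrom g₁ g₂
      comm' := by
        rintro m _ rfl
        exact ((congrArg (· ≫ changeFrom g₁ g₂ (m + 1)) (hQd m)).trans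
          (changeD_comp_changeFrom hfg₁ hg m)).symm }
  have hfl : IsLift X Q f (𝟙 A) (𝟙 C) := by
    constructor
    · rw [Category.comp_id]
      exact (congrArg (· ≫ eqToHom Q.left)
        (changeTo_of_ne f₁ f₂ (show 0 ≠ j + 1 by omega) (by omega))).trans (eqToHom_trans _ Q.left)
    · rw [Category.comp_id]
      exact (congrArg (· ≫ eqToHom Q.right)
        (changeTo_of_ne f₁ f₂ (show n + 1 ≠ j + 1 by omega) (by omega))).trans
          (eqToHom_trans _ Q.right)
  have hgl : IsLift Q X g (𝟙 A) (𝟙 C) := by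
    constructor
    · rw [Category.comp_id]
      exact (congrArg (· ≫ eqToHom X.left)
        (changeFrom_of_ne g₁ g₂ (show 0 ≠ j + 1 by omega) (by omega))).trans
          (eqToHom_trans _ X.left)
    · rw [Category.comp_id]
      exact (congrArg (· ≫ eqToHom X.right)
        (changeFrom_of_ne g₁ g₂ (show n + 1 ≠ j + 1 by omega) (by omega))).trans
          (eqToHom_trans _ X.right)
  refine ⟨Q, f, g, changeX_one _ _ _ _, changeX_two _ _ _ _,
    ⟨f, g, hfl, hgl, ⟨(homotopyOfSingle _ _ j k ?_ ?_ ?_).symm⟩,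
      ⟨(homotopyOfSingle _ _ j (eqToHom (changeX_two X.cpx j B₁ B₂) ≫ l ≫
        eqToHom (changeX_one X.cpx j B₁ B₂).symm) ?_ ?_ ?_).symm⟩⟩, hfl, hgl, ?_, ?_,
    fun m h₁ h₂ => changeX_of_ne X.cpx B₁ B₂ h₁ h₂⟩
  · change 𝟙 _ = _ + changeTo f₁ f₂ (j + 1) ≫ changeFrom g₁ g₂ (j + 1)
    rw [changeTo_one, changeFrom_one, ← hfg₁]
    simp [add_comm]
  · change 𝟙 _ = _ + changeTo f₁ f₂ (j + 2) ≫ changeFrom g₁ g₂ (j + 2)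
    rw [changeTo_two, changeFrom_two, ← hfg₂]
    simp [add_comm]
  · intro m h₁ h₂
    exact (changeTo_comp_changeFrom h₁ h₂).symm
  · rw [hQd]
    change 𝟙 (changeX X.cpx j B₁ B₂ (j + 1)) = changeD f₁ f₂ g₁ g₂ d₁ (j + 1) ≫ _ +
      changeFrom g₁ g₂ (j + 1) ≫ changeTo f₁ f₂ (j + 1)
    rw [changeTo_one, changeFrom_one, changeD_one,
      ← cancel_epi (eqToHom (changeX_one X.cpx j B₁ B₂).symm),
      ← cancel_mono (eqToHom (changeX_one X.cpx j B₁ B₂))]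
    simp only [Category.assoc, Preadditive.comp_add, Preadditive.add_comp, eqToHom_trans,
      eqToHom_trans_assoc, eqToHom_refl, Category.id_comp, Category.comp_id]
    rw [add_comm, hgf₁]
  · rw [hQd]
    change 𝟙 (changeX X.cpx j B₁ B₂ (j + 2)) = _ ≫ changeD f₁ f₂ g₁ g₂ d₁ (j + 1) +
      changeFrom g₁ g₂ (j + 2) ≫ changeTo f₁ f₂ (j + 2)
    rw [changeTo_two, changeFrom_two, changeD_one,
      ← cancel_epi (eqToHom (changeX_two X.cpx j B₁ B₂).symm),
      ← cancel_mono (eqToHom (changeX_two X.cpx j B₁ B₂))]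
    simp only [Category.assoc, Preadditive.comp_add, Preadditive.add_comp, eqToHom_trans,
      eqToHom_trans_assoc, eqToHom_refl, Category.id_comp, Category.comp_id]
    rw [add_comm, hgf₂]
  · intro m h₁ h₂
    exact (changeFrom_comp_changeTo h₁ h₂).symm
  · exact (congrArg (· ≫ eqToHom (changeX_one X.cpx j B₁ B₂)) (changeTo_one f₁ f₂)).trans (by simp)
  · exact changeFrom_two g₁ g₂

end LocalChange

/-! ### Terms in an additive subcategory -/

section Terms

variable {D : Type u} [Category.{v} D] [Preadditive D] {n : ℕ}

lemma isZero_trivComplex (B : D) {Z : D} (hZ : IsZero Z) {i j : ℕ} (h : j ≠ i) (h' : j ≠ i + 1) :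
    IsZero ((trivComplex i B Z).X j) := by
  change IsZero (if _ then _ else _)
  rwa [if_neg (by omega)]

namespace ComplexBetween

/-- All terms of the complex are in `P`. -/
def TermsIn {A C : D} (P : ObjectProperty D) (X : ComplexBetween n A C) : Prop :=
  ∀ i, P (X.cpx.X i)

variable {P : ObjectProperty D} {A C : D} {X : ComplexBetween n A C}

lemma TermsIn.left (h : X.TermsIn P) : P A := by
  have := h 0
  rwa [X.left] at this

lemma TermsIn.right (h : X.TermsIn P) : P C := by
  have := h (n + 1)
  rwa [X.right] at this

end ComplexBetween

variable [HasBinaryBiproducts D] (P : ObjectProperty D) [IsAdditiveSubcategory P]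

lemma prop_biprod {B B' : D} (h : P B) (h' : P B') : P (B ⊞ B') :=
  IsAdditiveSubcategory.biprod B B' h h'

variable {P}

namespace ComplexBetween

variable {A B C C' : D} {X : ComplexBetween n A C} {Y : ComplexBetween n B C'}

lemma termsIn_of_le (h : ∀ i, i ≤ n + 1 → P (X.cpx.X i)) : X.TermsIn P := fun i => by
  by_cases hi : i ≤ n + 1
  · exact h i hi
  · exact P.prop_of_isZero (X.isZero i (by omega))

lemma TermsIn.mappingCone (hX : X.TermsIn P) (hY : Y.TermsIn P) (f : X.cpx ⟶ Y.cpx) :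
    (mappingCone X Y f).TermsIn P := by
  rintro (_ | i)
  · exact hX 1
  · change P (if i + 1 ≤ n then _ else _)
    split_ifs
    · exact prop_biprod P (hX _) (hY _)
    · exact hY _

lemma TermsIn.mappingCocone (hX : X.TermsIn P) (hY : Y.TermsIn P) (f : X.cpx ⟶ Y.cpx) :
    (mappingCocone X Y f).TermsIn P := by
  rintro (_ | i)
  · exact hX 0
  · change P (if i + 1 ≤ n then _ else if i = n then _ else _)
    split_ifs
    · exact prop_biprod P (hX _) (hY _)
    · exact hY _
    · exact hX _

end ComplexBetween

lemma prop_trivComplex {B Z : D} (hB : P B) (hZ : IsZero Z) (i j : ℕ) :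
    P ((trivComplex i B Z).X j) := by
  change P (if _ then _ else _)
  split_ifs
  · exact hB
  · exact P.prop_of_isZero hZ

end Terms

/-! ### Cancellation of direct summands for `n ≥ 2` -/

section GaussianElimination

variable {D : Type u} [Category.{v} D] [Preadditive D] {n : ℕ}

/-- Gaussian elimination: if `(f₁, s; g₁, i)` and `(f₂, t; g₂, i')` exhibit the terms of `N` in
degrees `j + 1` and `j + 2` as biproducts `B₁ ⊞ V` and `B₂ ⊞ V`, and the component `V ⟶ V` of the
differential is the identity, then both copies of `V` can be cancelled. -/
lemma ComplexBetween.exists_cancel {A C : D} (N : ComplexBetween n A C) (j : ℕ) (hj : j + 2 ≤ n)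
    {B₁ B₂ V : D} (f₁ : N.cpx.X (j + 1) ⟶ B₁) (s : N.cpx.X (j + 1) ⟶ V)
    (g₁ : B₁ ⟶ N.cpx.X (j + 1)) (i : V ⟶ N.cpx.X (j + 1))
    (f₂ : N.cpx.X (j + 2) ⟶ B₂) (t : N.cpx.X (j + 2) ⟶ V)
    (g₂ : B₂ ⟶ N.cpx.X (j + 2)) (i' : V ⟶ N.cpx.X (j + 2))
    (h₁ : f₁ ≫ g₁ + s ≫ i = 𝟙 _) (hgf₁ : g₁ ≫ f₁ = 𝟙 _) (hif₁ : i ≫ f₁ = 0)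
    (h₂ : f₂ ≫ g₂ + t ≫ i' = 𝟙 _) (hgf₂ : g₂ ≫ f₂ = 𝟙 _) (hgt₂ : g₂ ≫ t = 0)
    (hV : i ≫ N.cpx.d (j + 1) (j + 2) ≫ t = 𝟙 _) :
    ∃ (Q : ComplexBetween n A C) (f : N.cpx ⟶ Q.cpx) (g : Q.cpx ⟶ N.cpx)
      (e₁ : Q.cpx.X (j + 1) = B₁) (e₂ : Q.cpx.X (j + 2) = B₂),
      HtpyEquivBetween N Q ∧ IsLift N Q f (𝟙 A) (𝟙 C) ∧ IsLift Q N g (𝟙 A) (𝟙 C) ∧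
        f.f (j + 1) ≫ eqToHom e₁ = f₁ ∧ g.f (j + 2) = eqToHom e₂ ≫ g₂ ∧
        ∀ m, m ≠ j + 1 → m ≠ j + 2 → Q.cpx.X m = N.cpx.X m := by
  generalize hd : N.cpx.d (j + 1) (j + 2) = d at hV
  have hfg₁ : f₁ ≫ g₁ = 𝟙 _ - s ≫ i := eq_sub_of_add_eq h₁
  have hfg₂ : f₂ ≫ g₂ = 𝟙 _ - t ≫ i' := eq_sub_of_add_eq h₂
  have hfG₁ : f₁ ≫ (g₁ - g₁ ≫ d ≫ t ≫ i) = 𝟙 _ - d ≫ t ≫ i := by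
    simp [reassoc_of% hfg₁, hfg₁, reassoc_of% hV]
  have hGt : (g₁ - g₁ ≫ d ≫ t ≫ i) ≫ d ≫ t = 0 := by
    simp [hV]
  have hFg₂ : (f₂ - t ≫ i ≫ d ≫ f₂) ≫ g₂ = 𝟙 _ - t ≫ i ≫ d := by
    simp [hfg₂, reassoc_of% hV]
  refine N.exists_localChange j hj ((g₁ - g₁ ≫ d ≫ t ≫ i) ≫ d ≫ f₂) f₁
    (f₂ - t ≫ i ≫ d ≫ f₂) (g₁ - g₁ ≫ d ≫ t ≫ i) g₂ (t ≫ i) 0 ?_ ?_ ?_ ?_ ?_ ?_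
  · rw [hd, reassoc_of% hfG₁]
    simp
  · rw [hd, Category.assoc, Category.assoc, hfg₂, Preadditive.comp_sub, Preadditive.comp_sub,
      reassoc_of% hGt]
    simp
  · rw [hfG₁, hd, sub_add_cancel]
  · rw [hFg₂, hd, Category.assoc, sub_add_cancel]
  · simp [hgf₁, hif₁]
  · simp [hgf₂, reassoc_of% hgt₂]

end GaussianElimination

section Cancellation

variable {D : Type u} [Category.{v} D] [Preadditive D] [HasZeroObject D] [HasBinaryBiproducts D]
  {m : ℕ} {G : Dᵒᵖ ⥤ D ⥤ AddCommGrpCat.{w}} {r : RealisationMap (m + 2) G}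
  {P : ObjectProperty D} [IsAdditiveSubcategory P]

/-- The zero extension of `B` by a zero object has a realisation whose term in degree `1` is any
given object `V`: add `V ⟶ V` in degrees `1` and `2`. -/
lemma IsNExangulated.exists_trivRight_add (h : IsNExangulated G r) {Z B V : D} (hZ : IsZero Z)
    (hB : P B) (hV : P V) :
    ∃ T : ComplexBetween (m + 2) Z B, r (0 : Extn G B Z) = T.cls ∧ T.TermsIn P ∧
      T.cpx.X 1 = V := by
  let X := trivRight (m + 2) Z B hZ
  have hX1 : IsZero (X.cpx.X 1) := isZero_trivComplex B hZ (by omega) (by omega)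
  obtain ⟨T, f, g, e₁, e₂, hT, -, -, -, -, hTX⟩ :=
    X.exists_localChange 0 (by omega) (B₁ := V) (B₂ := X.cpx.X 2 ⊞ V) biprod.inr 0 biprod.inl 0
      biprod.fst 0 biprod.snd (hX1.eq_of_src _ _) (by simp) (hX1.eq_of_src _ _) (by simp)
      (by simp) biprod.total
  refine ⟨T, ?_, fun i => ?_, e₁⟩
  · rw [h.exactRealisation.triv_right Z B hZ]
    exact (X.cls_eq_iff T).2 hT
  · by_cases h1 : i = 1
    · subst h1
      rwa [show T.cpx.X 1 = V from e₁]
    · by_cases h2 : i = 2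
      · subst h2
        rw [show T.cpx.X 2 = (X.cpx.X 2 ⊞ V : D) from e₂]
        exact prop_biprod P (prop_trivComplex hB hZ _ _) hV
      · rw [hTX i h1 h2]
        exact prop_trivComplex hB hZ _ _

/-- The dual: add `V ⟶ V` in degrees `n - 1` and `n`. -/
lemma IsNExangulated.exists_trivLeft_add (h : IsNExangulated G r) {B Z V : D} (hZ : IsZero Z)
    (hB : P B) (hV : P V) :
    ∃ T : ComplexBetween (m + 2) B Z, r (0 : Extn G Z B) = T.cls ∧ T.TermsIn P ∧
      T.cpx.X (m + 2) = V := by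
  let X := trivLeft (m + 2) B Z hZ
  have hX2 : IsZero (X.cpx.X (m + 2)) := isZero_trivComplex B hZ (by omega) (by omega)
  obtain ⟨T, f, g, e₁, e₂, hT, -, -, -, -, hTX⟩ :=
    X.exists_localChange m le_rfl (B₁ := X.cpx.X (m + 1) ⊞ V) (B₂ := V) biprod.snd biprod.inl 0
      biprod.fst 0 0 biprod.inr (by simp) (hX2.eq_of_tgt _ _) (by simp) (hX2.eq_of_src _ _)
      biprod.total (by simp)
  refine ⟨T, ?_, fun i => ?_, e₂⟩
  · rw [h.exactRealisation.triv_left B Z hZ]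
    exact (X.cls_eq_iff T).2 hT
  · by_cases h1 : i = m + 1
    · subst h1
      rw [e₁]
      exact prop_biprod P (prop_trivComplex hB hZ _ _) hV
    · by_cases h2 : i = m + 2
      · subst h2
        rwa [e₂]
      · rw [hTX i h1 h2]
        exact prop_trivComplex hB hZ _ _

/-- If an inflation `A ⟶ B ⊞ V` has zero component at `V`, then its component at `B` is an
inflation. The summand `V` in degree `1` is cancelled against a copy of `V` in degree `2`, which is
created by the mapping cocone of a morphism to a split complex. -/
lemma IsNExangulated.exists_inflation_of_biprod (h : IsNExangulated G r) {A C B V : D}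
    {π : Extn G C A} {R : ComplexBetween (m + 2) A C} (hR : r π = R.cls) (hRP : R.TermsIn P)
    (hB : P B) (hV : P V) (φ : R.cpx.X 1 ≅ B ⊞ V) (hφ : R.dLeft ≫ φ.hom ≫ biprod.snd = 0) :
    ∃ (C' : D) (σ : Extn G C' A) (Q : ComplexBetween (m + 2) A C'), r σ = Q.cls ∧ Q.TermsIn P ∧
      ∃ e : Q.cpx.X 1 = B, Q.dLeft ≫ eqToHom e = R.dLeft ≫ φ.hom ≫ biprod.fst := by
  obtain ⟨Z, hZ⟩ : ∃ Z : D, IsZero Z := HasZeroObject.zero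
  obtain ⟨T, hT, hTP, hT1⟩ := h.exists_trivRight_add hZ hRP.right hV
  have hpush : push (0 : A ⟶ Z) π = 0 := h.biadditive.zero_push π
  obtain ⟨F, hF, hN⟩ := h.good_lift_op (0 : A ⟶ Z) π R T hR (by rw [hpush]; exact hT)
  have hT0 : IsZero (T.cpx.X 0) := by rw [T.left]; exact hZ
  let y : T.cpx.X 1 ≅ V := eqToIso hT1
  obtain ⟨q, hq⟩ := (h.isNExangle hR).exists_of_dLeft_comp_eq_zero
    (φ.hom ≫ biprod.snd - F.f 1 ≫ y.hom) (by
      rw [Preadditive.comp_sub, hφ, ← Category.assoc, hF.dLeft_comp]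
      simp)
  set N := mappingCocone R T F
  let i₁ := mappingCocone.inl R T F 1
  let p₁ := mappingCocone.fst R T F 1
  let i₂ := mappingCocone.inl R T F 2
  let p₂ := mappingCocone.fst R T F 2
  let i₂' := mappingCocone.inr R T F 1
  let p₂' : N.cpx.X 2 ⟶ T.cpx.X 1 := mappingCocone.snd R T F 1
  have h11 : i₁ ≫ p₁ = 𝟙 _ := mappingCocone.inl_fst R T F (by omega)
  have h11' : p₁ ≫ i₁ = 𝟙 _ := by
    have := mappingCocone.total R T F (Nat.zero_le (m + 2))
    rwa [hT0.eq_of_tgt (mappingCocone.snd R T F 0) 0, zero_comp, add_zero] at this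
  have h22 : i₂ ≫ p₂ = 𝟙 _ := mappingCocone.inl_fst R T F (by omega)
  have h22' : i₂' ≫ p₂' = 𝟙 _ := mappingCocone.inr_snd R T F (by omega)
  have h22a : i₂ ≫ p₂' = 0 := mappingCocone.inl_snd R T F 1
  have h22b : i₂' ≫ p₂ = 0 := mappingCocone.inr_fst R T F 1
  have ht : p₂ ≫ i₂ + p₂' ≫ i₂' = 𝟙 _ := mappingCocone.total R T F (by omega)
  have hd : N.cpx.d 1 2 = p₁ ≫ (R.cpx.d 1 2 ≫ i₂ + F.f 1 ≫ i₂') := by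
    have := mappingCocone.d_succ_eq R T F 0
    rw [hT0.eq_of_tgt (mappingCocone.snd R T F 0) 0, zero_comp, add_zero] at this
    exact this
  -- the projection `N₂ ⟶ V` along which `V` is cancelled
  let t : N.cpx.X 2 ⟶ V := p₂ ≫ q + p₂' ≫ y.hom
  have hdt : N.cpx.d 1 2 ≫ t = p₁ ≫ φ.hom ≫ biprod.snd := by
    simp only [t, hd, Category.assoc, Preadditive.comp_add, Preadditive.add_comp,
      reassoc_of% h22, reassoc_of% h22', reassoc_of% h22a, reassoc_of% h22b, zero_comp, comp_zero,
      add_zero, zero_add, hq, Preadditive.comp_sub]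
    abel
  -- `V` is a summand of `N₁ ≅ R₁ ≅ B ⊞ V`, and `N₂ ≅ R₂ ⊞ V` with second projection `t`
  obtain ⟨Q, f, g, e₁, e₂, hQ, hf, -, hf₁, -, hQN⟩ :=
    N.exists_cancel 0 (by omega) (p₁ ≫ φ.hom ≫ biprod.fst) (p₁ ≫ φ.hom ≫ biprod.snd)
      (biprod.inl ≫ φ.inv ≫ i₁) (biprod.inr ≫ φ.inv ≫ i₁) p₂ t (i₂ - q ≫ y.inv ≫ i₂')
      (y.inv ≫ i₂')
      (by
        have : φ.hom ≫ (biprod.fst ≫ biprod.inl + biprod.snd ≫ biprod.inr) ≫ φ.inv = 𝟙 _ := by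
          rw [biprod.total]; simp
        calc _ = p₁ ≫ (φ.hom ≫ (biprod.fst ≫ biprod.inl + biprod.snd ≫ biprod.inr) ≫
                φ.inv) ≫ i₁ := by
              simp only [Category.assoc, Preadditive.comp_add, Preadditive.add_comp]
          _ = 𝟙 _ := by rw [this, Category.id_comp, h11'])
      (by simp [reassoc_of% h11]) (by simp [reassoc_of% h11])
      (by
        rw [← ht]
        simp [t]
        abel)
      (by simp [h22, h22b])
      (by simp [t, reassoc_of% h22, reassoc_of% h22b, reassoc_of% h22a, reassoc_of% h22'])
      (by
        change _ ≫ N.cpx.d 1 2 ≫ t = _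
        rw [hdt]
        simp [reassoc_of% h11])
  refine ⟨_, _, Q, hN.trans ((N.cls_eq_iff Q).2 hQ), fun j => ?_, e₁, ?_⟩
  · by_cases h1 : j = 1
    · subst h1
      rwa [show Q.cpx.X 1 = B from e₁]
    · by_cases h2 : j = 2
      · subst h2
        rw [show Q.cpx.X 2 = R.cpx.X 2 from e₂]
        exact hRP 2
      · rw [hQN j h1 h2]
        exact hRP.mappingCocone hTP F j
  · have h1 : Q.dLeft = N.dLeft ≫ f.f 1 := by rw [hf.dLeft_comp, Category.id_comp]
    rw [h1, Category.assoc]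
    refine (congrArg (N.dLeft ≫ ·) hf₁).trans ?_
    have hNp : N.dLeft ≫ p₁ = R.dLeft := by
      change (mappingCocone R T F).dLeft ≫ p₁ = _
      rw [mappingCocone.dLeft_eq, hF.isoLeft_inv, zero_comp, zero_comp, add_zero, Category.assoc]
      exact (congrArg (R.dLeft ≫ ·) h11).trans (Category.comp_id _)
    rw [← hNp, Category.assoc]

/-- If a deflation `B ⊞ V ⟶ C` has zero component at `V`, then its component at `B` is a
deflation. -/
lemma IsNExangulated.exists_deflation_of_biprod (h : IsNExangulated G r) {A C B V : D}
    {π : Extn G C A} {R : ComplexBetween (m + 2) A C} (hR : r π = R.cls) (hRP : R.TermsIn P)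
    (hB : P B) (hV : P V) (φ : R.cpx.X (m + 2) ≅ B ⊞ V)
    (hφ : biprod.inr ≫ φ.inv ≫ R.dRight = 0) :
    ∃ (A' : D) (σ : Extn G C A') (Q : ComplexBetween (m + 2) A' C), r σ = Q.cls ∧ Q.TermsIn P ∧
      ∃ e : Q.cpx.X (m + 2) = B, Q.dRight = eqToHom e ≫ biprod.inl ≫ φ.inv ≫ R.dRight := by
  obtain ⟨Z, hZ⟩ : ∃ Z : D, IsZero Z := HasZeroObject.zero
  obtain ⟨T, hT, hTP, hTm⟩ := h.exists_trivLeft_add hZ hRP.left hV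
  have hpull : pull (0 : Z ⟶ C) π = 0 := h.biadditive.zero_pull π
  obtain ⟨F, hF, hN⟩ := h.good_lift (0 : Z ⟶ C) π T R (by rw [hpull]; exact hT) hR
  have hTn : IsZero (T.cpx.X (m + 2 + 1)) := by rw [T.right]; exact hZ
  let y : T.cpx.X (m + 2) ≅ V := eqToIso hTm
  obtain ⟨q, hq⟩ := (h.isNExangle hR).exists_of_comp_dRight_eq_zero (m := m + 1)
    (biprod.inr ≫ φ.inv - y.inv ≫ F.f (m + 2)) (by
      rw [Preadditive.sub_comp, Category.assoc, Category.assoc, hφ, hF.comp_dRight]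
      simp)
  set N := mappingCone T R F
  let i₁ : T.cpx.X (m + 2) ⟶ N.cpx.X (m + 1) := mappingCone.inl T R F (m + 1)
  let p₁ : N.cpx.X (m + 1) ⟶ T.cpx.X (m + 2) := mappingCone.fst T R F (m + 1)
  let i₁' := mappingCone.inr T R F (m + 1)
  let p₁' := mappingCone.snd T R F (m + 1)
  let i₂ := mappingCone.inr T R F (m + 2)
  let p₂ := mappingCone.snd T R F (m + 2)
  have h11 : i₁ ≫ p₁ = 𝟙 _ := mappingCone.inl_fst T R F (by omega)
  have h11' : i₁' ≫ p₁' = 𝟙 _ := mappingCone.inr_snd T R F m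
  have h11a : i₁ ≫ p₁' = 0 := mappingCone.inl_snd T R F (m + 1)
  have h11b : i₁' ≫ p₁ = 0 := mappingCone.inr_fst T R F (m + 1)
  have ht : p₁ ≫ i₁ + p₁' ≫ i₁' = 𝟙 _ := mappingCone.total T R F (m + 1)
  have h22 : i₂ ≫ p₂ = 𝟙 _ := mappingCone.inr_snd T R F (m + 1)
  have h22' : p₂ ≫ i₂ = 𝟙 _ := by
    have := mappingCone.total T R F (m + 2)
    rwa [hTn.eq_of_tgt (mappingCone.fst T R F (m + 2)) 0, zero_comp, zero_add] at this
  have hd : N.cpx.d (m + 1) (m + 2) =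
      p₁ ≫ F.f (m + 2) ≫ i₂ + p₁' ≫ R.cpx.d (m + 1) (m + 2) ≫ i₂ := by
    have := mappingCone.d_eq T R F (m + 1)
    rw [hTn.eq_of_src (mappingCone.inl T R F (m + 1 + 1)) 0, comp_zero, neg_zero,
      zero_add] at this
    exact this
  -- the inclusion `V ⟶ N_{n-1}` along which `V` is cancelled
  let i : V ⟶ N.cpx.X (m + 1) := q ≫ i₁' + y.inv ≫ i₁
  have hid : i ≫ N.cpx.d (m + 1) (m + 2) = biprod.inr ≫ φ.inv ≫ i₂ := by
    have hq' : q ≫ R.cpx.d (m + 1) (m + 2) = biprod.inr ≫ φ.inv - y.inv ≫ F.f (m + 2) := hq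
    simp only [i, hd, Category.assoc, Preadditive.comp_add, Preadditive.add_comp,
      reassoc_of% h11, reassoc_of% h11', reassoc_of% h11a, reassoc_of% h11b, zero_comp, comp_zero,
      add_zero, zero_add, reassoc_of% hq', Preadditive.sub_comp]
    abel
  obtain ⟨Q, f, g, e₁, e₂, hQ, -, hg, -, hg₂, hQN⟩ :=
    N.exists_cancel m le_rfl (p₁' - p₁ ≫ y.hom ≫ q) (p₁ ≫ y.hom) i₁' i
      (p₂ ≫ φ.hom ≫ biprod.fst) (p₂ ≫ φ.hom ≫ biprod.snd)
      (biprod.inl ≫ φ.inv ≫ i₂) (biprod.inr ≫ φ.inv ≫ i₂)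
      (by
        rw [← ht]
        simp [i]
        abel)
      (by simp [h11', reassoc_of% h11b])
      (by simp [i, h11', h11a, reassoc_of% h11, reassoc_of% h11b])
      (by
        have : φ.hom ≫ (biprod.fst ≫ biprod.inl + biprod.snd ≫ biprod.inr) ≫ φ.inv = 𝟙 _ := by
          rw [biprod.total]; simp
        calc _ = p₂ ≫ (φ.hom ≫ (biprod.fst ≫ biprod.inl + biprod.snd ≫ biprod.inr) ≫
                φ.inv) ≫ i₂ := by
              simp only [Category.assoc, Preadditive.comp_add, Preadditive.add_comp]
          _ = 𝟙 _ := by rw [this, Category.id_comp, h22'])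
      (by simp [reassoc_of% h22]) (by simp [reassoc_of% h22])
      (by
        rw [reassoc_of% hid]
        simp [reassoc_of% h22])
  refine ⟨_, _, Q, hN.trans ((N.cls_eq_iff Q).2 hQ), fun j => ?_, e₂, ?_⟩
  · by_cases h1 : j = m + 1
    · subst h1
      rw [e₁]
      exact hRP _
    · by_cases h2 : j = m + 2
      · subst h2
        rwa [e₂]
      · rw [hQN j h1 h2]
        exact hTP.mappingCone hRP F j
  · have h1 : Q.dRight = g.f (m + 2) ≫ N.dRight := by rw [hg.comp_dRight, Category.comp_id]
    have h2 : i₂ ≫ N.dRight = R.dRight := by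
      change i₂ ≫ (mappingCone T R F).dRight = _
      rw [mappingCone.dRight_eq, Preadditive.comp_add]
      have h3 : i₂ ≫ mappingCone.fst T R F (m + 2) = 0 := mappingCone.inr_fst T R F (m + 2)
      rw [reassoc_of% h3, zero_comp, zero_add, reassoc_of% h22]
    rw [h1, hg₂]
    simp only [Category.assoc, h2]

end Cancellation

/-! ### Composites of inflations and of deflations -/

section Composition

variable {D : Type u} [Category.{v} D] [Preadditive D] {G : Dᵒᵖ ⥤ D ⥤ AddCommGrpCat.{w}} {n : ℕ}

lemma IsInflation.exists_realisation {r : RealisationMap n G} {A B : D} {f : A ⟶ B}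
    (hf : IsInflation r f) :
    ∃ (C : D) (δ : Extn G C A) (X : ComplexBetween n A C), r δ = X.cls ∧
      ∃ e : X.cpx.X 1 = B, X.dLeft ≫ eqToHom e = f := by
  cases hf with
  | mk δ X h => exact ⟨_, δ, X, h, rfl, by simp⟩

lemma IsDeflation.exists_realisation {r : RealisationMap n G} {B C : D} {f : B ⟶ C}
    (hf : IsDeflation r f) :
    ∃ (A : D) (δ : Extn G C A) (X : ComplexBetween n A C), r δ = X.cls ∧
      ∃ e : X.cpx.X n = B, X.dRight = eqToHom e ≫ f := by
  cases hf with
  | mk δ X h => exact ⟨_, δ, X, h, rfl, by simp⟩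

lemma IsInflation.comp_eqToHom {r : RealisationMap n G} {A B B' : D} {f : A ⟶ B}
    (hf : IsInflation r f) (e : B = B') : IsInflation r (f ≫ eqToHom e) := by
  subst e
  simpa using hf

lemma IsDeflation.eqToHom_comp {r : RealisationMap n G} {B B' C : D} {f : B ⟶ C}
    (hf : IsDeflation r f) (e : B' = B) : IsDeflation r (eqToHom e ≫ f) := by
  subst e
  simpa using hf

variable [HasBinaryBiproducts D] {P : ObjectProperty D} [IsAdditiveSubcategory P]

lemma IsNExtensionClosed.exists_realisation {r : RealisationMap n G}
    (hP : IsNExtensionClosed r P) {A C : D} (hA : P A) (hC : P C) (δ : Extn G C A) :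
    ∃ X : ComplexBetween n A C, r δ = X.cls ∧ X.TermsIn P := by
  obtain ⟨X, hX, hXP⟩ := hP A C hA hC δ
  exact ⟨X, hX, ComplexBetween.termsIn_of_le hXP⟩

variable [HasZeroObject D]

/-- For `n ≥ 2`, if an inflation factors as `b ≫ χ`, then `b` is an inflation. The mapping cocone
over the push-forward along `b` has first morphism `(d₀, b)`, which becomes `(0, b)` after a change
of coordinates by `χ`. -/
lemma IsNExangulated.exists_inflation_of_comp_eq {m : ℕ} {r : RealisationMap (m + 2) G}
    (h : IsNExangulated G r) (hP : IsNExtensionClosed r P) {A B C : D} {ζ : Extn G C A}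
    {Z : ComplexBetween (m + 2) A C} (hZ : r ζ = Z.cls) (hZP : Z.TermsIn P) (hB : P B)
    (b : A ⟶ B) (χ : B ⟶ Z.cpx.X 1) (hb : b ≫ χ = Z.dLeft) :
    ∃ (C' : D) (σ : Extn G C' A) (Q : ComplexBetween (m + 2) A C'), r σ = Q.cls ∧ Q.TermsIn P ∧
      ∃ e : Q.cpx.X 1 = B, Q.dLeft ≫ eqToHom e = b := by
  obtain ⟨Y, hY, hYP⟩ := hP.exists_realisation hB hZP.right (push b ζ)
  obtain ⟨f, hf, hR⟩ := h.good_lift_op b ζ Z Y hZ hY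
  let i := mappingCocone.inl Z Y f 1
  let p := mappingCocone.fst Z Y f 1
  let i' : B ⟶ (mappingCocone Z Y f).cpx.X 1 := Y.isoLeft.inv ≫ mappingCocone.inr Z Y f 0
  let p' : (mappingCocone Z Y f).cpx.X 1 ⟶ B := mappingCocone.snd Z Y f 0 ≫ Y.isoLeft.hom
  have hip : i ≫ p = 𝟙 _ := mappingCocone.inl_fst Z Y f (by omega)
  have hip' : i' ≫ p' = 𝟙 _ := by
    have := mappingCocone.inr_snd Z Y f (Nat.zero_le (m + 2))
    simp [i', p', reassoc_of% this]
  have h1 : i ≫ p' = 0 := by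
    have : i ≫ mappingCocone.snd Z Y f 0 = 0 := mappingCocone.inl_snd Z Y f 0
    simp [p', reassoc_of% this]
  have h2 : i' ≫ p = 0 := by
    have : mappingCocone.inr Z Y f 0 ≫ p = 0 := mappingCocone.inr_fst Z Y f 0
    simp [i', this]
  have ht : p ≫ i + p' ≫ i' = 𝟙 _ := by
    have := mappingCocone.total Z Y f (Nat.zero_le (m + 2))
    simpa [i', p'] using this
  have hd : (mappingCocone Z Y f).dLeft = Z.dLeft ≫ i + b ≫ i' := by
    rw [mappingCocone.dLeft_eq, hf.isoLeft_inv, Category.assoc]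
  let φ : (mappingCocone Z Y f).cpx.X 1 ≅ B ⊞ Z.cpx.X 1 :=
    { hom := biprod.lift p' (p - p' ≫ χ)
      inv := biprod.desc (i' + χ ≫ i) i
      hom_inv_id := by
        rw [biprod.lift_desc, ← ht]
        simp
        abel
      inv_hom_id := by
        ext <;> simp [hip, hip', h1, h2, reassoc_of% hip', reassoc_of% h1] }
  obtain ⟨C', σ, Q, hQ, hQP, e, he⟩ := h.exists_inflation_of_biprod hR (hZP.mappingCocone hYP f)
    hB (hZP 1) φ (by
      simp [φ, hd, hip, h2, reassoc_of% hip', reassoc_of% h1, hb])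
  refine ⟨C', σ, Q, hQ, hQP, e, he.trans ?_⟩
  simp [φ, hd, hip', h1]

/-- For `n ≥ 2`, if a deflation factors as `χ ≫ b`, then `b` is a deflation. -/
lemma IsNExangulated.exists_deflation_of_comp_eq {m : ℕ} {r : RealisationMap (m + 2) G}
    (h : IsNExangulated G r) (hP : IsNExtensionClosed r P) {A B C : D} {ζ : Extn G C A}
    {Z : ComplexBetween (m + 2) A C} (hZ : r ζ = Z.cls) (hZP : Z.TermsIn P) (hB : P B)
    (b : B ⟶ C) (χ : Z.cpx.X (m + 2) ⟶ B) (hb : χ ≫ b = Z.dRight) :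
    ∃ (A' : D) (σ : Extn G C A') (Q : ComplexBetween (m + 2) A' C), r σ = Q.cls ∧ Q.TermsIn P ∧
      ∃ e : Q.cpx.X (m + 2) = B, Q.dRight = eqToHom e ≫ b := by
  obtain ⟨Y, hY, hYP⟩ := hP.exists_realisation hZP.left hB (pull b ζ)
  obtain ⟨f, hf, hR⟩ := h.good_lift b ζ Y Z hY hZ
  let i : B ⟶ (mappingCone Y Z f).cpx.X (m + 2) :=
    Y.isoRight.inv ≫ mappingCone.inl Y Z f (m + 2)
  let p : (mappingCone Y Z f).cpx.X (m + 2) ⟶ B :=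
    mappingCone.fst Y Z f (m + 2) ≫ Y.isoRight.hom
  let i' := mappingCone.inr Y Z f (m + 2)
  let p' := mappingCone.snd Y Z f (m + 2)
  have hip : i ≫ p = 𝟙 _ := by
    have := mappingCone.inl_fst Y Z f (le_refl (m + 2))
    simp [i, p, reassoc_of% this]
  have hip' : i' ≫ p' = 𝟙 _ := mappingCone.inr_snd Y Z f (m + 1)
  have h1 : i ≫ p' = 0 := by simp [i, p']
  have h2 : i' ≫ p = 0 := by
    have := mappingCone.inr_fst Y Z f (m + 2)
    simp [i', p, reassoc_of% this]
  have ht : p ≫ i + p' ≫ i' = 𝟙 _ := by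
    have := mappingCone.total Y Z f (m + 2)
    simpa [i, p] using this
  have hd : (mappingCone Y Z f).dRight = p ≫ b + p' ≫ Z.dRight := by
    rw [mappingCone.dRight_eq, hf.right]
    simp [p, p']
  let φ : (mappingCone Y Z f).cpx.X (m + 2) ≅ B ⊞ Z.cpx.X (m + 2) :=
    { hom := biprod.lift (p + p' ≫ χ) p'
      inv := biprod.desc i (i' - χ ≫ i)
      hom_inv_id := by
        rw [biprod.lift_desc, ← ht]
        simp
      inv_hom_id := by
        ext <;> simp [hip, hip', h1, h2, reassoc_of% hip', reassoc_of% h1] }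
  obtain ⟨A', σ, Q, hQ, hQP, e, he⟩ := h.exists_deflation_of_biprod hR (hYP.mappingCone hZP f)
    hB (hZP _) φ (by
      simp [φ, hd, reassoc_of% hip, reassoc_of% hip', reassoc_of% h1, reassoc_of% h2, hb])
  refine ⟨A', σ, Q, hQ, hQP, e, he.trans ?_⟩
  simp [φ, hd, reassoc_of% hip, reassoc_of% h1]

/-- The composite of two inflations whose distinguished `n`-exangles have all terms in `P` is again
the inflation of such an `n`-exangle. For `n = 1` the cone of the composite is isomorphic to the
middle term of a realisation of `(d₁^X)_* ρ`. For `n ≥ 2` some inflation with terms in `P` factors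
through the composite. -/
lemma IsNExangulated.exists_inflation_comp [NeZero n] {r : RealisationMap n G}
    (h : IsNExangulated G r) (hP : IsNExtensionClosed r P) {A C C' : D}
    {δ : Extn G C A} {X : ComplexBetween n A C} (hX : r δ = X.cls) (hXP : X.TermsIn P)
    {ρ : Extn G C' (X.cpx.X 1)} {Y : ComplexBetween n (X.cpx.X 1) C'} (hY : r ρ = Y.cls)
    (hYP : Y.TermsIn P) :
    ∃ (C'' : D) (σ : Extn G C'' A) (Q : ComplexBetween n A C''), r σ = Q.cls ∧ Q.TermsIn P ∧
      ∃ e : Q.cpx.X 1 = Y.cpx.X 1, Q.dLeft ≫ eqToHom e = X.dLeft ≫ Y.dLeft := by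
  obtain ⟨C'', ζ, Z, hZ, e, he⟩ :=
    (h.inflation_comp X.dLeft Y.dLeft ⟨δ, X, hX⟩ ⟨ρ, Y, hY⟩).exists_realisation
  obtain ⟨W, hW, hWP⟩ := hP.exists_realisation (hXP 2) hYP.right (push (X.cpx.d 1 2) ρ)
  obtain ⟨N, M, hN, hM, φ, hφ⟩ := h.exists_iso_dLeft_comp hX hY hZ (eqToIso e) he hW
  obtain _ | _ | m := n
  · exact absurd rfl (NeZero.ne 0)
  · obtain ⟨ψ⟩ := h.nonempty_iso_right hN hM φ hφ
    refine ⟨C'', ζ, Z, hZ, ComplexBetween.termsIn_of_le fun i hi => ?_, e, he⟩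
    obtain rfl | rfl | rfl : i = 0 ∨ i = 1 ∨ i = 2 := by omega
    · rw [Z.left]
      exact hXP.left
    · rw [e]
      exact hYP 1
    · rw [show Z.cpx.X 2 = C'' from Z.right]
      exact P.prop_of_iso ψ (hWP 1)
  · obtain ⟨p, hp⟩ := h.exists_pull_eq hM (pull W.dRight ρ) (by
      rw [← hφ, push_comp, (h.isNExangle hN).push_eq_zero, push_zero])
    -- `p` is the end of a comparison of the two `n`-exangles; it need not be invertible, but `Z`
    -- can be replaced by a realisation `Z'` of the extension with components `p^* ζ` and `δ`
    let ζ' : Extn G (W.cpx.X (m + 2) ⊞ C) A := pull biprod.fst (pull p ζ) + pull biprod.snd δ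
    have hinl : pull biprod.inl ζ' = pull p ζ := by
      simp only [ζ', pull_add, ← pull_comp, biprod.inl_snd, h.biadditive.zero_pull, add_zero,
        biprod.inl_fst_assoc]
    have hinr : pull biprod.inr ζ' = δ := by
      simp only [ζ', pull_add, ← pull_comp, biprod.inr_snd, biprod.inr_fst_assoc, zero_comp,
        h.biadditive.zero_pull, zero_add, pull_id]
    obtain ⟨Z', hZ', hZP'⟩ := hP.exists_realisation hXP.left
      (prop_biprod P (hWP (m + 2)) hXP.right) ζ'
    have hdζ' : push Z'.dLeft ζ' = 0 := (h.isNExangle hZ').push_eq_zero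
    -- the component `δ` makes `Z'.dLeft` factor through `X.dLeft`, say by `a`, and the component
    -- `p^* ζ` allows `a` to be corrected by a multiple of `d₁^X` so as to factor through `Y.dLeft`
    obtain ⟨a, ha⟩ := (h.isNExangle hX).exists_of_push_eq_zero Z'.dLeft (by
      rw [← hinr, push_pull, hdζ', pull_zero])
    obtain ⟨ψ, hψ⟩ := h.exists_push_eq hW (push a ρ) (by
      rw [← push_pull, ← hp, push_pull, ← push_comp, ha, ← push_pull, ← hinl, push_pull, hdζ',
        pull_zero])
    obtain ⟨χ, hχ⟩ := (h.isNExangle hY).exists_of_push_eq_zero (a - X.cpx.d 1 2 ≫ ψ) (by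
      rw [h.biadditive.sub_push, push_comp, hψ, sub_self])
    exact h.exists_inflation_of_comp_eq hP hZ' hZP' (hYP 1) (X.dLeft ≫ Y.dLeft) χ (by
      rw [Category.assoc, hχ, Preadditive.comp_sub, ha, ← Category.assoc, X.dLeft_d, zero_comp,
        sub_zero])

/-- The composite of two deflations whose distinguished `n`-exangles have all terms in `P` is again
the deflation of such an `n`-exangle. -/
lemma IsNExangulated.exists_deflation_comp [NeZero n] {r : RealisationMap n G}
    (h : IsNExangulated G r) (hP : IsNExtensionClosed r P) {A B C : D}
    {δ : Extn G C A} {X : ComplexBetween n A C} (hX : r δ = X.cls) (hXP : X.TermsIn P)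
    {ρ : Extn G (X.cpx.X n) B} {Y : ComplexBetween n B (X.cpx.X n)} (hY : r ρ = Y.cls)
    (hYP : Y.TermsIn P) :
    ∃ (A' : D) (σ : Extn G C A') (Q : ComplexBetween n A' C), r σ = Q.cls ∧ Q.TermsIn P ∧
      ∃ e : Q.cpx.X n = Y.cpx.X n, Q.dRight = eqToHom e ≫ Y.dRight ≫ X.dRight := by
  obtain ⟨A', ζ, Z, hZ, e, he⟩ :=
    (h.deflation_comp Y.dRight X.dRight ⟨ρ, Y, hY⟩ ⟨δ, X, hX⟩).exists_realisation
  obtain _ | n := n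
  · exact absurd rfl (NeZero.ne 0)
  obtain ⟨W, hW, hWP⟩ := hP.exists_realisation hYP.left (hXP n) (pull (X.cpx.d n (n + 1)) ρ)
  obtain ⟨N, M, hN, hM, φ, hφ⟩ := h.exists_iso_comp_dRight hX hY hZ (eqToIso e) he.symm hW
  obtain _ | m := n
  · obtain ⟨ψ⟩ := h.nonempty_iso_left hN hM φ hφ
    refine ⟨A', ζ, Z, hZ, ComplexBetween.termsIn_of_le fun i hi => ?_, e, he⟩
    obtain rfl | rfl | rfl : i = 0 ∨ i = 1 ∨ i = 2 := by omega
    · rw [Z.left]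
      exact P.prop_of_iso ψ (hWP 1)
    · rw [show Z.cpx.X 1 = _ from e]
      exact hYP 1
    · rw [show Z.cpx.X 2 = C from Z.right]
      exact hXP.right
  · obtain ⟨p, hp⟩ := h.exists_push_eq hM (push W.dLeft ρ) (by
      rw [← hφ, pull_comp, (h.isNExangle hN).pull_eq_zero, pull_zero])
    let ζ' : Extn G C (W.cpx.X 1 ⊞ A) := push biprod.inl (push p ζ) + push biprod.inr δ
    have hfst : push biprod.fst ζ' = push p ζ := by
      simp only [ζ', push_add, ← push_comp, biprod.inr_fst, h.biadditive.zero_push, add_zero,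
        Category.assoc, biprod.inl_fst, Category.comp_id]
    have hsnd : push biprod.snd ζ' = δ := by
      simp only [ζ', push_add, ← push_comp, biprod.inr_snd, Category.assoc, biprod.inl_snd,
        comp_zero, h.biadditive.zero_push, zero_add, push_id]
    obtain ⟨Z', hZ', hZP'⟩ := hP.exists_realisation
      (prop_biprod P (hWP 1) hXP.left) hXP.right ζ'
    have hdζ' : pull Z'.dRight ζ' = 0 := (h.isNExangle hZ').pull_eq_zero
    obtain ⟨a, ha⟩ := (h.isNExangle hX).exists_of_pull_eq_zero Z'.dRight (by
      rw [← hsnd, ← push_pull, hdζ', push_zero])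
    obtain ⟨ψ, hψ⟩ := h.exists_pull_eq hW (pull a ρ) (by
      rw [push_pull, ← hp, ← push_pull, ← pull_comp, ha, push_pull, ← hfst,
        ← push_pull, hdζ', push_zero])
    obtain ⟨χ, hχ⟩ := (h.isNExangle hY).exists_of_pull_eq_zero (a - ψ ≫ X.cpx.d _ _) (by
      rw [h.biadditive.sub_pull, pull_comp, hψ, sub_self])
    exact h.exists_deflation_of_comp_eq hP hZ' hZP' (hYP _) (Y.dRight ≫ X.dRight) χ (by
      rw [← Category.assoc, hχ, Preadditive.sub_comp, ha, Category.assoc, X.d_dRight, comp_zero,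
        sub_zero])

end Composition

/-! ### Images of complexes under additive functors -/

section MapBetween

variable {D : Type u} [Category.{v} D] [Preadditive D] {D' : Type u'} [Category.{v'} D']
  [Preadditive D'] (F : D ⥤ D') [F.Additive] {n : ℕ} {A B C C' : D}
  {X : ComplexBetween n A C} {Y : ComplexBetween n B C'}

/-- The image of a morphism of complexes under an additive functor. -/
abbrev mapHom (f : X.cpx ⟶ Y.cpx) : (mapBetween F X).cpx ⟶ (mapBetween F Y).cpx :=
  (F.mapHomologicalComplex _).map f

lemma mapBetween_isoLeft_hom : (mapBetween F X).isoLeft.hom = F.map X.isoLeft.hom :=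
  (eqToHom_map F X.left).symm

lemma mapBetween_isoRight_hom : (mapBetween F X).isoRight.hom = F.map X.isoRight.hom :=
  (eqToHom_map F X.right).symm

lemma mapBetween_isoLeft_inv : (mapBetween F X).isoLeft.inv = F.map X.isoLeft.inv :=
  (eqToHom_map F X.left.symm).symm

lemma mapBetween_dLeft : (mapBetween F X).dLeft = F.map X.dLeft := by
  rw [ComplexBetween.dLeft, ComplexBetween.dLeft, F.map_comp, mapBetween_isoLeft_inv]
  rfl

lemma mapBetween_dRight : (mapBetween F X).dRight = F.map X.dRight := by
  rw [ComplexBetween.dRight, ComplexBetween.dRight, F.map_comp, mapBetween_isoRight_hom]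
  rfl

variable {F} in
lemma IsLift.map {f : X.cpx ⟶ Y.cpx} {a : A ⟶ B} {c : C ⟶ C'} (h : IsLift X Y f a c) :
    IsLift (mapBetween F X) (mapBetween F Y) (mapHom F f) (F.map a) (F.map c) where
  left := by
    rw [mapBetween_isoLeft_hom, mapBetween_isoLeft_hom]
    exact (F.map_comp (f.f 0) _).symm.trans ((congrArg F.map h.left).trans (F.map_comp _ _))
  right := by
    rw [mapBetween_isoRight_hom, mapBetween_isoRight_hom]
    exact (F.map_comp (f.f (n + 1)) _).symm.trans ((congrArg F.map h.right).trans (F.map_comp _ _))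

variable {F} in
lemma IsLift.of_map [F.Faithful] {f : X.cpx ⟶ Y.cpx} {a : A ⟶ B} {c : C ⟶ C'}
    (h : IsLift (mapBetween F X) (mapBetween F Y) (mapHom F f) (F.map a) (F.map c)) :
    IsLift X Y f a c where
  left := F.map_injective (by
    have := h.left
    rw [mapBetween_isoLeft_hom, mapBetween_isoLeft_hom] at this
    exact (F.map_comp (f.f 0) _).trans (this.trans (F.map_comp _ _).symm))
  right := F.map_injective (by
    have := h.right
    rw [mapBetween_isoRight_hom, mapBetween_isoRight_hom] at this
    exact (F.map_comp (f.f (n + 1)) _).trans (this.trans (F.map_comp _ _).symm))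

lemma HtpyEquivBetween.map {X Y : ComplexBetween n A C} (h : HtpyEquivBetween X Y) :
    HtpyEquivBetween (mapBetween F X) (mapBetween F Y) := by
  obtain ⟨f, g, hf, hg, ⟨k⟩, ⟨l⟩⟩ := h
  refine ⟨mapHom F f, mapHom F g, by simpa using hf.map (F := F), by simpa using hg.map (F := F),
    ⟨?_⟩, ⟨?_⟩⟩
  · exact (Homotopy.ofEq (CategoryTheory.Functor.map_comp _ _ _).symm).trans
      ((F.mapHomotopy k).trans (Homotopy.ofEq (CategoryTheory.Functor.map_id _ _)))
  · exact (Homotopy.ofEq (CategoryTheory.Functor.map_comp _ _ _).symm).trans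
      ((F.mapHomotopy l).trans (Homotopy.ofEq (CategoryTheory.Functor.map_id _ _)))

/-- Two complexes are homotopy equivalent if they are isomorphic by an isomorphism that is the
identity at both ends. -/
lemma HtpyEquivBetween.of_iso {A C : D} {X Y : ComplexBetween n A C} (e : X.cpx ≅ Y.cpx)
    (h : IsLift X Y e.hom (𝟙 A) (𝟙 C)) : HtpyEquivBetween X Y := by
  refine ⟨e.hom, e.inv, h, ⟨?_, ?_⟩, ⟨Homotopy.ofEq e.hom_inv_id⟩, ⟨Homotopy.ofEq e.inv_hom_id⟩⟩
  · rw [Category.comp_id, ← Category.comp_id X.isoLeft.hom, ← h.left, ← Category.assoc,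
      ← HomologicalComplex.comp_f, e.inv_hom_id, HomologicalComplex.id_f, Category.id_comp]
  · rw [Category.comp_id, ← Category.comp_id X.isoRight.hom, ← h.right, ← Category.assoc,
      ← HomologicalComplex.comp_f, e.inv_hom_id, HomologicalComplex.id_f, Category.id_comp]

lemma trivComplex_X_eq (i : ℕ) (B Z : D) :
    (trivComplex i B Z).X i = (trivComplex i B Z).X (i + 1) :=
  (if_pos (Or.inl rfl)).trans (if_pos (Or.inr rfl)).symm

lemma trivComplex_d_self (i : ℕ) (B Z : D) :
    (trivComplex i B Z).d i (i + 1) = eqToHom (trivComplex_X_eq i B Z) :=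
  (CochainComplex.of_d (fun j => if j = i ∨ j = i + 1 then B else Z)
    (fun j => if h : j = i then eqToHom (by rw [if_pos (Or.inl h), if_pos (by omega)]) else 0)
    i).trans (dif_pos rfl)

lemma trivComplex_d_of_ne {i j : ℕ} (h : j ≠ i) (B Z : D) :
    (trivComplex i B Z).d j (j + 1) = 0 :=
  (CochainComplex.of_d (fun j => if j = i ∨ j = i + 1 then B else Z)
    (fun j => if h : j = i then eqToHom (by rw [if_pos (Or.inl h), if_pos (by omega)]) else 0)
    j).trans (dif_neg h)

lemma map_trivComplex_X (i : ℕ) (B Z : D) (j : ℕ) :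
    ((F.mapHomologicalComplex (ComplexShape.up ℕ)).obj (trivComplex i B Z)).X j =
      (trivComplex i (F.obj B) (F.obj Z)).X j :=
  apply_ite F.obj (j = i ∨ j = i + 1) B Z

/-- An additive functor preserves the complexes `B ⟶ B` up to isomorphism. -/
def mapTrivComplexIso (i : ℕ) (B Z : D) :
    (F.mapHomologicalComplex (ComplexShape.up ℕ)).obj (trivComplex i B Z) ≅
      trivComplex i (F.obj B) (F.obj Z) :=
  HomologicalComplex.Hom.isoOfComponents (fun j => eqToIso (map_trivComplex_X F i B Z j)) (by
    rintro j _ rfl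
    by_cases h : j = i
    · subst h
      have h' :
          ((F.mapHomologicalComplex (ComplexShape.up ℕ)).obj (trivComplex j B Z)).d j (j + 1) =
            eqToHom (congrArg F.obj (trivComplex_X_eq j B Z)) :=
        (congrArg F.map (trivComplex_d_self j B Z)).trans (eqToHom_map F _)
      rw [h', trivComplex_d_self]
      exact (eqToHom_trans (map_trivComplex_X F j B Z j)
        (trivComplex_X_eq j (F.obj B) (F.obj Z))).trans
        (eqToHom_trans (congrArg F.obj (trivComplex_X_eq j B Z))
          (map_trivComplex_X F j B Z (j + 1))).symm
    · have h' :
          ((F.mapHomologicalComplex (ComplexShape.up ℕ)).obj (trivComplex i B Z)).d j (j + 1) =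
            0 := (congrArg F.map (trivComplex_d_of_ne h B Z)).trans (F.map_zero _ _)
      rw [h', trivComplex_d_of_ne h, comp_zero, zero_comp])

lemma htpyEquivBetween_map_trivLeft [NeZero n] (B Z : D) (hZ : IsZero Z) :
    HtpyEquivBetween (mapBetween F (trivLeft n B Z hZ))
      (trivLeft n (F.obj B) (F.obj Z) (F.map_isZero hZ)) :=
  HtpyEquivBetween.of_iso (mapTrivComplexIso F 0 B Z)
    ⟨(eqToHom_trans (map_trivComplex_X F 0 B Z 0)
        (trivLeft n (F.obj B) (F.obj Z) (F.map_isZero hZ)).left).trans (Category.comp_id _).symm,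
      (eqToHom_trans (map_trivComplex_X F 0 B Z (n + 1))
        (trivLeft n (F.obj B) (F.obj Z) (F.map_isZero hZ)).right).trans (Category.comp_id _).symm⟩

lemma htpyEquivBetween_map_trivRight [NeZero n] (B Z : D) (hZ : IsZero Z) :
    HtpyEquivBetween (mapBetween F (trivRight n Z B hZ))
      (trivRight n (F.obj Z) (F.obj B) (F.map_isZero hZ)) :=
  HtpyEquivBetween.of_iso (mapTrivComplexIso F n B Z)
    ⟨(eqToHom_trans (map_trivComplex_X F n B Z 0)
        (trivRight n (F.obj Z) (F.obj B) (F.map_isZero hZ)).left).trans (Category.comp_id _).symm,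
      (eqToHom_trans (map_trivComplex_X F n B Z (n + 1))
        (trivRight n (F.obj Z) (F.obj B) (F.map_isZero hZ)).right).trans (Category.comp_id _).symm⟩

end MapBetween

/-! ### Images of mapping cones and cocones -/

section ConeDecomposition

variable {D : Type u} [Category.{v} D] [Preadditive D] {n : ℕ} {A B C C' : D}

/-- A presentation of the terms and differentials of a complex `K` as those of the mapping cone
of `f`, by inclusions and projections which are zero where a summand is absent. -/
structure ConeDecomposition (X : ComplexBetween n A C) (Y : ComplexBetween n B C')
    (f : X.cpx ⟶ Y.cpx) (K : CochainComplex D ℕ) where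
  /-- the inclusion of `X_{i+1}` -/
  inl : ∀ i, X.cpx.X (i + 1) ⟶ K.X i
  /-- the inclusion of `Yᵢ` -/
  inr : ∀ i, Y.cpx.X i ⟶ K.X i
  /-- the projection to `X_{i+1}` -/
  fst : ∀ i, K.X i ⟶ X.cpx.X (i + 1)
  /-- the projection to `Yᵢ` -/
  snd : ∀ i, K.X i ⟶ Y.cpx.X i
  inl_fst : ∀ i, i ≤ n → inl i ≫ fst i = 𝟙 _
  inl_eq_zero : ∀ i, ¬ i ≤ n → inl i = 0
  inl_snd : ∀ i, inl i ≫ snd i = 0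
  inr_fst : ∀ i, inr i ≫ fst i = 0
  inr_snd : ∀ i, inr (i + 1) ≫ snd (i + 1) = 𝟙 _
  inr_zero : inr 0 = 0
  total : ∀ i, fst i ≫ inl i + snd i ≫ inr i = 𝟙 _
  d_eq : ∀ i, K.d i (i + 1) =
    fst i ≫ (-(X.cpx.d (i + 1) (i + 2)) ≫ inl (i + 1) + f.f (i + 1) ≫ inr (i + 1)) +
      snd i ≫ Y.cpx.d i (i + 1) ≫ inr (i + 1)

namespace ConeDecomposition

variable {X : ComplexBetween n A C} {Y : ComplexBetween n B C'} {f : X.cpx ⟶ Y.cpx}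
  {K L : CochainComplex D ℕ} (s : ConeDecomposition X Y f K) (t : ConeDecomposition X Y f L)

lemma hom_ext {i : ℕ} {Z : D} {g h : K.X i ⟶ Z} (h₁ : s.inl i ≫ g = s.inl i ≫ h)
    (h₂ : s.inr i ≫ g = s.inr i ≫ h) : g = h := by
  rw [← Category.id_comp g, ← Category.id_comp h, ← s.total i]
  simp only [Preadditive.add_comp, Category.assoc, h₁, h₂]

lemma inl_d (i : ℕ) : s.inl i ≫ K.d i (i + 1) =
    -(X.cpx.d (i + 1) (i + 2)) ≫ s.inl (i + 1) + f.f (i + 1) ≫ s.inr (i + 1) := by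
  by_cases h : i ≤ n
  · rw [s.d_eq, Preadditive.comp_add, reassoc_of% (s.inl_fst i h), reassoc_of% (s.inl_snd i),
      zero_comp, add_zero]
  · exact (X.isZero _ (by omega)).eq_of_src _ _

lemma inr_d (i : ℕ) : s.inr (i + 1) ≫ K.d (i + 1) (i + 2) =
    Y.cpx.d (i + 1) (i + 2) ≫ s.inr (i + 2) := by
  rw [s.d_eq, Preadditive.comp_add, reassoc_of% (s.inr_fst (i + 1)), reassoc_of% (s.inr_snd i),
    zero_comp, zero_add]

/-- The components of the comparison morphism of two complexes with the same decomposition. -/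
def comparison (i : ℕ) : K.X i ⟶ L.X i := s.fst i ≫ t.inl i + s.snd i ≫ t.inr i

lemma inl_comparison (i : ℕ) : s.inl i ≫ comparison s t i = t.inl i := by
  by_cases h : i ≤ n
  · rw [comparison, Preadditive.comp_add, reassoc_of% (s.inl_fst i h), reassoc_of% (s.inl_snd i),
      zero_comp, add_zero]
  · rw [s.inl_eq_zero i h, t.inl_eq_zero i h, zero_comp]

lemma inr_comparison (i : ℕ) : s.inr i ≫ comparison s t i = t.inr i := by
  cases i with
  | zero => rw [s.inr_zero, t.inr_zero, zero_comp]
  | succ i =>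
    rw [comparison, Preadditive.comp_add, reassoc_of% (s.inr_fst (i + 1)),
      reassoc_of% (s.inr_snd i), zero_comp, zero_add]

lemma comparison_comm (i : ℕ) :
    comparison s t i ≫ L.d i (i + 1) = K.d i (i + 1) ≫ comparison s t (i + 1) := by
  apply s.hom_ext
  · rw [reassoc_of% (inl_comparison s t i), reassoc_of% (s.inl_d i), t.inl_d,
      Preadditive.add_comp, Preadditive.neg_comp, Category.assoc, Category.assoc, inl_comparison,
      inr_comparison]
  · cases i with
    | zero => rw [s.inr_zero, zero_comp, zero_comp]
    | succ i =>
      rw [reassoc_of% (inr_comparison s t (i + 1)), t.inr_d, reassoc_of% (s.inr_d i),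
        inr_comparison]

/-- Two complexes with the same decomposition are isomorphic. -/
def iso : K ≅ L :=
  HomologicalComplex.Hom.isoOfComponents
    (fun i =>
      { hom := comparison s t i
        inv := comparison t s i
        hom_inv_id := s.hom_ext
          (by rw [reassoc_of% (inl_comparison s t i), inl_comparison, Category.comp_id])
          (by rw [reassoc_of% (inr_comparison s t i), inr_comparison, Category.comp_id])
        inv_hom_id := t.hom_ext
          (by rw [reassoc_of% (inl_comparison t s i), inl_comparison, Category.comp_id])
          (by rw [reassoc_of% (inr_comparison t s i), inr_comparison, Category.comp_id]) }) (by
    rintro i _ rfl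
    exact comparison_comm s t i)

/-- Two complexes with fixed ends and the same decomposition are homotopy equivalent if the
decompositions are compatible with the ends. -/
lemma htpyEquivBetween {P Q : D} {M N : ComplexBetween n P Q} (s : ConeDecomposition X Y f M.cpx)
    (t : ConeDecomposition X Y f N.cpx)
    (hl : s.inl 0 ≫ M.isoLeft.hom = t.inl 0 ≫ N.isoLeft.hom)
    (hr : s.inr (n + 1) ≫ M.isoRight.hom = t.inr (n + 1) ≫ N.isoRight.hom) :
    HtpyEquivBetween M N := by
  refine HtpyEquivBetween.of_iso (iso s t) ⟨?_, ?_⟩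
  · change comparison s t 0 ≫ _ = _
    refine s.hom_ext ?_ ?_
    · rw [reassoc_of% (inl_comparison s t 0), Category.comp_id, hl]
    · rw [s.inr_zero, zero_comp, zero_comp]
  · change comparison s t (n + 1) ≫ _ = _
    refine s.hom_ext ?_ ?_
    · rw [s.inl_eq_zero (n + 1) (by omega), zero_comp, zero_comp]
    · rw [reassoc_of% (inr_comparison s t (n + 1)), Category.comp_id, hr]

/-- The image of a decomposition under an additive functor. -/
def map {D' : Type u'} [Category.{v'} D'] [Preadditive D'] (F : D ⥤ D') [F.Additive] :
    ConeDecomposition (mapBetween F X) (mapBetween F Y) (mapHom F f)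
      ((F.mapHomologicalComplex _).obj K) where
  inl i := F.map (s.inl i)
  inr i := F.map (s.inr i)
  fst i := F.map (s.fst i)
  snd i := F.map (s.snd i)
  inl_fst i h := (F.map_comp _ _).symm.trans
    ((congrArg F.map (s.inl_fst i h)).trans (F.map_id _))
  inl_eq_zero i h := (congrArg F.map (s.inl_eq_zero i h)).trans (F.map_zero _ _)
  inl_snd i := (F.map_comp _ _).symm.trans ((congrArg F.map (s.inl_snd i)).trans (F.map_zero _ _))
  inr_fst i := (F.map_comp _ _).symm.trans ((congrArg F.map (s.inr_fst i)).trans (F.map_zero _ _))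
  inr_snd i := (F.map_comp _ _).symm.trans
    ((congrArg F.map (s.inr_snd i)).trans (F.map_id _))
  inr_zero := (congrArg F.map s.inr_zero).trans (F.map_zero _ _)
  total i := by
    have := congrArg F.map (s.total i)
    rw [F.map_add, F.map_comp, F.map_comp, F.map_id] at this
    exact this
  d_eq i := by
    have := congrArg F.map (s.d_eq i)
    simp only [F.map_add, F.map_comp, F.map_neg] at this
    exact this

end ConeDecomposition

/-- The tautological decomposition of the mapping cone. -/
def mappingCone.decomposition [HasBinaryBiproducts D] (X : ComplexBetween n A C)
    (Y : ComplexBetween n B C') (f : X.cpx ⟶ Y.cpx) :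
    ConeDecomposition X Y f (mappingCone X Y f).cpx where
  inl := inl X Y f
  inr := inr X Y f
  fst := fst X Y f
  snd := snd X Y f
  inl_fst _ := inl_fst X Y f
  inl_eq_zero _ := inl_eq_zero X Y f
  inl_snd := inl_snd X Y f
  inr_fst := inr_fst X Y f
  inr_snd := inr_snd X Y f
  inr_zero := rfl
  total := total X Y f
  d_eq := d_eq X Y f

/-- A presentation of the terms and differentials of a complex `K` as those of the mapping cocone
of `f`, by inclusions and projections which are zero where a summand is absent. -/
structure CoconeDecomposition (X : ComplexBetween n A C) (Y : ComplexBetween n B C')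
    (f : X.cpx ⟶ Y.cpx) (K : CochainComplex D ℕ) where
  /-- the inclusion of `Xᵢ` -/
  inl : ∀ i, X.cpx.X i ⟶ K.X i
  /-- the inclusion of `Yᵢ` -/
  inr : ∀ i, Y.cpx.X i ⟶ K.X (i + 1)
  /-- the projection to `Xᵢ` -/
  fst : ∀ i, K.X i ⟶ X.cpx.X i
  /-- the projection to `Yᵢ` -/
  snd : ∀ i, K.X (i + 1) ⟶ Y.cpx.X i
  isZero : ∀ i, n + 1 < i → IsZero (K.X i)
  inl_fst : ∀ i, i ≤ n → inl i ≫ fst i = 𝟙 _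
  inl_eq_zero : ∀ i, ¬ i ≤ n → inl i = 0
  inl_snd : ∀ i, inl (i + 1) ≫ snd i = 0
  inr_fst : ∀ i, inr i ≫ fst (i + 1) = 0
  inr_snd : ∀ i, i ≤ n → inr i ≫ snd i = 𝟙 _
  inr_eq_zero : ∀ i, ¬ i ≤ n → inr i = 0
  fst_inl_zero : fst 0 ≫ inl 0 = 𝟙 _
  total : ∀ i, i ≤ n → fst (i + 1) ≫ inl (i + 1) + snd i ≫ inr i = 𝟙 _
  d_zero_eq : K.d 0 1 = fst 0 ≫ (X.cpx.d 0 1 ≫ inl 1 + f.f 0 ≫ inr 0)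
  d_succ_eq : ∀ i, K.d (i + 1) (i + 2) =
    fst (i + 1) ≫ (X.cpx.d (i + 1) (i + 2) ≫ inl (i + 2) + f.f (i + 1) ≫ inr (i + 1)) +
      snd i ≫ (-(Y.cpx.d i (i + 1)) ≫ inr (i + 1))

namespace CoconeDecomposition

variable {X : ComplexBetween n A C} {Y : ComplexBetween n B C'} {f : X.cpx ⟶ Y.cpx}
  {K L : CochainComplex D ℕ} (s : CoconeDecomposition X Y f K) (t : CoconeDecomposition X Y f L)

lemma hom_ext_zero {Z : D} {g h : K.X 0 ⟶ Z} (h₁ : s.inl 0 ≫ g = s.inl 0 ≫ h) : g = h := by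
  rw [← Category.id_comp g, ← Category.id_comp h, ← s.fst_inl_zero, Category.assoc, h₁,
    Category.assoc]

lemma hom_ext_succ {i : ℕ} {Z : D} {g h : K.X (i + 1) ⟶ Z}
    (h₁ : s.inl (i + 1) ≫ g = s.inl (i + 1) ≫ h) (h₂ : s.inr i ≫ g = s.inr i ≫ h) : g = h := by
  by_cases hi : i ≤ n
  · rw [← Category.id_comp g, ← Category.id_comp h, ← s.total i hi]
    simp only [Preadditive.add_comp, Category.assoc, h₁, h₂]
  · exact (s.isZero _ (by omega)).eq_of_src _ _

lemma inl_d (i : ℕ) : s.inl i ≫ K.d i (i + 1) =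
    X.cpx.d i (i + 1) ≫ s.inl (i + 1) + f.f i ≫ s.inr i := by
  by_cases h : i ≤ n
  · cases i with
    | zero =>
      refine (congrArg (s.inl 0 ≫ ·) s.d_zero_eq).trans ?_
      exact (Category.assoc _ _ _).symm.trans
        ((congrArg (· ≫ _) (s.inl_fst 0 h)).trans (Category.id_comp _))
    | succ i =>
      rw [s.d_succ_eq, Preadditive.comp_add, reassoc_of% (s.inl_fst _ h),
        reassoc_of% (s.inl_snd i), zero_comp, add_zero]
  · rw [s.inl_eq_zero i h, s.inl_eq_zero (i + 1) (by omega), s.inr_eq_zero i h, zero_comp,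
      comp_zero, comp_zero, add_zero]

lemma inr_d (i : ℕ) : s.inr i ≫ K.d (i + 1) (i + 2) = -(Y.cpx.d i (i + 1)) ≫ s.inr (i + 1) := by
  by_cases h : i ≤ n
  · rw [s.d_succ_eq, Preadditive.comp_add, reassoc_of% (s.inr_fst i), reassoc_of% (s.inr_snd i h),
      zero_comp, zero_add]
  · rw [s.inr_eq_zero i h, s.inr_eq_zero (i + 1) (by omega), zero_comp, comp_zero,
      neg_zero]

/-- The components of the comparison morphism of two complexes with the same decomposition. -/
def comparison : ∀ i : ℕ, K.X i ⟶ L.X i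
  | 0 => s.fst 0 ≫ t.inl 0
  | i + 1 => s.fst (i + 1) ≫ t.inl (i + 1) + s.snd i ≫ t.inr i

lemma inl_comparison (i : ℕ) : s.inl i ≫ comparison s t i = t.inl i := by
  by_cases h : i ≤ n
  · cases i with
    | zero => rw [comparison, reassoc_of% (s.inl_fst 0 h)]
    | succ i =>
      rw [comparison, Preadditive.comp_add, reassoc_of% (s.inl_fst _ h),
        reassoc_of% (s.inl_snd i), zero_comp, add_zero]
  · rw [s.inl_eq_zero i h, t.inl_eq_zero i h, zero_comp]

lemma inr_comparison (i : ℕ) : s.inr i ≫ comparison s t (i + 1) = t.inr i := by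
  by_cases h : i ≤ n
  · rw [comparison, Preadditive.comp_add, reassoc_of% (s.inr_fst i),
      reassoc_of% (s.inr_snd i h), zero_comp, zero_add]
  · rw [s.inr_eq_zero i h, t.inr_eq_zero i h, zero_comp]

lemma comparison_comparison (i : ℕ) : comparison s t i ≫ comparison t s i = 𝟙 _ := by
  cases i with
  | zero =>
    exact s.hom_ext_zero
      (by rw [reassoc_of% (inl_comparison s t 0), inl_comparison, Category.comp_id])
  | succ i =>
    exact s.hom_ext_succ
      (by rw [reassoc_of% (inl_comparison s t (i + 1)), inl_comparison, Category.comp_id])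
      (by rw [reassoc_of% (inr_comparison s t i), inr_comparison, Category.comp_id])

lemma comparison_comm (i : ℕ) :
    comparison s t i ≫ L.d i (i + 1) = K.d i (i + 1) ≫ comparison s t (i + 1) := by
  have key : s.inl i ≫ comparison s t i ≫ L.d i (i + 1) =
      s.inl i ≫ K.d i (i + 1) ≫ comparison s t (i + 1) := by
    rw [reassoc_of% (inl_comparison s t i), reassoc_of% (s.inl_d i), t.inl_d,
      Preadditive.add_comp, Category.assoc, Category.assoc, inl_comparison, inr_comparison]
  cases i with
  | zero => exact s.hom_ext_zero key
  | succ i =>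
    refine s.hom_ext_succ key ?_
    rw [reassoc_of% (inr_comparison s t i), t.inr_d, reassoc_of% (s.inr_d i), Preadditive.neg_comp,
      Category.assoc, inr_comparison]

/-- Two complexes with the same decomposition are isomorphic. -/
def iso : K ≅ L :=
  HomologicalComplex.Hom.isoOfComponents
    (fun i =>
      { hom := comparison s t i
        inv := comparison t s i
        hom_inv_id := comparison_comparison s t i
        inv_hom_id := comparison_comparison t s i }) (by
    rintro i _ rfl
    exact comparison_comm s t i)

/-- Two complexes with fixed ends and the same decomposition are homotopy equivalent if the
decompositions are compatible with the ends. -/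
lemma htpyEquivBetween {P Q : D} {M N : ComplexBetween n P Q}
    (s : CoconeDecomposition X Y f M.cpx) (t : CoconeDecomposition X Y f N.cpx)
    (hl : s.inl 0 ≫ M.isoLeft.hom = t.inl 0 ≫ N.isoLeft.hom)
    (hr : s.inr n ≫ M.isoRight.hom = t.inr n ≫ N.isoRight.hom) :
    HtpyEquivBetween M N := by
  refine HtpyEquivBetween.of_iso (iso s t) ⟨?_, ?_⟩
  · change comparison s t 0 ≫ _ = _
    refine s.hom_ext_zero ?_
    rw [reassoc_of% (inl_comparison s t 0), Category.comp_id, hl]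
  · change comparison s t (n + 1) ≫ _ = _
    refine s.hom_ext_succ ?_ ?_
    · rw [s.inl_eq_zero (n + 1) (by omega), zero_comp, zero_comp]
    · rw [reassoc_of% (inr_comparison s t n), Category.comp_id, hr]

/-- The image of a decomposition under an additive functor. -/
def map {D' : Type u'} [Category.{v'} D'] [Preadditive D'] (F : D ⥤ D') [F.Additive] :
    CoconeDecomposition (mapBetween F X) (mapBetween F Y) (mapHom F f)
      ((F.mapHomologicalComplex _).obj K) where
  inl i := F.map (s.inl i)
  inr i := F.map (s.inr i)
  fst i := F.map (s.fst i)
  snd i := F.map (s.snd i)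
  isZero i h := F.map_isZero (s.isZero i h)
  inl_fst i h := (F.map_comp _ _).symm.trans
    ((congrArg F.map (s.inl_fst i h)).trans (F.map_id _))
  inl_eq_zero i h := (congrArg F.map (s.inl_eq_zero i h)).trans (F.map_zero _ _)
  inl_snd i := (F.map_comp _ _).symm.trans ((congrArg F.map (s.inl_snd i)).trans (F.map_zero _ _))
  inr_fst i := (F.map_comp _ _).symm.trans ((congrArg F.map (s.inr_fst i)).trans (F.map_zero _ _))
  inr_snd i h := (F.map_comp _ _).symm.trans
    ((congrArg F.map (s.inr_snd i h)).trans (F.map_id _))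
  inr_eq_zero i h := (congrArg F.map (s.inr_eq_zero i h)).trans (F.map_zero _ _)
  fst_inl_zero := (F.map_comp _ _).symm.trans
    ((congrArg F.map s.fst_inl_zero).trans (F.map_id _))
  total i h := by
    have := congrArg F.map (s.total i h)
    rw [F.map_add, F.map_comp, F.map_comp, F.map_id] at this
    exact this
  d_zero_eq := by
    have := congrArg F.map s.d_zero_eq
    simp only [F.map_add, F.map_comp] at this
    exact this
  d_succ_eq i := by
    have := congrArg F.map (s.d_succ_eq i)
    simp only [F.map_add, F.map_comp, F.map_neg] at this
    exact this

end CoconeDecomposition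

/-- The tautological decomposition of the mapping cocone. -/
def mappingCocone.decomposition [HasBinaryBiproducts D] (X : ComplexBetween n A C)
    (Y : ComplexBetween n B C') (f : X.cpx ⟶ Y.cpx) :
    CoconeDecomposition X Y f (mappingCocone X Y f).cpx where
  inl := inl X Y f
  inr := inr X Y f
  fst := fst X Y f
  snd := snd X Y f
  isZero := (mappingCocone X Y f).isZero
  inl_fst _ := inl_fst X Y f
  inl_eq_zero _ := inl_eq_zero X Y f
  inl_snd := inl_snd X Y f
  inr_fst := inr_fst X Y f
  inr_snd _ := inr_snd X Y f
  inr_eq_zero _ := inr_eq_zero X Y f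
  fst_inl_zero := fst_inl_zero X Y f
  total _ := total X Y f
  d_zero_eq := d_zero_eq X Y f
  d_succ_eq := d_succ_eq X Y f

end ConeDecomposition

section MapCone

variable {D : Type u} [Category.{v} D] [Preadditive D] [HasBinaryBiproducts D]
  {D' : Type u'} [Category.{v'} D'] [Preadditive D'] [HasBinaryBiproducts D']
  (F : D ⥤ D') [F.Additive] {n : ℕ} {A B C C' : D}
  (X : ComplexBetween n A C) (Y : ComplexBetween n B C') (f : X.cpx ⟶ Y.cpx)

/-- Additive functors preserve mapping cones up to an isomorphism that fixes the ends. -/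
lemma htpyEquivBetween_map_mappingCone :
    HtpyEquivBetween (mapBetween F (mappingCone X Y f))
      (mappingCone (mapBetween F X) (mapBetween F Y) (mapHom F f)) := by
  refine ConeDecomposition.htpyEquivBetween
    (M := mapBetween F (mappingCone X Y f))
    (N := mappingCone (mapBetween F X) (mapBetween F Y) (mapHom F f))
    ((mappingCone.decomposition X Y f).map F)
    (mappingCone.decomposition (mapBetween F X) (mapBetween F Y) (mapHom F f)) ?_ ?_
  · exact congrArg (· ≫ 𝟙 _) (F.map_id (X.cpx.X 1))
  · refine Eq.trans ?_
      (mappingCone.inr_isoRight (mapBetween F X) (mapBetween F Y) (mapHom F f)).symm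
    rw [mapBetween_isoRight_hom, mapBetween_isoRight_hom, ← mappingCone.inr_isoRight X Y f]
    exact (F.map_comp _ _).symm

/-- Additive functors preserve mapping cocones up to an isomorphism that fixes the ends. -/
lemma htpyEquivBetween_map_mappingCocone :
    HtpyEquivBetween (mapBetween F (mappingCocone X Y f))
      (mappingCocone (mapBetween F X) (mapBetween F Y) (mapHom F f)) := by
  refine CoconeDecomposition.htpyEquivBetween
    (M := mapBetween F (mappingCocone X Y f))
    (N := mappingCocone (mapBetween F X) (mapBetween F Y) (mapHom F f))
    ((mappingCocone.decomposition X Y f).map F)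
    (mappingCocone.decomposition (mapBetween F X) (mapBetween F Y) (mapHom F f)) ?_ ?_
  · exact congrArg (· ≫ _) (F.map_id (X.cpx.X 0))
  · refine Eq.trans ?_
      (mappingCocone.inr_isoRight (mapBetween F X) (mapBetween F Y) (mapHom F f)).symm
    rw [mapBetween_isoRight_hom]
    exact (F.map_comp _ _).symm.trans ((congrArg F.map (mappingCocone.inr_isoRight X Y f)).trans
      (F.map_id _))

end MapCone

/-! ### Complexes in a full subcategory -/

section FullSubcategory

variable {D : Type u} [Category.{v} D] [Preadditive D] {P : ObjectProperty D} {n : ℕ}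
  {A C B C' : P.FullSubcategory}

/-- The morphism of complexes in a full subcategory given by a morphism in the ambient
category. -/
def liftHom {X : ComplexBetween n A C} {Y : ComplexBetween n B C'}
    (f : (mapBetween P.ι X).cpx ⟶ (mapBetween P.ι Y).cpx) : X.cpx ⟶ Y.cpx where
  f i := ObjectProperty.homMk (f.f i)
  comm' i j _ := ObjectProperty.hom_ext _ (f.comm i j)

lemma isLift_liftHom {X : ComplexBetween n A C} {Y : ComplexBetween n B C'}
    {f : (mapBetween P.ι X).cpx ⟶ (mapBetween P.ι Y).cpx} {a : A ⟶ B} {c : C ⟶ C'}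
    (h : IsLift (mapBetween P.ι X) (mapBetween P.ι Y) f (P.ι.map a) (P.ι.map c)) :
    IsLift X Y (liftHom f) a c :=
  IsLift.of_map (F := P.ι) h

lemma HtpyEquivBetween.of_map_ι {X Y : ComplexBetween n A C}
    (h : HtpyEquivBetween (mapBetween P.ι X) (mapBetween P.ι Y)) : HtpyEquivBetween X Y := by
  obtain ⟨f, g, hf, hg, ⟨k⟩, ⟨l⟩⟩ := h
  refine ⟨liftHom f, liftHom g, isLift_liftHom (by simpa using hf),
    isLift_liftHom (by simpa using hg),
    ⟨{ hom := fun i j => ObjectProperty.homMk (k.hom i j)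
       zero := fun i j h => ObjectProperty.hom_ext _ (k.zero i j h)
       comm := fun i => ObjectProperty.hom_ext _ (k.comm i) }⟩,
    ⟨{ hom := fun i j => ObjectProperty.homMk (l.hom i j)
       zero := fun i j h => ObjectProperty.hom_ext _ (l.zero i j h)
       comm := fun i => ObjectProperty.hom_ext _ (l.comm i) }⟩⟩

lemma cls_mapBetween_ι_eq_iff {X Y : ComplexBetween n A C} :
    (mapBetween P.ι X).cls = (mapBetween P.ι Y).cls ↔ X.cls = Y.cls := by
  rw [ComplexBetween.cls_eq_iff, ComplexBetween.cls_eq_iff]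
  exact ⟨HtpyEquivBetween.of_map_ι, HtpyEquivBetween.map P.ι⟩

lemma termsIn_mapBetween_ι (X : ComplexBetween n A C) : (mapBetween P.ι X).TermsIn P :=
  fun i => (X.cpx.X i).property

variable {E : Dᵒᵖ ⥤ D ⥤ AddCommGrpCat.{w}}

lemma IsNExangle.of_mapBetween_ι {X : ComplexBetween n A C}
    {δ : Extn (restrictedBifunctor E P) C A}
    (h : IsNExangle (G := E) (A := A.obj) (C := C.obj) (mapBetween P.ι X) δ) : IsNExangle X δ where
  push_eq_zero := by
    have := h.push_eq_zero
    rw [mapBetween_dLeft] at this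
    exact this
  pull_eq_zero := by
    have := h.pull_eq_zero
    rw [mapBetween_dRight] at this
    exact this
  exact_cov W i hi g := by
    refine ⟨fun hg => ?_, ?_⟩
    · obtain ⟨k, hk⟩ := (h.exact_cov W.obj i hi g.hom).1 (congrArg P.ι.map hg)
      exact ⟨ObjectProperty.homMk k, ObjectProperty.hom_ext _ hk⟩
    · rintro ⟨k, rfl⟩
      exact ObjectProperty.hom_ext _ ((h.exact_cov W.obj i hi _).2 ⟨k.hom, rfl⟩)
  exact_cov_end W g := by
    have hd : (mapBetween P.ι X).dRight = P.ι.map X.dRight := mapBetween_dRight P.ι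
    refine ⟨fun hg => ?_, ?_⟩
    · obtain ⟨k, hk⟩ := (h.exact_cov_end W.obj g.hom).1 hg
      exact ⟨ObjectProperty.homMk k,
        ObjectProperty.hom_ext _ ((congrArg (k ≫ ·) hd).symm.trans hk)⟩
    · rintro ⟨k, rfl⟩
      exact (h.exact_cov_end W.obj _).2 ⟨k.hom, congrArg (k.hom ≫ ·) hd⟩
  exact_contra W i hi g := by
    refine ⟨fun hg => ?_, ?_⟩
    · obtain ⟨k, hk⟩ := (h.exact_contra W.obj i hi g.hom).1 (congrArg P.ι.map hg)
      exact ⟨ObjectProperty.homMk k, ObjectProperty.hom_ext _ hk⟩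
    · rintro ⟨k, rfl⟩
      exact ObjectProperty.hom_ext _ ((h.exact_contra W.obj i hi _).2 ⟨k.hom, rfl⟩)
  exact_contra_end W g := by
    have hd : (mapBetween P.ι X).dLeft = P.ι.map X.dLeft := mapBetween_dLeft P.ι
    refine ⟨fun hg => ?_, ?_⟩
    · obtain ⟨k, hk⟩ := (h.exact_contra_end W.obj g.hom).1 hg
      exact ⟨ObjectProperty.homMk k,
        ObjectProperty.hom_ext _ ((congrArg (· ≫ k) hd).symm.trans hk)⟩
    · rintro ⟨k, rfl⟩
      exact (h.exact_contra_end W.obj _).2 ⟨k.hom, congrArg (· ≫ k.hom) hd⟩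

lemma IsBiadditive.restrict (h : IsBiadditive E) : IsBiadditive (restrictedBifunctor E P) where
  push_add a a' δ := h.push_add (P.ι.map a) (P.ι.map a') δ
  pull_add c c' δ := h.pull_add (P.ι.map c) (P.ι.map c') δ

end FullSubcategory

/-! ### The induced realisation -/

section InducedRealisation

variable {D : Type u} [Category.{v} D] [Preadditive D] [HasBinaryBiproducts D]
  {P : ObjectProperty D} [IsAdditiveSubcategory P] {n : ℕ} {E : Dᵒᵖ ⥤ D ⥤ AddCommGrpCat.{w}}
  {s : RealisationMap n E} (hP : IsNExtensionClosed s P)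

/-- The induced realisation does not depend on the chosen realisations: homotopy equivalences in
the ambient category restrict to the full subcategory. -/
lemma inducedRealisation_eq_cls_iff {A C : P.FullSubcategory}
    (δ : Extn (restrictedBifunctor E P) C A) (X : ComplexBetween n A C) :
    inducedRealisation s P hP δ = X.cls ↔
      s (A := A.obj) (C := C.obj) δ = (mapBetween P.ι X).cls := by
  have h := (hP A.obj C.obj A.property C.property δ).choose_spec
  rw [h.1]
  exact cls_mapBetween_ι_eq_iff.symm

lemma isNExangulatedFunctor_ι :
    IsNExangulatedFunctor (inducedRealisation s P hP) s P.ι (inclusionTransformation E P) where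
  map_realisation δ X hX := (inducedRealisation_eq_cls_iff hP δ X).1 hX

variable [HasZeroObject D] [NeZero n]

lemma IsNExangulated.isExactRealisation_inducedRealisation (h : IsNExangulated E s) :
    IsExactRealisation (inducedRealisation s P hP) where
  exists_lift δ ρ X Y hX hY a c hac := by
    rw [inducedRealisation_eq_cls_iff] at hX hY
    obtain ⟨f, hf⟩ := h.exactRealisation.exists_lift _ _ _ _ hX hY (P.ι.map a) (P.ι.map c) hac
    exact ⟨liftHom f, isLift_liftHom hf⟩
  isNExangle δ X hX := by
    rw [inducedRealisation_eq_cls_iff] at hX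
    exact IsNExangle.of_mapBetween_ι (h.exactRealisation.isNExangle _ _ hX)
  triv_left A Z hZ := by
    rw [inducedRealisation_eq_cls_iff]
    exact (h.exactRealisation.triv_left A.obj Z.obj (P.ι.map_isZero hZ)).trans
      ((ComplexBetween.cls_eq_iff _ _).2 (htpyEquivBetween_map_trivLeft P.ι A Z hZ)).symm
  triv_right Z C hZ := by
    rw [inducedRealisation_eq_cls_iff]
    exact (h.exactRealisation.triv_right Z.obj C.obj (P.ι.map_isZero hZ)).trans
      ((ComplexBetween.cls_eq_iff _ _).2 (htpyEquivBetween_map_trivRight P.ι C Z hZ)).symm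

lemma IsNExangulated.inducedRealisation_inflation_comp (h : IsNExangulated E s)
    {A B B' : P.FullSubcategory} (f : A ⟶ B) (g : B ⟶ B')
    (hf : IsInflation (inducedRealisation s P hP) f)
    (hg : IsInflation (inducedRealisation s P hP) g) :
    IsInflation (inducedRealisation s P hP) (f ≫ g) := by
  obtain ⟨δ, X, hX⟩ := hf
  obtain ⟨ρ, Y, hY⟩ := hg
  rw [inducedRealisation_eq_cls_iff] at hX hY
  obtain ⟨C, σ, Q, hQ, hQP, e, he⟩ := h.exists_inflation_comp hP hX (termsIn_mapBetween_ι X)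
    (Y := mapBetween P.ι Y) hY (termsIn_mapBetween_ι Y)
  let Q' : ComplexBetween n A (⟨C, hQP.right⟩ : P.FullSubcategory) :=
    liftBetween P Q fun i _ => hQP i
  have e' : Q'.cpx.X 1 = Y.cpx.X 1 := ObjectProperty.FullSubcategory.ext e
  have key : Q'.dLeft ≫ eqToHom e' = X.dLeft ≫ Y.dLeft := by
    apply P.ι.map_injective
    rw [P.ι.map_comp, P.ι.map_comp, eqToHom_map, ← mapBetween_dLeft, ← mapBetween_dLeft,
      ← mapBetween_dLeft]
    exact he
  have hσ : inducedRealisation s P hP (A := A) (C := ⟨C, hQP.right⟩) σ = Q'.cls :=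
    (inducedRealisation_eq_cls_iff hP (A := A) (C := ⟨C, hQP.right⟩) σ Q').2 hQ
  rw [← key]
  exact (IsInflation.mk (r := inducedRealisation s P hP) (A := A) (C := ⟨C, hQP.right⟩)
    σ Q' hσ).comp_eqToHom e'

lemma IsNExangulated.inducedRealisation_deflation_comp (h : IsNExangulated E s)
    {A B B' : P.FullSubcategory} (f : A ⟶ B) (g : B ⟶ B')
    (hf : IsDeflation (inducedRealisation s P hP) f)
    (hg : IsDeflation (inducedRealisation s P hP) g) :
    IsDeflation (inducedRealisation s P hP) (f ≫ g) := by
  obtain ⟨δ, X, hX⟩ := hg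
  obtain ⟨ρ, Y, hY⟩ := hf
  rw [inducedRealisation_eq_cls_iff] at hX hY
  obtain ⟨A, σ, Q, hQ, hQP, e, he⟩ := h.exists_deflation_comp hP hX (termsIn_mapBetween_ι X)
    (Y := mapBetween P.ι Y) hY (termsIn_mapBetween_ι Y)
  let Q' : ComplexBetween n (⟨A, hQP.left⟩ : P.FullSubcategory) B' :=
    liftBetween P Q fun i _ => hQP i
  have e' : Q'.cpx.X n = Y.cpx.X n := ObjectProperty.FullSubcategory.ext e
  have key : eqToHom e'.symm ≫ Q'.dRight = Y.dRight ≫ X.dRight := by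
    apply P.ι.map_injective
    rw [P.ι.map_comp, P.ι.map_comp, eqToHom_map, ← mapBetween_dRight, ← mapBetween_dRight,
      ← mapBetween_dRight]
    have he' : eqToHom e.symm ≫ Q.dRight =
        (mapBetween P.ι Y).dRight ≫ (mapBetween P.ι X).dRight := by
      rw [he]
      exact (eqToHom_trans_assoc _ _ _).trans (Category.id_comp _)
    exact he'
  have hσ : inducedRealisation s P hP (A := ⟨A, hQP.left⟩) (C := B') σ = Q'.cls :=
    (inducedRealisation_eq_cls_iff hP (A := ⟨A, hQP.left⟩) (C := B') σ Q').2 hQ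
  rw [← key]
  exact (IsDeflation.mk (r := inducedRealisation s P hP) (A := ⟨A, hQP.left⟩) (C := B')
    σ Q' hσ).eqToHom_comp e'.symm

/-- An `n`-extension closed additive subcategory inherits the structure of an `n`-exangulated
category. -/
lemma IsNExangulated.restrict (h : IsNExangulated E s) :
    IsNExangulated (restrictedBifunctor E P) (inducedRealisation s P hP) where
  biadditive := h.biadditive.restrict
  exactRealisation := h.isExactRealisation_inducedRealisation hP
  inflation_comp := h.inducedRealisation_inflation_comp hP
  deflation_comp := h.inducedRealisation_deflation_comp hP
  good_lift c ρ X Y hX hY := by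
    rw [inducedRealisation_eq_cls_iff] at hX hY
    obtain ⟨f, hf, hM⟩ := h.good_lift (P.ι.map c) ρ _ _ hX hY
    rw [mapBetween_dLeft] at hM
    refine ⟨liftHom f, isLift_liftHom (by simpa using hf), ?_⟩
    rw [inducedRealisation_eq_cls_iff]
    exact hM.trans ((ComplexBetween.cls_eq_iff _ _).2
      (htpyEquivBetween_map_mappingCone P.ι X Y (liftHom f))).symm
  good_lift_op a δ X Y hX hY := by
    rw [inducedRealisation_eq_cls_iff] at hX hY
    obtain ⟨f, hf, hM⟩ := h.good_lift_op (P.ι.map a) δ _ _ hX hY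
    rw [mapBetween_dRight] at hM
    refine ⟨liftHom f, isLift_liftHom (by simpa using hf), ?_⟩
    rw [inducedRealisation_eq_cls_iff]
    exact hM.trans ((ComplexBetween.cls_eq_iff _ _).2
      (htpyEquivBetween_map_mappingCocone P.ι X Y (liftHom f))).symm

end InducedRealisation

end

end NExangulated

theorem theorem2p4 {C : Type u} [Category.{v} C] [Preadditive C] [HasZeroObject C]
    [HasBinaryBiproducts C]
    (n : ℕ) [NeZero n] (E : Cᵒᵖ ⥤ C ⥤ AddCommGrpCat.{w}) (s : RealisationMap n E)
    (hC : IsNExangulated E s)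
    (A : ObjectProperty C) [IsAdditiveSubcategory A] (hA : IsNExtensionClosed s A) :
    -- `t` does not depend on choices: the `t`-distinguished `n`-exangles are exactly the
    -- `s`-distinguished `n`-exangles with all terms in `A`
    (∀ (X₀ X₁ : A.FullSubcategory) (δ : Extn (restrictedBifunctor E A) X₁ X₀)
      (X : ComplexBetween n X₀ X₁), inducedRealisation s A hA δ = X.cls ↔
        s (A := X₀.obj) (C := X₁.obj) δ = (mapBetween A.ι X).cls) ∧
    IsNExangulated (restrictedBifunctor E A) (inducedRealisation s A hA) ∧
    IsNExangulatedFunctor (inducedRealisation s A hA) s A.ι (inclusionTransformation E A) ∧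
    A.ι.Full ∧ A.ι.Faithful ∧ IsIso (inclusionTransformation E A) :=
  ⟨fun _ _ δ X => inducedRealisation_eq_cls_iff hA δ X, hC.restrict hA, isNExangulatedFunctor_ι hA,
    inferInstance, inferInstance, inferInstanceAs (IsIso (𝟙 (restrictedBifunctor E A)))⟩
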